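/- Let $p\ge 0$ be an integer, $\beta=(\beta_1,\dots,\beta_p)\in\mathbb R^p$ such that all complex roots of $w^p=\beta_1w^{p-1}+\dots+\beta_p$ satisfy $|w|<1$, let $\mu\in\mathbb R$, $\nu=(1-\beta_1-\dots-\beta_p)\mu$, let $\Pi$ be a probability distribution on $\mathbb R$, and let $0\le\Gamma<\infty$. For $n\ge1$ and $0\le\gamma\le\Gamma$ put $\gamma_n=\min(1,\gamma n^{-1/2})$ and consider the observations $$y_t=v_t+z_t^{\gamma_n}\xi_t,\quad t=1-p,\dots,n,\qquad v_t=\beta_1v_{t-1}+\dots+\beta_pv_{t-p}+\nu+\varepsilon_t\quad(t\in\mathbb Z),$$ where $\{\varepsilon_t\}$ are i.i.d. with distribution function (d.f.) $G$, $\{v_t\}$ is a stationary solution of the autoregression, $\{z_t^{\gamma_n}\}$ are i.i.d. Bernoulli variables with values $1$ and $0$ and $P(z_t^{\gamma_n}=1)=\gamma_n$, $\{\xi_t\}$ are i.i.d. with distribution $\Pi$, and the sequences $\{v_t\}$, $\{z_t^{\gamma_n}\}$, $\{\xi_t\}$ are mutually independent. Let $\hat\mu_n\in\mathbb R$ and $\hat\beta_n=(\hat\beta_{1n},\dots,\hat\beta_{pn})\in\mathbb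 R^p$ be any estimators (random variables) with $n^{1/2}(\hat\mu_n-\mu)=O_P(1)$ and $n^{1/2}(\hat\beta_n-\beta)=O_P(1)$ as $n\to\infty$, uniformly in $\gamma\le\Gamma$. Put $\hat u_t=y_t-\hat\mu_n$, $\hat\varepsilon_t=\hat u_t-\hat\beta_{1n}\hat u_{t-1}-\dots-\hat\beta_{pn}\hat u_{t-p}$ for $t=1,\dots,n$, and $$\hat G_n(x)=\frac1n\sum_{t=1}^nI(\hat\varepsilon_t\le x),\quad G_n(x)=\frac1n\sum_{t=1}^nI(\varepsilon_t\le x),$$ $$\hat S_n(x)=\frac{\hat G_n(x)+1-\hat G_n(-x)}2,\quad S_n(x)=\frac{G_n(x)+1-G_n(-x)}2 .$$ For a d.f. $F$ let $\Delta_F(x,\Pi)=\sum_{j=0}^p\bigl[\mathsf E F(x+\beta_j\xi_1)-F(x)\bigr]$ with $\beta_0=-1$. Call a d.f. *admissible* if it has mean zero and finite variance and is twice differentiable with bounded second derivative; call it symmetric if $F(-x)=1-F(x)$ for all $x$. Assume one of the following two situations. 1. $G$ does not depend on $n$ and is admissible and symmetric; put $G_0=G$. 2. $G=A_n$ depends on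 $n$, $A_n(x)=(1-n^{-1/2})G_0(x)+n^{-1/2}H(x)$, where the d.f.s $G_0$ and $H$ are admissible and $G_0$ is symmetric ($H$ need not be symmetric). Then in either situation, with $\Delta_S(x,\Pi)=\bigl(\Delta_{G_0}(x,\Pi)-\Delta_{G_0}(-x,\Pi)\bigr)/2$, for every $x\in\mathbb R$ and every $\delta>0$, $$\sup_{0\le\gamma\le\Gamma}\mathsf P\Bigl(\bigl|n^{1/2}[\hat S_n(x)-S_n(x)]-\gamma\Delta_S(x,\Pi)\bigr|>\delta\Bigr)\to0,\qquad n\to\infty .$$ -/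

import Mathlib

open MeasureTheory ProbabilityTheory Filter Topology

noncomputable section

namespace ResidualAR

/-- All complex roots of `w ^ p = β₁ w ^ (p - 1) + ⋯ + β_p` lie in the open unit disc.
The coefficient `β_{j+1}` is `β j`, `j : Fin p`. -/
def RootsInUnitDisc {p : ℕ} (β : Fin p → ℝ) : Prop :=
  ∀ w : ℂ, w ^ p = ∑ j : Fin p, (β j : ℂ) * w ^ (p - 1 - (j : ℕ)) → ‖w‖ < 1

/-- A law on `ℝ` with mean zero and finite variance whose distribution function is twice
differentiable with a bounded second derivative.  (Such a law has no atoms, so that its variance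
is positive.) -/
structure IsSmoothCenteredLaw (Q : Measure ℝ) : Prop where
  finite_variance : MemLp (fun x : ℝ => x) 2 Q
  mean_zero : ∫ x, x ∂Q = 0
  differentiable_cdf : Differentiable ℝ (fun x => cdf Q x)
  differentiable_density : Differentiable ℝ (deriv fun x => cdf Q x)
  bounded_second_deriv : ∃ C : ℝ, ∀ x, |deriv (deriv fun x => cdf Q x) x| ≤ C

/-- The distribution function of `Q` is symmetric about zero. -/
def IsSymmetricCdf (Q : Measure ℝ) : Prop :=
  ∀ x : ℝ, cdf Q (-x) = 1 - cdf Q x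

/-- The distribution function `A_n = (1 - n^{-1/2}) G₀ + n^{-1/2} H`. -/
def mixtureCdf (Q₀ QH : Measure ℝ) (n : ℕ) (x : ℝ) : ℝ :=
  (1 - 1 / √(n : ℝ)) * cdf Q₀ x + 1 / √(n : ℝ) * cdf QH x

/-- The contamination level `γ_n = min (1, γ / √n)`. -/
def contaminationLevel (γ : ℝ) (n : ℕ) : ℝ := min 1 (γ / √(n : ℝ))

section Model

variable {Ω : Type*} [MeasurableSpace Ω]

/-- `v` is a (strictly) stationary solution of the autoregression
`v_t = β₁ v_{t-1} + ⋯ + β_p v_{t-p} + ν + ε_t`, `t ∈ ℤ`. -/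
structure IsStationarySolution (P : Measure Ω) {p : ℕ} (β : Fin p → ℝ) (ν : ℝ)
    (ε v : ℤ → Ω → ℝ) : Prop where
  measurable : ∀ t, Measurable (v t)
  stationary : ∀ h : ℤ,
    P.map (fun ω (t : ℤ) => v (t + h) ω) = P.map (fun ω (t : ℤ) => v t ω)
  equation : ∀ t : ℤ, ∀ᵐ ω ∂P,
    v t ω = ∑ j : Fin p, β j * v (t - ((j : ℕ) + 1)) ω + ν + ε t ω

/-- The autoregression with outliers: `ε` are i.i.d. with distribution function `F`, `v` is a
stationary solution of the autoregression with innovations `ε`, `z` are i.i.d. Bernoulli variables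
with success probability `q`, `ξ` are i.i.d. with law `Q`, and the three sequences `v`, `z`, `ξ`
are mutually independent. -/
structure IsContaminatedAR (P : Measure Ω) {p : ℕ} (β : Fin p → ℝ) (ν : ℝ)
    (F : ℝ → ℝ) (q : ℝ) (Q : Measure ℝ) (ε v z ξ : ℤ → Ω → ℝ) : Prop where
  innov_measurable : ∀ t, Measurable (ε t)
  innov_indep : iIndepFun ε P
  innov_cdf : ∀ t x, cdf (P.map (ε t)) x = F x
  solution : IsStationarySolution P β ν ε v
  bern_measurable : ∀ t, Measurable (z t)
  bern_indep : iIndepFun z P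
  bern_one : ∀ t, P {ω | z t ω = 1} = ENNReal.ofReal q
  bern_zero : ∀ t, P {ω | z t ω = 0} = ENNReal.ofReal (1 - q)
  outlier_measurable : ∀ t, Measurable (ξ t)
  outlier_indep : iIndepFun ξ P
  outlier_law : ∀ t, P.map (ξ t) = Q
  sequences_indep : iIndepFun (β := fun _ : Fin 3 => ℤ → ℝ)
    ![fun ω t => v t ω, fun ω t => z t ω, fun ω t => ξ t ω] P

end Model

/-- The residual `ε̂_t = û_t - β̂₁ û_{t-1} - ⋯ - β̂_p û_{t-p}`, with `û_t = y_t - m`, computed from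
the observations `y`, the estimated mean `m` and the estimated coefficients `b`. -/
def arResidual {p : ℕ} (y : ℤ → ℝ) (m : ℝ) (b : Fin p → ℝ) (t : ℤ) : ℝ :=
  (y t - m) - ∑ j : Fin p, b j * (y (t - ((j : ℕ) + 1)) - m)

/-- The empirical distribution function of `r 1, …, r n`. -/
def edf (n : ℕ) (r : ℤ → ℝ) (x : ℝ) : ℝ :=
  (n : ℝ)⁻¹ * ∑ t ∈ Finset.Icc (1 : ℤ) n, (Set.Iic x).indicator (fun _ => (1 : ℝ)) (r t)

/-- The symmetrization `(F(x) + 1 - F(-x)) / 2`. -/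
def symmetrize (F : ℝ → ℝ) (x : ℝ) : ℝ := (F x + 1 - F (-x)) / 2

/-- The shift `Δ(x, Q) = ∑_{j=0}^p (E F(x + β_j ξ) - F(x))`, where `β₀ = -1` and `ξ` has
law `Q`. -/
def shift {p : ℕ} (β : Fin p → ℝ) (F : ℝ → ℝ) (Q : Measure ℝ) (x : ℝ) : ℝ :=
  ∑ j : Fin (p + 1), (∫ s, F (x + Matrix.vecCons (-1) β j * s) ∂Q - F x)

/-- The symmetrized shift `(Δ(x, Q) - Δ(-x, Q)) / 2`. -/
def symmShift {p : ℕ} (β : Fin p → ℝ) (F : ℝ → ℝ) (Q : Measure ℝ) (x : ℝ) : ℝ :=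
  (shift β F Q x - shift β F Q (-x)) / 2

section Uniform

variable {Ω : ℕ → ℝ → Type*} [∀ n γ, MeasurableSpace (Ω n γ)]

/-- `X_n = O_P(1)` as `n → ∞`, uniformly in `0 ≤ γ ≤ Γ`; `X n γ` lives on its own probability
space `Ω n γ`. -/
def UniformlyBoundedInProb {E : Type*} [Norm E] (P : ∀ n γ, Measure (Ω n γ)) (Γ : ℝ)
    (X : ∀ n γ, Ω n γ → E) : Prop :=
  ∀ η : ENNReal, 0 < η → ∃ C : ℝ, ∀ᶠ n in atTop,
    ⨆ γ ∈ Set.Icc 0 Γ, P n γ {ω | C < ‖X n γ ω‖} ≤ η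

/-- `X_n = o_P(1)` as `n → ∞`, uniformly in `0 ≤ γ ≤ Γ`: for each `δ > 0`,
`sup_{γ ≤ Γ} P(|X_n| > δ) → 0`. -/
def UniformlyTendstoZeroInProb (P : ∀ n γ, Measure (Ω n γ)) (Γ : ℝ)
    (X : ∀ n γ, Ω n γ → ℝ) : Prop :=
  ∀ δ : ℝ, 0 < δ →
    Tendsto (fun n => ⨆ γ ∈ Set.Icc 0 Γ, P n γ {ω | δ < |X n γ ω|}) atTop (𝓝 0)

end Uniform

end ResidualAR

end

/-!
Given the past and the outliers, the residual at time `t` is at most `x` iff the innovation is at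
most `x` plus a small threshold, a function of the estimation errors, of the past of the
solution and of the outliers.  For a fixed value of the estimation errors, the empirical process
changes by an `L²` small sum of martingale differences and by a drift, which is expanded to first
order; since the indicators are monotone in the threshold, finite nets make the expansion uniform
over bounded estimation errors.  Its slope in the estimation errors is a multiple of the density
at `x`, which is even for a symmetric law, so that the symmetrization cancels it and only the shift
by the outliers survives.  The existence of a causal solution makes the past of the solution
independent of the present innovation.
-/

noncomputable section

namespace ResidualAR

section Causality

/-- The companion operator `x ↦ (∑ⱼ βⱼ xⱼ, x₀, …, x_{p-1})` of the autoregression.  It acts on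
`p + 1` coordinates, one more than necessary, so that `p = 0` is not exceptional. -/
def companion {R : Type*} [CommSemiring R] {p : ℕ} (β : Fin p → R) :
    (Fin (p + 1) → R) →ₗ[R] (Fin (p + 1) → R) where
  toFun x := Fin.cons (∑ j, β j * x j.castSucc) (Fin.init x)
  map_add' x y := by
    ext i
    refine Fin.cases ?_ (fun i => ?_) i <;> simp [Fin.init, mul_add, Finset.sum_add_distrib]
  map_smul' c x := by
    ext i
    refine Fin.cases ?_ (fun i => ?_) i <;> simp [Fin.init, Finset.mul_sum, mul_left_comm]

lemma companion_apply {R : Type*} [CommSemiring R] {p : ℕ} (β : Fin p → R) (x : Fin (p + 1) → R) :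
    companion β x = Fin.cons (∑ j, β j * x j.castSucc) (Fin.init x) := rfl

lemma eq_pow_mul_last_of_companion_eq_smul {R : Type*} [CommSemiring R] {p : ℕ} {β : Fin p → R}
    {l : R} {x : Fin (p + 1) → R} (h : companion β x = l • x) (i : Fin (p + 1)) :
    x i = l ^ (p - (i : ℕ)) * x (Fin.last p) := by
  induction i using Fin.reverseInduction with
  | last => simp
  | cast i ih =>
    have hi : x i.castSucc = l * x i.succ := by
      simpa [companion_apply, Fin.init] using congrFun h i.succ
    rw [hi, ih, ← mul_assoc, ← pow_succ']
    congr 2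
    simp only [Fin.val_succ, Fin.val_castSucc]
    omega

lemma norm_lt_one_of_companion_eq_smul {p : ℕ} {β : Fin p → ℝ} (hβ : RootsInUnitDisc β) {l : ℂ}
    {x : Fin (p + 1) → ℂ} (hx : x ≠ 0) (h : companion (fun j => (β j : ℂ)) x = l • x) :
    ‖l‖ < 1 := by
  rcases eq_or_ne l 0 with rfl | hl
  · simp
  have hcoord := eq_pow_mul_last_of_companion_eq_smul h
  have hlast : x (Fin.last p) ≠ 0 := fun h0 => hx (funext fun i => by simp [hcoord i, h0])
  have hfirst : ∑ j, (β j : ℂ) * x j.castSucc = l * x 0 := by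
    simpa [companion_apply] using congrFun h 0
  refine hβ l (mul_left_cancel₀ (mul_ne_zero hl hlast) ?_)
  calc l * x (Fin.last p) * l ^ p = l * x 0 := by rw [hcoord 0]; simp; ring
    _ = ∑ j, (β j : ℂ) * x j.castSucc := hfirst.symm
    _ = l * x (Fin.last p) * ∑ j : Fin p, (β j : ℂ) * l ^ (p - 1 - (j : ℕ)) := by
      rw [Finset.mul_sum]
      refine Finset.sum_congr rfl fun j _ => ?_
      rw [hcoord j.castSucc, Fin.val_castSucc,
        show p - (j : ℕ) = p - 1 - j + 1 by omega, pow_succ]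
      ring

lemma summable_norm_pow_of_spectralRadius_lt_one {A : Type*} [NormedRing A] [NormedAlgebra ℂ A]
    [CompleteSpace A] (a : A) (h : spectralRadius ℂ a < 1) : Summable fun k : ℕ => ‖a ^ k‖ := by
  obtain ⟨r, hr, hr1⟩ := ENNReal.lt_iff_exists_nnreal_btwn.1 h
  have hgelfand := spectrum.pow_nnnorm_pow_one_div_tendsto_nhds_spectralRadius a
  have hgeometric : ∀ᶠ k : ℕ in atTop, ‖a ^ k‖ ≤ (r : ℝ) ^ k := by
    filter_upwards [hgelfand.eventually_lt_const hr, eventually_gt_atTop 0] with k hk hk0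
    have hpow := ENNReal.rpow_le_rpow hk.le (Nat.cast_nonneg k : (0 : ℝ) ≤ k)
    rw [← ENNReal.rpow_mul, one_div_mul_cancel (by positivity), ENNReal.rpow_one,
      ENNReal.rpow_natCast] at hpow
    exact_mod_cast hpow
  refine Summable.of_norm_bounded_eventually_nat
    (summable_geometric_of_lt_one r.2 (by exact_mod_cast hr1)) ?_
  filter_upwards [hgeometric] with k hk using by simpa using hk

/-- The companion operator of a real autoregression as a bounded operator on `ℂ ^ (p + 1)`. -/
def companionCLM {p : ℕ} (β : Fin p → ℝ) : (Fin (p + 1) → ℂ) →L[ℂ] (Fin (p + 1) → ℂ) :=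
  LinearMap.toContinuousLinearMap (companion fun j => (β j : ℂ))

lemma summable_norm_companionCLM_pow {p : ℕ} {β : Fin p → ℝ} (hβ : RootsInUnitDisc β) :
    Summable fun k : ℕ => ‖companionCLM β ^ k‖ := by
  refine summable_norm_pow_of_spectralRadius_lt_one _ ?_
  suffices h : ∀ l ∈ spectrum ℂ (companionCLM β), ‖l‖₊ < 1 by
    simpa using spectrum.spectralRadius_lt_of_forall_lt _ h
  intro l hl
  have heigen : Module.End.HasEigenvalue (companion fun j => (β j : ℂ)) l := by
    rw [Module.End.hasEigenvalue_iff_mem_spectrum,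
      ← AlgEquiv.spectrum_eq (Module.End.toContinuousLinearMap (Fin (p + 1) → ℂ))]
    exact hl
  obtain ⟨x, hx⟩ := heigen.exists_hasEigenvector
  exact_mod_cast norm_lt_one_of_companion_eq_smul hβ hx.2 hx.apply_eq_smul

lemma eq_pow_apply_add_sum_of_recurrence {R E : Type*} [Semiring R] [AddCommMonoid E] [Module R E]
    [TopologicalSpace E] {B : E →L[R] E} {V f : ℤ → E} (h : ∀ s, V s = B (V (s - 1)) + f s)
    (t : ℤ) (m : ℕ) :
    V t = (B ^ m) (V (t - m)) + ∑ i ∈ Finset.range m, (B ^ i) (f (t - i)) := by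
  induction m with
  | zero => simp
  | succ m ih =>
    rw [ih, h (t - m), Finset.sum_range_succ, map_add, pow_succ,
      show t - (m : ℤ) - 1 = t - ((m + 1 : ℕ) : ℤ) by push_cast; ring]
    simp only [mul_apply_eq_comp]
    abel

/-- The path `u` solves the centred autoregression driven by the innovations `e`. -/
def SolvesAR {p : ℕ} (β : Fin p → ℝ) (u e : ℤ → ℝ) : Prop :=
  ∀ t, u t = ∑ j : Fin p, β j * u (t - ((j : ℕ) + 1)) + e t

/-- Causality of the autoregression: the moving averages of the innovations with the absolutely
summable weights `ψ` approximate every solution, with an error that the factors `ρ k → 0`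
control. -/
structure IsCausalExpansion {p : ℕ} (β : Fin p → ℝ) (ψ ρ : ℕ → ℝ) : Prop where
  summable : Summable fun i => |ψ i|
  tendsto_zero : Tendsto ρ atTop (𝓝 0)
  abs_sub_le : ∀ {u e : ℤ → ℝ}, SolvesAR β u e → ∀ (t : ℤ) (k : ℕ),
    |u t - ∑ i ∈ Finset.range k, ψ i * e (t - i)| ≤ ρ k * ∑ j : Fin (p + 1), |u (t - k - (j : ℕ))|

/-- The lags `(u_s, …, u_{s-p})`, the state on which the companion operator acts. -/
def lagVector (p : ℕ) (u : ℤ → ℝ) (s : ℤ) : Fin (p + 1) → ℂ := fun i => (u (s - (i : ℕ)) : ℂ)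

lemma norm_lagVector_le (p : ℕ) (u : ℤ → ℝ) (s : ℤ) :
    ‖lagVector p u s‖ ≤ ∑ j : Fin (p + 1), |u (s - (j : ℕ))| := by
  rw [pi_norm_le_iff_of_nonneg (Finset.sum_nonneg fun _ _ => abs_nonneg _)]
  intro i
  rw [lagVector, Complex.norm_real, Real.norm_eq_abs]
  exact Finset.single_le_sum (f := fun j : Fin (p + 1) => |u (s - (j : ℕ))|)
    (fun _ _ => abs_nonneg _) (Finset.mem_univ i)

lemma SolvesAR.lagVector_eq {p : ℕ} {β : Fin p → ℝ} {u e : ℤ → ℝ} (h : SolvesAR β u e) (s : ℤ) :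
    lagVector p u s = companionCLM β (lagVector p u (s - 1)) + (e s : ℂ) • Pi.single 0 1 := by
  ext i
  have hcomp : companionCLM β (lagVector p u (s - 1)) =
    Fin.cons (∑ j, (β j : ℂ) * lagVector p u (s - 1) j.castSucc)
      (Fin.init (lagVector p u (s - 1))) := companion_apply _ _
  rw [hcomp]
  refine Fin.cases ?_ (fun i => ?_) i
  · simp only [lagVector, Fin.val_castSucc, Pi.add_apply, Fin.cons_zero, Pi.smul_apply,
      Pi.single_eq_same, smul_eq_mul, mul_one, Fin.val_zero, Nat.cast_zero, sub_zero]
    rw [h s]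
    push_cast
    simp only [sub_sub, add_comm]
  · simp [lagVector, Fin.init, sub_sub, add_comm]

lemma RootsInUnitDisc.exists_isCausalExpansion {p : ℕ} {β : Fin p → ℝ} (hβ : RootsInUnitDisc β) :
    ∃ ψ ρ : ℕ → ℝ, IsCausalExpansion β ψ ρ := by
  set B := companionCLM β
  set impulse : Fin (p + 1) → ℂ := Pi.single 0 1
  have hsum := summable_norm_companionCLM_pow hβ
  refine ⟨fun i => ((B ^ i) impulse 0).re, fun k => ‖B ^ k‖, ?_, hsum.tendsto_atTop_zero, ?_⟩
  · refine Summable.of_nonneg_of_le (fun _ => abs_nonneg _) (fun i => ?_)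
      (hsum.mul_right ‖impulse‖)
    exact (Complex.abs_re_le_norm _).trans
      ((norm_le_pi_norm _ _).trans (ContinuousLinearMap.le_opNorm _ _))
  · intro u e h t k
    have hiter := congrArg Complex.re
      (congrFun (eq_pow_apply_add_sum_of_recurrence h.lagVector_eq t k) 0)
    have hremainder : u t - ∑ i ∈ Finset.range k, ((B ^ i) impulse 0).re * e (t - i) =
        ((B ^ k) (lagVector p u (t - k)) 0).re := by
      simp only [map_smul, Pi.add_apply, Finset.sum_apply, Pi.smul_apply, smul_eq_mul,
        Complex.add_re, Complex.re_sum, Complex.re_ofReal_mul, mul_comm (e _)] at hiter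
      rw [sub_eq_iff_eq_add, ← hiter]
      simp [lagVector]
    rw [hremainder]
    calc |((B ^ k) (lagVector p u (t - k)) 0).re| ≤ ‖(B ^ k) (lagVector p u (t - k))‖ :=
          (Complex.abs_re_le_norm _).trans (norm_le_pi_norm _ _)
      _ ≤ ‖B ^ k‖ * ‖lagVector p u (t - k)‖ := ContinuousLinearMap.le_opNorm _ _
      _ ≤ ‖B ^ k‖ * ∑ j : Fin (p + 1), |u (t - k - (j : ℕ))| :=
          mul_le_mul_of_nonneg_left (norm_lagVector_le _ _ _) (norm_nonneg _)

lemma RootsInUnitDisc.one_sub_sum_ne_zero {p : ℕ} {β : Fin p → ℝ} (hβ : RootsInUnitDisc β) :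
    1 - ∑ j, β j ≠ 0 := by
  intro h
  have hroot : (1 : ℂ) ^ p = ∑ j : Fin p, (β j : ℂ) * (1 : ℂ) ^ (p - 1 - (j : ℕ)) := by
    simp only [one_pow, mul_one]
    exact_mod_cast (sub_eq_zero.1 h)
  simpa using hβ 1 hroot

end Causality

section MovingAverage

variable {Ω : Type*} [MeasurableSpace Ω] {P : Measure Ω}

lemma tendstoInMeasure_mul_of_identDistrib [IsFiniteMeasure P] {X : Ω → ℝ} {Y : ℕ → Ω → ℝ}
    (hY : ∀ k, IdentDistrib (Y k) X P P) {ρ : ℕ → ℝ} (hρ : Tendsto ρ atTop (𝓝 0)) :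
    TendstoInMeasure P (fun k ω => ρ k * Y k ω) atTop (fun _ => 0) := by
  have hX : TendstoInMeasure P (fun k ω => ρ k * X ω) atTop (fun _ => (0 : ℝ)) := by
    refine tendstoInMeasure_of_tendsto_ae
      (fun k => ((hY k).aemeasurable_snd.const_mul _).aestronglyMeasurable)
      (Eventually.of_forall fun ω => ?_)
    simpa using hρ.mul_const (X ω)
  rw [tendstoInMeasure_iff_norm] at hX ⊢
  refine fun δ hδ => (hX δ hδ).congr fun k => ?_
  have hlarge : MeasurableSet {x : ℝ | δ ≤ ‖ρ k * x - 0‖} :=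
    measurableSet_le measurable_const
      ((measurable_const.mul measurable_id).sub_const 0).norm
  exact ((hY k).measure_mem_eq hlarge).symm

lemma exists_le_abs_mul_of_le_mul_sum {k : ℕ} {δ r : ℝ} (hδ : 0 < δ) {x : Fin (k + 1) → ℝ}
    (h : δ ≤ r * ∑ j, |x j|) : ∃ j, δ / (k + 1) ≤ |r * x j| := by
  by_contra! hsmall
  have hsum : ∑ j, |r * x j| < ∑ _j : Fin (k + 1), δ / (k + 1) :=
    Finset.sum_lt_sum_of_nonempty Finset.univ_nonempty fun j _ => hsmall j
  have hδ' : ∑ _j : Fin (k + 1), δ / (k + 1) = δ := by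
    simp only [Finset.sum_const, Finset.card_univ, Fintype.card_fin, nsmul_eq_mul]
    push_cast
    field_simp
  have hr : r * ∑ j, |x j| ≤ ∑ j, |r * x j| := by
    simp only [abs_mul, ← Finset.mul_sum]
    exact mul_le_mul_of_nonneg_right (le_abs_self r) (Finset.sum_nonneg fun _ _ => abs_nonneg _)
  linarith

lemma IsCausalExpansion.tendstoInMeasure [IsFiniteMeasure P] {p : ℕ} {β : Fin p → ℝ}
    {ψ ρ : ℕ → ℝ} (h : IsCausalExpansion β ψ ρ) {u ε : ℤ → Ω → ℝ}
    (hu : ∀ t, IdentDistrib (u t) (u 0) P P)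
    (hsol : ∀ᵐ ω ∂P, SolvesAR β (fun t => u t ω) (fun t => ε t ω)) (t : ℤ) :
    TendstoInMeasure P (fun (k : ℕ) ω => ∑ i ∈ Finset.range k, ψ i * ε (t - i) ω) atTop (u t) := by
  rw [tendstoInMeasure_iff_norm]
  intro δ hδ
  have hlag : Tendsto (fun k : ℕ => ∑ j : Fin (p + 1),
      P {ω | δ / (p + 1) ≤ |ρ k * u (t - k - (j : ℕ)) ω|}) atTop (𝓝 0) := by
    rw [← Finset.sum_const_zero (s := (Finset.univ : Finset (Fin (p + 1))))]
    refine tendsto_finsetSum _ fun j _ => ?_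
    simpa using tendstoInMeasure_iff_norm.1
      (tendstoInMeasure_mul_of_identDistrib (fun k : ℕ => hu (t - k - (j : ℕ))) h.tendsto_zero)
      (δ / (p + 1)) (by positivity)
  refine tendsto_of_tendsto_of_tendsto_of_le_of_le tendsto_const_nhds hlag
    (fun _ => zero_le) fun k => ?_
  refine (measure_mono_ae ?_).trans (measure_iUnion_fintype_le P _)
  filter_upwards [hsol] with ω hω hδω
  refine Set.mem_iUnion.2 (exists_le_abs_mul_of_le_mul_sum hδ ?_)
  refine le_trans ?_ (h.abs_sub_le hω t k)
  rwa [← Real.norm_eq_abs, norm_sub_rev]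

lemma exists_measurable_modification {ψ : ℕ → ℝ} {X : Ω → ℝ} {ε : ℤ → Ω → ℝ} {t : ℤ}
    (hlim : TendstoInMeasure P (fun (k : ℕ) ω => ∑ i ∈ Finset.range k, ψ i * ε (t - i) ω)
      atTop X) :
    ∃ Y : Ω → ℝ, (∀ m : MeasurableSpace Ω, (∀ s ≤ t, Measurable[m] (ε s)) → Measurable[m] Y) ∧
      Y =ᵐ[P] X := by
  obtain ⟨ns, -, hns⟩ := hlim.exists_seq_tendsto_ae
  refine ⟨fun ω => limUnder atTop fun i => ∑ i ∈ Finset.range (ns i), ψ i * ε (t - i) ω,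
    fun m hm => ?_, ?_⟩
  · refine (StronglyMeasurable.limUnder fun i => Measurable.stronglyMeasurable ?_).measurable
    exact Finset.measurable_sum _ fun j _ => (hm _ (by omega)).const_mul _
  · filter_upwards [hns] with ω hω using hω.limUnder_eq

lemma eLpNorm_le_of_tendstoInMeasure_movingAverage {ψ : ℕ → ℝ} (hψ : Summable fun i => |ψ i|)
    {X : Ω → ℝ} {ε : ℤ → Ω → ℝ} {t : ℤ} {r : ENNReal} (hr : 1 ≤ r)
    (hε : ∀ s, AEStronglyMeasurable (ε s) P) {σ : ℝ} (hσ0 : 0 ≤ σ)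
    (hσ : ∀ s, eLpNorm (ε s) r P ≤ ENNReal.ofReal σ)
    (hlim : TendstoInMeasure P (fun (k : ℕ) ω => ∑ i ∈ Finset.range k, ψ i * ε (t - i) ω)
      atTop X) :
    eLpNorm X r P ≤ ENNReal.ofReal ((∑' i, |ψ i|) * σ) := by
  have hterm : ∀ i : ℕ, AEStronglyMeasurable (ψ i • ε (t - i)) P := fun i => (hε _).const_smul _
  have hsum : ∀ k : ℕ, (fun ω => ∑ i ∈ Finset.range k, ψ i * ε (t - i) ω)
      = ∑ i ∈ Finset.range k, ψ i • ε (t - i) := fun k => by ext ω; simp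
  rw [funext hsum] at hlim
  refine eLpNorm_le_of_tendstoInMeasure (Eventually.of_forall fun k => ?_) hlim fun k =>
    Finset.aestronglyMeasurable_sum _ fun i _ => hterm i
  calc eLpNorm (∑ i ∈ Finset.range k, ψ i • ε (t - i)) r P
      ≤ ∑ i ∈ Finset.range k, eLpNorm (ψ i • ε (t - i)) r P :=
        eLpNorm_sum_le (fun i _ => hterm i) hr
    _ ≤ ∑ i ∈ Finset.range k, ENNReal.ofReal (|ψ i| * σ) := by
        refine Finset.sum_le_sum fun i _ => ?_
        rw [eLpNorm_const_smul, ENNReal.ofReal_mul (abs_nonneg _), ← Real.norm_eq_abs, ofReal_norm]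
        exact mul_le_mul_right (hσ _) _
    _ = ENNReal.ofReal ((∑ i ∈ Finset.range k, |ψ i|) * σ) := by
        rw [Finset.sum_mul, ENNReal.ofReal_sum_of_nonneg fun _ _ => by positivity]
    _ ≤ ENNReal.ofReal ((∑' i, |ψ i|) * σ) :=
        ENNReal.ofReal_le_ofReal (mul_le_mul_of_nonneg_right
          (hψ.sum_le_tsum _ fun _ _ => abs_nonneg _) hσ0)

end MovingAverage

section Independence

variable {Ω : Type*} [MeasurableSpace Ω] {P : Measure Ω}

lemma indepFun_prodMk_of_indepFun [IsProbabilityMeasure P] {α β γ : Type*} [MeasurableSpace α]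
    [MeasurableSpace β] [MeasurableSpace γ] {X : Ω → α} {Y : Ω → β} {Z : Ω → γ}
    (hX : AEMeasurable X P) (hY : AEMeasurable Y P) (hZ : AEMeasurable Z P)
    (hXY : IndepFun X Y P) (hXYZ : IndepFun (fun ω => (X ω, Y ω)) Z P) :
    IndepFun X (fun ω => (Y ω, Z ω)) P := by
  have hYZ : IndepFun Y Z P := hXYZ.comp measurable_snd measurable_id
  rw [indepFun_iff_map_prod_eq_prod_map_map hX (hY.prodMk hZ)]
  rw [indepFun_iff_map_prod_eq_prod_map_map hX hY] at hXY
  rw [indepFun_iff_map_prod_eq_prod_map_map (hX.prodMk hY) hZ, hXY] at hXYZ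
  rw [indepFun_iff_map_prod_eq_prod_map_map hY hZ] at hYZ
  have := Measure.isProbabilityMeasure_map (μ := P) hX
  have := Measure.isProbabilityMeasure_map (μ := P) hY
  have := Measure.isProbabilityMeasure_map (μ := P) hZ
  rw [hYZ, ← Measure.prodAssoc_prod, ← hXYZ, AEMeasurable.map_map_of_aemeasurable
    MeasurableEquiv.prodAssoc.measurable.aemeasurable ((hX.prodMk hY).prodMk hZ)]
  rfl

lemma indepFun_past {ι α : Type*} [Preorder ι] [MeasurableSpace α] {ε : ι → Ω → α}
    (hε : ∀ t, Measurable (ε t)) (h : iIndepFun ε P) (t : ι) :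
    IndepFun (ε t) (fun ω (s : Set.Iio t) => ε s ω) P := by
  rw [IndepFun_iff_Indep]
  have hdisj := indep_iSup_of_disjoint (m := fun s => MeasurableSpace.comap (ε s) inferInstance)
    (fun s => (hε s).comap_le) h.iIndep (S := {t}) (T := Set.Iio t) (by simp)
  refine indep_of_indep_of_le hdisj (by simp) ?_
  rw [MeasurableSpace.pi, MeasurableSpace.comap_iSup]
  refine iSup_le fun s => ?_
  rw [MeasurableSpace.comap_comp]
  exact le_iSup₂_of_le (s : ι) s.2 le_rfl

end Independence

section PastAlgebra

variable {Ω : Type*} {ε z ξ : ℤ → Ω → ℝ}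

/-- The innovations before time `t` together with both outlier sequences. -/
def pastAndOutliers (ε z ξ : ℤ → Ω → ℝ) (t : ℤ) (ω : Ω) :
    (Set.Iio t → ℝ) × ((ℤ → ℝ) × (ℤ → ℝ)) :=
  ((fun s => ε s ω), ((fun s => z s ω), (fun s => ξ s ω)))

/-- The σ-algebra of the innovations before time `t` and of both outlier sequences. -/
abbrev pastAlgebra (ε z ξ : ℤ → Ω → ℝ) (t : ℤ) : MeasurableSpace Ω :=
  MeasurableSpace.comap (pastAndOutliers ε z ξ t) inferInstance

lemma measurable_innov_pastAlgebra {s t : ℤ} (hst : s < t) :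
    Measurable[pastAlgebra ε z ξ t] (ε s) :=
  ((measurable_pi_apply (⟨s, hst⟩ : Set.Iio t)).comp measurable_fst).comp
    (comap_measurable (pastAndOutliers ε z ξ t))

lemma measurable_bern_pastAlgebra (s t : ℤ) : Measurable[pastAlgebra ε z ξ t] (z s) :=
  ((measurable_pi_apply s).comp (measurable_fst.comp measurable_snd)).comp
    (comap_measurable (pastAndOutliers ε z ξ t))

lemma measurable_outlier_pastAlgebra (s t : ℤ) : Measurable[pastAlgebra ε z ξ t] (ξ s) :=
  ((measurable_pi_apply s).comp (measurable_snd.comp measurable_snd)).comp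
    (comap_measurable (pastAndOutliers ε z ξ t))

lemma pastAlgebra_le [MeasurableSpace Ω] (hε : ∀ t, Measurable (ε t)) (hz : ∀ t, Measurable (z t))
    (hξ : ∀ t, Measurable (ξ t)) (t : ℤ) :
    pastAlgebra ε z ξ t ≤ inferInstanceAs (MeasurableSpace Ω) :=
  ((measurable_pi_lambda _ fun _ => hε _).prodMk
    ((measurable_pi_lambda _ hz).prodMk (measurable_pi_lambda _ hξ))).comap_le

end PastAlgebra

section Model

variable {Ω : Type*} [MeasurableSpace Ω] {P : Measure Ω}

lemma IsStationarySolution.identDistrib {p : ℕ} {β : Fin p → ℝ} {ν : ℝ} {ε v : ℤ → Ω → ℝ}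
    (h : IsStationarySolution P β ν ε v) (t : ℤ) : IdentDistrib (v t) (v 0) P P := by
  have hshift : IdentDistrib (fun ω (s : ℤ) => v (s + t) ω) (fun ω (s : ℤ) => v s ω) P P :=
    ⟨(measurable_pi_lambda _ fun _ => h.measurable _).aemeasurable,
      (measurable_pi_lambda _ fun _ => h.measurable _).aemeasurable, h.stationary t⟩
  simpa [Function.comp_def] using hshift.comp (measurable_pi_apply (0 : ℤ))

lemma IsStationarySolution.solvesAR_sub {p : ℕ} {β : Fin p → ℝ} {ν μ : ℝ} {ε v : ℤ → Ω → ℝ}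
    (h : IsStationarySolution P β ν ε v) (hν : ν = (1 - ∑ j, β j) * μ) :
    ∀ᵐ ω ∂P, SolvesAR β (fun t => v t ω - μ) (fun t => ε t ω) := by
  filter_upwards [ae_all_iff.2 h.equation] with ω hω t
  beta_reduce
  rw [hω t, hν]
  simp only [mul_sub, Finset.sum_sub_distrib, ← Finset.sum_mul]
  ring

namespace IsContaminatedAR

variable {p : ℕ} {β : Fin p → ℝ} {ν : ℝ} {F : ℝ → ℝ} {q : ℝ} {Q : Measure ℝ}
  {ε v z ξ : ℤ → Ω → ℝ}

lemma bern_zero_or_one [IsProbabilityMeasure P] (h : IsContaminatedAR P β ν F q Q ε v z ξ)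
    (hq : q ∈ Set.Icc 0 1) (t : ℤ) : ∀ᵐ ω ∂P, z t ω = 0 ∨ z t ω = 1 := by
  have hone : MeasurableSet {ω | z t ω = 1} := h.bern_measurable t (measurableSet_singleton 1)
  have hzero : MeasurableSet {ω | z t ω = 0} := h.bern_measurable t (measurableSet_singleton 0)
  have hdisj : Disjoint {ω | z t ω = 0} {ω | z t ω = 1} :=
    Set.disjoint_left.2 fun ω h0 h1 => zero_ne_one (h0.symm.trans h1)
  have hunion : P ({ω | z t ω = 0} ∪ {ω | z t ω = 1}) = 1 := by
    rw [measure_union hdisj hone, h.bern_zero, h.bern_one,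
      ← ENNReal.ofReal_add (sub_nonneg.2 hq.2) hq.1]
    simp
  exact (mem_ae_iff_prob_eq_one (hzero.union hone)).2 hunion

lemma integral_bern [IsProbabilityMeasure P] (h : IsContaminatedAR P β ν F q Q ε v z ξ)
    (hq : q ∈ Set.Icc 0 1) (t : ℤ) : ∫ ω, z t ω ∂P = q := by
  have hone : MeasurableSet {ω | z t ω = 1} := h.bern_measurable t (measurableSet_singleton 1)
  have hind : z t =ᵐ[P] {ω | z t ω = 1}.indicator (fun _ => (1 : ℝ)) := by
    filter_upwards [h.bern_zero_or_one hq t] with ω hω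
    rcases hω with h0 | h1 <;> simp [Set.indicator, *]
  rw [integral_congr_ae hind, integral_indicator_const _ hone, Measure.real, h.bern_one,
    ENNReal.toReal_ofReal hq.1, smul_eq_mul, mul_one]

lemma map_innov [IsProbabilityMeasure P] (h : IsContaminatedAR P β ν F q Q ε v z ξ)
    {L : Measure ℝ} [IsProbabilityMeasure L] (hL : ∀ x, cdf L x = F x) (t : ℤ) :
    P.map (ε t) = L := by
  have := Measure.isProbabilityMeasure_map (μ := P) (h.innov_measurable t).aemeasurable
  apply Measure.eq_of_cdf
  ext x
  rw [h.innov_cdf, hL]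

lemma measurable_outliers (h : IsContaminatedAR P β ν F q Q ε v z ξ) :
    Measurable fun ω => ((fun t => z t ω), (fun t => ξ t ω)) :=
  (measurable_pi_lambda _ h.bern_measurable).prodMk (measurable_pi_lambda _ h.outlier_measurable)

lemma indepFun_solution (h : IsContaminatedAR P β ν F q Q ε v z ξ) :
    IndepFun (fun ω t => v t ω) (fun ω => ((fun t => z t ω), (fun t => ξ t ω))) P := by
  have hmeas : ∀ i, Measurable ((![fun ω t => v t ω, fun ω t => z t ω, fun ω t => ξ t ω] :
      Fin 3 → Ω → ℤ → ℝ) i) :=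
    Fin.forall_fin_succ.2 ⟨measurable_pi_lambda _ h.solution.measurable,
      Fin.forall_fin_two.2 ⟨measurable_pi_lambda _ h.bern_measurable,
        measurable_pi_lambda _ h.outlier_measurable⟩⟩
  exact (h.sequences_indep.indepFun_prodMk hmeas 1 2 0 (by decide) (by decide)).symm

lemma indepFun_bern_outlier (h : IsContaminatedAR P β ν F q Q ε v z ξ) :
    IndepFun (fun ω t => z t ω) (fun ω t => ξ t ω) P :=
  h.sequences_indep.indepFun (show (1 : Fin 3) ≠ 2 by decide)

lemma indepFun_innov (h : IsContaminatedAR P β ν F q Q ε v z ξ) :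
    IndepFun (fun ω t => ε t ω) (fun ω => ((fun t => z t ω), (fun t => ξ t ω))) P := by
  have hfilter : Measurable fun (w : ℤ → ℝ) (t : ℤ) =>
      w t - ∑ j : Fin p, β j * w (t - ((j : ℕ) + 1)) - ν := by fun_prop
  refine (h.indepFun_solution.comp hfilter measurable_id).congr ?_ (ae_eq_refl _)
  filter_upwards [ae_all_iff.2 h.solution.equation] with ω hω
  funext t
  change v t ω - ∑ j : Fin p, β j * v (t - ((j : ℕ) + 1)) ω - ν = ε t ω
  rw [hω t]
  ring

end IsContaminatedAR

lemma IsContaminatedAR.indep_pastAlgebra [IsProbabilityMeasure P] {p : ℕ} {β : Fin p → ℝ}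
    {ν : ℝ} {F : ℝ → ℝ} {q : ℝ} {Q : Measure ℝ} {ε v z ξ : ℤ → Ω → ℝ}
    (h : IsContaminatedAR P β ν F q Q ε v z ξ) (t : ℤ) :
    Indep (MeasurableSpace.comap (ε t) inferInstance) (pastAlgebra ε z ξ t) P := by
  have hpast : Measurable fun ω (s : Set.Iio t) => ε s ω :=
    measurable_pi_lambda _ fun s => h.innov_measurable _
  have hsplit : Measurable fun w : ℤ → ℝ => (w t, fun s : Set.Iio t => w s) := by fun_prop
  exact (IndepFun_iff_Indep _ _ _).1 (indepFun_prodMk_of_indepFun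
    (h.innov_measurable t).aemeasurable hpast.aemeasurable h.measurable_outliers.aemeasurable
    (indepFun_past h.innov_measurable h.innov_indep t)
    (h.indepFun_innov.comp hsplit measurable_id))

/-- The properties of the centred model that the asymptotic analysis uses.  The process `u` is a
modification of the centred solution for which `u s` is measurable with respect to the past of
every `t > s`, `L` is the law of the innovations, and `κ` bounds the `L²` norm of `u t`. -/
structure IsRegularModel (P : Measure Ω) {p : ℕ} (β : Fin p → ℝ) (L Q : Measure ℝ) (q κ : ℝ)
    (ε u z ξ : ℤ → Ω → ℝ) : Prop where
  innov_measurable : ∀ t, Measurable (ε t)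
  sol_measurable : ∀ t, Measurable (u t)
  bern_measurable : ∀ t, Measurable (z t)
  outlier_measurable : ∀ t, Measurable (ξ t)
  sol_past : ∀ {s t}, s < t → Measurable[pastAlgebra ε z ξ t] (u s)
  innov_indep_past : ∀ t,
    Indep (MeasurableSpace.comap (ε t) inferInstance) (pastAlgebra ε z ξ t) P
  innov_law : ∀ t, P.map (ε t) = L
  sol_norm : ∀ t, eLpNorm (u t) 2 P ≤ ENNReal.ofReal κ
  equation : ∀ᵐ ω ∂P, SolvesAR β (fun t => u t ω) (fun t => ε t ω)
  bern_zero_or_one : ∀ᵐ ω ∂P, ∀ t, z t ω = 0 ∨ z t ω = 1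
  integral_bern : ∀ t, ∫ ω, z t ω ∂P = q
  bern_indep : iIndepFun z P
  outlier_indep : iIndepFun ξ P
  outlier_law : ∀ t, P.map (ξ t) = Q
  bern_indep_outlier : IndepFun (fun ω t => z t ω) (fun ω t => ξ t ω) P
  bern_indep_sol : ∀ s t, IndepFun (z s) (u t) P

lemma IsContaminatedAR.exists_isRegularModel [IsProbabilityMeasure P] {p : ℕ} {β : Fin p → ℝ}
    {ν μ : ℝ} {F : ℝ → ℝ} {q : ℝ} {Q : Measure ℝ} {ε v z ξ : ℤ → Ω → ℝ}
    (h : IsContaminatedAR P β ν F q Q ε v z ξ) (hq : q ∈ Set.Icc 0 1)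
    (hν : ν = (1 - ∑ j, β j) * μ) {ψ ρ : ℕ → ℝ} (hψ : IsCausalExpansion β ψ ρ)
    {L : Measure ℝ} [IsProbabilityMeasure L] (hL : ∀ x, cdf L x = F x) {σ : ℝ} (hσ0 : 0 ≤ σ)
    (hσ : eLpNorm (fun x : ℝ => x) 2 L ≤ ENNReal.ofReal σ) :
    ∃ u : ℤ → Ω → ℝ, IsRegularModel P β L Q q ((∑' i, |ψ i|) * σ) ε u z ξ ∧
      ∀ᵐ ω ∂P, ∀ t, v t ω = u t ω + μ := by
  have hlaw := h.map_innov hL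
  have hsol := h.solution.solvesAR_sub hν
  have hlim := hψ.tendstoInMeasure (u := fun t ω => v t ω - μ)
    (fun t => (h.solution.identDistrib t).comp (measurable_id.sub_const μ)) hsol
  have hnorm : ∀ t, eLpNorm (ε t) 2 P ≤ ENNReal.ofReal σ := fun t => by
    rwa [← hlaw t, eLpNorm_map_measure measurable_id'.aestronglyMeasurable
      (h.innov_measurable t).aemeasurable] at hσ
  choose u hmeas hmod using fun t => exists_measurable_modification (hlim t)
  have hmod_all : ∀ᵐ ω ∂P, ∀ t, u t ω = v t ω - μ := ae_all_iff.2 hmod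
  refine ⟨u, ?_, by filter_upwards [hmod_all] with ω hω t using by rw [hω t]; ring⟩
  exact
    { innov_measurable := h.innov_measurable
      sol_measurable := fun t => hmeas t _ fun s _ => h.innov_measurable s
      bern_measurable := h.bern_measurable
      outlier_measurable := h.outlier_measurable
      sol_past := fun hst => hmeas _ _ fun r hr => measurable_innov_pastAlgebra (hr.trans_lt hst)
      innov_indep_past := h.indep_pastAlgebra
      innov_law := hlaw
      sol_norm := fun t => (eLpNorm_congr_ae (hmod t)).trans_le
        (eLpNorm_le_of_tendstoInMeasure_movingAverage hψ.summable one_le_two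
          (fun s => (h.innov_measurable s).aestronglyMeasurable) hσ0 hnorm (hlim t))
      equation := by
        filter_upwards [hmod_all, hsol] with ω hω hsolω
        simpa only [hω] using hsolω
      bern_zero_or_one := ae_all_iff.2 fun t => h.bern_zero_or_one hq t
      integral_bern := h.integral_bern hq
      bern_indep := h.bern_indep
      outlier_indep := h.outlier_indep
      outlier_law := h.outlier_law
      bern_indep_outlier := h.indepFun_bern_outlier
      bern_indep_sol := fun s t => (h.indepFun_solution.symm.comp
        (φ := fun w : (ℤ → ℝ) × (ℤ → ℝ) => w.1 s) (ψ := fun w : ℤ → ℝ => w t - μ)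
        (by fun_prop) (by fun_prop)).congr (ae_eq_refl _) (hmod t).symm }

namespace IsRegularModel

variable {p : ℕ} {β : Fin p → ℝ} {L Q : Measure ℝ} {q κ : ℝ} {ε u z ξ : ℤ → Ω → ℝ}

lemma pastAlgebra_le (hm : IsRegularModel P β L Q q κ ε u z ξ) (t : ℤ) :
    pastAlgebra ε z ξ t ≤ inferInstanceAs (MeasurableSpace Ω) :=
  ResidualAR.pastAlgebra_le hm.innov_measurable hm.bern_measurable hm.outlier_measurable t

lemma indepFun_innov (hm : IsRegularModel P β L Q q κ ε u z ξ) {s t : ℤ} (hst : s ≠ t) :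
    IndepFun (ε s) (ε t) P := by
  wlog h : s < t generalizing s t
  · exact (this hst.symm (hst.lt_or_gt.resolve_left h)).symm
  exact ((IndepFun_iff_Indep _ _ _).2 (indep_of_indep_of_le_right (hm.innov_indep_past t)
    (measurable_innov_pastAlgebra h).comap_le)).symm

lemma integral_outlier (hm : IsRegularModel P β L Q q κ ε u z ξ) {φ : ℝ → ℝ} (hφ : Measurable φ)
    (t : ℤ) : ∫ ω, φ (ξ t ω) ∂P = ∫ x, φ x ∂Q := by
  rw [← hm.outlier_law t, integral_map (hm.outlier_measurable t).aemeasurable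
    hφ.aestronglyMeasurable]

lemma integral_bern_mul_bern (hm : IsRegularModel P β L Q q κ ε u z ξ) {s t : ℤ} (hst : s ≠ t) :
    ∫ ω, z s ω * z t ω ∂P = q ^ 2 := by
  rw [(hm.bern_indep.indepFun hst).integral_fun_mul_eq_mul_integral
    (hm.bern_measurable s).aestronglyMeasurable (hm.bern_measurable t).aestronglyMeasurable,
    hm.integral_bern, hm.integral_bern, sq]

lemma integral_bern_mul_abs_sol (hm : IsRegularModel P β L Q q κ ε u z ξ) (s t : ℤ) :
    ∫ ω, z s ω * |u t ω| ∂P = q * ∫ ω, |u t ω| ∂P := by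
  have hindep : IndepFun (z s) (fun ω => |u t ω|) P :=
    (hm.bern_indep_sol s t).comp measurable_id measurable_id.abs
  rw [hindep.integral_fun_mul_eq_mul_integral (hm.bern_measurable s).aestronglyMeasurable
    (hm.sol_measurable t).abs.aestronglyMeasurable, hm.integral_bern]

lemma integral_bern_mul_outlier (hm : IsRegularModel P β L Q q κ ε u z ξ) {φ : ℝ → ℝ}
    (hφ : Measurable φ) (t : ℤ) : ∫ ω, z t ω * φ (ξ t ω) ∂P = q * ∫ x, φ x ∂Q := by
  have hindep : IndepFun (fun ω => z t ω) (fun ω => φ (ξ t ω)) P :=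
    hm.bern_indep_outlier.comp (φ := fun w : ℤ → ℝ => w t) (ψ := fun w : ℤ → ℝ => φ (w t))
      (by fun_prop) (by fun_prop)
  rw [hindep.integral_fun_mul_eq_mul_integral (hm.bern_measurable t).aestronglyMeasurable
    (hφ.comp (hm.outlier_measurable t)).aestronglyMeasurable, hm.integral_bern,
    hm.integral_outlier hφ]

lemma integral_bern_mul_outlier_pair (hm : IsRegularModel P β L Q q κ ε u z ξ) {φ : ℝ → ℝ}
    (hφ : Measurable φ) {s t : ℤ} (hst : s ≠ t) :
    ∫ ω, (z s ω * φ (ξ s ω)) * (z t ω * φ (ξ t ω)) ∂P = (q * ∫ x, φ x ∂Q) ^ 2 := by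
  have hindep : IndepFun (fun ω => z s ω * z t ω) (fun ω => φ (ξ s ω) * φ (ξ t ω)) P :=
    hm.bern_indep_outlier.comp (φ := fun w : ℤ → ℝ => w s * w t)
      (ψ := fun w : ℤ → ℝ => φ (w s) * φ (w t)) (by fun_prop) (by fun_prop)
  have hindep_outlier : IndepFun (fun ω => φ (ξ s ω)) (fun ω => φ (ξ t ω)) P :=
    (hm.outlier_indep.indepFun hst).comp hφ hφ
  have houtlier : ∀ r, AEStronglyMeasurable (fun ω => φ (ξ r ω)) P := fun r =>
    (hφ.comp (hm.outlier_measurable r)).aestronglyMeasurable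
  calc ∫ ω, (z s ω * φ (ξ s ω)) * (z t ω * φ (ξ t ω)) ∂P
      = ∫ ω, (z s ω * z t ω) * (φ (ξ s ω) * φ (ξ t ω)) ∂P := by
        simp only [mul_mul_mul_comm]
    _ = (∫ ω, z s ω * z t ω ∂P) * ∫ ω, φ (ξ s ω) * φ (ξ t ω) ∂P :=
        hindep.integral_fun_mul_eq_mul_integral
          ((hm.bern_measurable s).mul (hm.bern_measurable t)).aestronglyMeasurable
          ((houtlier s).mul (houtlier t))
    _ = q ^ 2 * ((∫ x, φ x ∂Q) * ∫ x, φ x ∂Q) := by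
        rw [hm.integral_bern_mul_bern hst, hindep_outlier.integral_fun_mul_eq_mul_integral
          (houtlier s) (houtlier t), hm.integral_outlier hφ, hm.integral_outlier hφ]
    _ = (q * ∫ x, φ x ∂Q) ^ 2 := by ring

end IsRegularModel

end Model

section Expansion

/-- `F` has oscillation at most one, is `C`-Lipschitz, and has at `x` a first order expansion with
slope `g` and quadratic remainder; this is the regularity of the distribution function of the
innovations that enters the asymptotics. -/
structure HasExpansion (F : ℝ → ℝ) (C x g : ℝ) : Prop where
  nonneg : 0 ≤ C
  abs_sub_le_one : ∀ a b, |F a - F b| ≤ 1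
  abs_sub_le : ∀ a b, |F a - F b| ≤ C * |a - b|
  abs_slope_le : |g| ≤ C
  abs_remainder_le : ∀ a, |F (x + a) - F x - g * a| ≤ C * a ^ 2

lemma abs_cdf_sub_le_one (Q : Measure ℝ) (a b : ℝ) : |cdf Q a - cdf Q b| ≤ 1 := by
  rw [abs_le]
  constructor <;> linarith [cdf_nonneg Q a, cdf_nonneg Q b, cdf_le_one Q a, cdf_le_one Q b]

lemma abs_sub_sub_deriv_mul_le {f : ℝ → ℝ} (hf : Differentiable ℝ f) {M : ℝ}
    (hM : ∀ a b, |deriv f a - deriv f b| ≤ M * |a - b|) (x a : ℝ) :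
    |f (x + a) - f x - deriv f x * a| ≤ M * a ^ 2 := by
  have hM0 : 0 ≤ M := by simpa using (abs_nonneg _).trans (hM 1 0)
  have hderiv : ∀ y, HasDerivAt (fun y => f y - deriv f x * y) (deriv f y - deriv f x) y :=
    fun y => by
      have hsub := (hf y).hasDerivAt.sub ((hasDerivAt_id y).const_mul (deriv f x))
      rwa [mul_one] at hsub
  have hbound : ∀ y ∈ Metric.closedBall x |a|, ‖deriv (fun y => f y - deriv f x * y) y‖
      ≤ M * |a| := fun y hy => by
    rw [(hderiv y).deriv, Real.norm_eq_abs]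
    exact (hM y x).trans (mul_le_mul_of_nonneg_left (by simpa [Real.dist_eq] using hy) hM0)
  have hmvt := Convex.norm_image_sub_le_of_norm_deriv_le (x := x) (y := x + a)
    (fun y _ => (hderiv y).differentiableAt) hbound (convex_closedBall x |a|) (by simp) (by simp)
  rw [Real.norm_eq_abs, Real.norm_eq_abs] at hmvt
  calc |f (x + a) - f x - deriv f x * a|
      = |f (x + a) - deriv f x * (x + a) - (f x - deriv f x * x)| := by congr 1; ring
    _ ≤ M * |a| * |x + a - x| := hmvt
    _ = M * a ^ 2 := by rw [add_sub_cancel_left, mul_assoc, ← sq, sq_abs]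

lemma abs_sub_le_of_abs_deriv_le {f : ℝ → ℝ} (hf : Differentiable ℝ f) {M : ℝ}
    (hM : ∀ x, |deriv f x| ≤ M) (a b : ℝ) : |f a - f b| ≤ M * |a - b| :=
  Convex.norm_image_sub_le_of_norm_deriv_le (s := Set.univ) (fun x _ => hf x) (fun x _ => hM x)
    convex_univ (Set.mem_univ b) (Set.mem_univ a)

lemma IsSmoothCenteredLaw.exists_hasExpansion {Q : Measure ℝ} (h : IsSmoothCenteredLaw Q) :
    ∃ C : ℝ, ∀ x, HasExpansion (fun y => cdf Q y) C x (deriv (fun y => cdf Q y) x) := by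
  obtain ⟨M, hM⟩ := h.bounded_second_deriv
  set F : ℝ → ℝ := fun y => cdf Q y
  have hM0 : 0 ≤ M := (abs_nonneg _).trans (hM 0)
  have hexp := abs_sub_sub_deriv_mul_le h.differentiable_cdf
    (abs_sub_le_of_abs_deriv_le h.differentiable_density hM)
  -- the density is an increment of `F` over unit length plus a bounded remainder
  have hslope : ∀ x, |deriv F x| ≤ M + 1 := fun x => by
    have hunit := hexp x 1
    rw [mul_one, one_pow, mul_one] at hunit
    calc |deriv F x| = |(F (x + 1) - F x) - (F (x + 1) - F x - deriv F x)| := by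
          rw [sub_sub_cancel]
      _ ≤ |F (x + 1) - F x| + |F (x + 1) - F x - deriv F x| := abs_sub _ _
      _ ≤ M + 1 := by linarith [abs_cdf_sub_le_one Q (x + 1) x]
  exact ⟨M + 1, fun x => ⟨by linarith, abs_cdf_sub_le_one Q,
    abs_sub_le_of_abs_deriv_le h.differentiable_cdf hslope, hslope x, fun a =>
      (hexp x a).trans (mul_le_mul_of_nonneg_right (by linarith) (sq_nonneg a))⟩⟩

lemma IsSymmetricCdf.deriv_neg {Q : Measure ℝ} (hs : IsSymmetricCdf Q) (x : ℝ) :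
    deriv (fun y => cdf Q y) (-x) = deriv (fun y => cdf Q y) x := by
  have hcomp : deriv (fun y => cdf Q (-y)) x = -deriv (fun y => cdf Q y) (-x) :=
    deriv_comp_neg (fun y => cdf Q y) x
  have hreflect : (fun y => cdf Q (-y)) = fun y => 1 - cdf Q y := funext hs
  rw [hreflect, deriv_const_sub] at hcomp
  exact (neg_injective hcomp).symm

namespace HasExpansion

variable {F : ℝ → ℝ} {C x g a A : ℝ}

lemma abs_slope_mul_le (hF : HasExpansion F C x g) (ha : |a| ≤ A) : |g * a| ≤ C * A := by
  rw [abs_mul]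
  exact mul_le_mul hF.abs_slope_le ha (abs_nonneg _) hF.nonneg

lemma abs_remainder_le_of_abs_le (hF : HasExpansion F C x g) (ha : |a| ≤ A) :
    |F (x + a) - F x - g * a| ≤ C * A ^ 2 :=
  (hF.abs_remainder_le a).trans
    (mul_le_mul_of_nonneg_left (sq_le_sq.2 (ha.trans (le_abs_self A))) hF.nonneg)

lemma abs_increment_sub_le_of_one_outlier (hF : HasExpansion F C x g) {T w B : ℝ}
    (ha : |a| ≤ A) (hT : |T - w| ≤ A + B) :
    |F (x + T) - F x - g * a - (F (x + w) - F x)| ≤ 2 * C * A + min 1 (C * B) := by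
  have hA := mul_nonneg hF.nonneg ((abs_nonneg _).trans ha)
  have hincr : |F (x + T) - F (x + w)| ≤ C * A + min 1 (C * B) := by
    rcases le_total 1 (C * B) with h | h
    · rw [min_eq_left h]
      linarith [hF.abs_sub_le_one (x + T) (x + w)]
    · rw [min_eq_right h, ← mul_add]
      refine (hF.abs_sub_le _ _).trans (mul_le_mul_of_nonneg_left ?_ hF.nonneg)
      rwa [add_sub_add_left_eq_sub]
  calc |F (x + T) - F x - g * a - (F (x + w) - F x)|
      = |(F (x + T) - F (x + w)) - g * a| := by congr 1; ring
    _ ≤ |F (x + T) - F (x + w)| + |g * a| := abs_sub _ _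
    _ ≤ 2 * C * A + min 1 (C * B) := by linarith [hF.abs_slope_mul_le ha]

lemma abs_increment_sub_le_of_finset {ι : Type*} (hF : HasExpansion F C x g) (S : Finset ι)
    (w : ι → ℝ) {T : ℝ} (ha : |a| ≤ A) :
    |F (x + T) - F x - g * a - ∑ i ∈ S, (F (x + w i) - F x)| ≤ 1 + C * A + S.card := by
  have hsum : |∑ i ∈ S, (F (x + w i) - F x)| ≤ S.card := by
    refine (Finset.abs_sum_le_sum_abs _ _).trans ?_
    simpa using Finset.sum_le_card_nsmul S _ 1 fun i _ => hF.abs_sub_le_one _ _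
  calc |F (x + T) - F x - g * a - ∑ i ∈ S, (F (x + w i) - F x)|
      ≤ |F (x + T) - F x| + |g * a| + |∑ i ∈ S, (F (x + w i) - F x)| :=
        (abs_sub _ _).trans (add_le_add_left (abs_sub _ _) _)
    _ ≤ 1 + C * A + S.card :=
        add_le_add (add_le_add (hF.abs_sub_le_one _ _) (hF.abs_slope_mul_le ha)) hsum

/-- Several outliers in one window are rare: the crude bound that is used for them is paid for by
the number `(∑ zᵢ)² - ∑ zᵢ` of ordered pairs of outliers. -/
lemma abs_increment_sub_le {ι : Type*} [Fintype ι] (hF : HasExpansion F C x g) {z y b : ι → ℝ}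
    (hz : ∀ i, z i = 0 ∨ z i = 1) {T R : ℝ} (hR : 0 ≤ R) (ha : |a| ≤ A)
    (hT : |T - ∑ i, b i * (z i * y i)| ≤ A + R * ∑ i, z i * |y i|)
    (hT0 : (∀ i, z i = 0) → T = a) :
    |F (x + T) - F x - g * a - ∑ i, z i * (F (x + b i * y i) - F x)| ≤
      C * A ^ 2 + 2 * C * A * (∑ i, z i) + ∑ i, z i * min 1 (C * R * |y i|)
        + 2 * ((∑ i, z i) ^ 2 - ∑ i, z i) := by
  classical
  have hC := hF.nonneg
  have hCA : 0 ≤ C * A := mul_nonneg hC ((abs_nonneg _).trans ha)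
  have hCA2 : 0 ≤ C * A ^ 2 := by positivity
  obtain ⟨S, hS⟩ : ∃ S : Finset ι, ∀ i, z i = if i ∈ S then 1 else 0 :=
    ⟨Finset.univ.filter fun i => z i = 1, fun i => by rcases hz i with h | h <;> simp [h]⟩
  have hsum : ∀ f : ι → ℝ, ∑ i, z i * f i = ∑ i ∈ S, f i := fun f => by simp [hS]
  have hcard : ∑ i, z i = (S.card : ℝ) := by simpa using hsum fun _ => 1
  simp only [mul_left_comm (b _)] at hT
  rw [hsum, hsum] at hT
  rw [hsum, hsum, hcard]
  rcases Nat.lt_or_ge S.card 2 with hlt | hge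
  · interval_cases hc : S.card
    · obtain rfl := Finset.card_eq_zero.1 hc
      obtain rfl := hT0 fun i => by simp [hS]
      simpa using hF.abs_remainder_le_of_abs_le ha
    · obtain ⟨i, rfl⟩ := Finset.card_eq_one.1 hc
      simp only [Finset.sum_singleton] at hT ⊢
      have hone := hF.abs_increment_sub_le_of_one_outlier ha hT
      rw [← mul_assoc] at hone
      push_cast
      linarith
  · have hge' : (2 : ℝ) ≤ S.card := by exact_mod_cast hge
    have hmin : 0 ≤ ∑ i ∈ S, min 1 (C * R * |y i|) :=
      Finset.sum_nonneg fun i _ => le_min zero_le_one (by positivity)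
    have hmany := hF.abs_increment_sub_le_of_finset S (fun i => b i * y i) (T := T) ha
    nlinarith

end HasExpansion

end Expansion

section Mean

variable {Ω : Type*} [MeasurableSpace Ω] {P : Measure Ω}

/-- `X` is integrable and `E |X| ≤ b`. -/
def BoundedInMean (P : Measure Ω) (X : Ω → ℝ) (b : ℝ) : Prop :=
  Integrable X P ∧ ∫ ω, |X ω| ∂P ≤ b

namespace BoundedInMean

lemma congr {X Y : Ω → ℝ} {a : ℝ} (h : BoundedInMean P X a) (hXY : X =ᵐ[P] Y) :
    BoundedInMean P Y a :=
  ⟨h.1.congr hXY, (integral_congr_ae (hXY.symm.fun_comp abs)).trans_le h.2⟩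

lemma mono {X : Ω → ℝ} {a b : ℝ} (h : BoundedInMean P X a) (hab : a ≤ b) : BoundedInMean P X b :=
  ⟨h.1, h.2.trans hab⟩

lemma add {X Y : Ω → ℝ} {a b : ℝ} (hX : BoundedInMean P X a) (hY : BoundedInMean P Y b) :
    BoundedInMean P (fun ω => X ω + Y ω) (a + b) := by
  refine ⟨hX.1.add hY.1, ?_⟩
  calc ∫ ω, |X ω + Y ω| ∂P ≤ ∫ ω, (|X ω| + |Y ω|) ∂P :=
        integral_mono (hX.1.add hY.1).abs (hX.1.abs.add hY.1.abs) fun ω => abs_add_le _ _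
    _ = ∫ ω, |X ω| ∂P + ∫ ω, |Y ω| ∂P := integral_add hX.1.abs hY.1.abs
    _ ≤ a + b := add_le_add hX.2 hY.2

lemma const_mul {X : Ω → ℝ} {a : ℝ} (hX : BoundedInMean P X a) (c : ℝ) :
    BoundedInMean P (fun ω => c * X ω) (|c| * a) := by
  refine ⟨hX.1.const_mul c, ?_⟩
  simp only [abs_mul]
  rw [integral_const_mul]
  exact mul_le_mul_of_nonneg_left hX.2 (abs_nonneg _)

lemma neg {X : Ω → ℝ} {a : ℝ} (hX : BoundedInMean P X a) : BoundedInMean P (fun ω => -X ω) a :=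
  ⟨hX.1.neg, by simpa using hX.2⟩

lemma abs {X : Ω → ℝ} {a : ℝ} (hX : BoundedInMean P X a) : BoundedInMean P (fun ω => |X ω|) a :=
  ⟨hX.1.abs, by simpa using hX.2⟩

lemma sum {ι : Type*} {s : Finset ι} {X : ι → Ω → ℝ} {a : ι → ℝ}
    (h : ∀ i ∈ s, BoundedInMean P (X i) (a i)) :
    BoundedInMean P (fun ω => ∑ i ∈ s, X i ω) (∑ i ∈ s, a i) := by
  classical
  induction s using Finset.induction_on with
  | empty => exact ⟨by simp, by simp⟩
  | insert i s hi ih =>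
    simp only [Finset.sum_insert hi]
    exact (h i (Finset.mem_insert_self _ _)).add
      (ih fun j hj => h j (Finset.mem_insert_of_mem hj))

lemma const [IsProbabilityMeasure P] (c : ℝ) : BoundedInMean P (fun _ => c) |c| :=
  ⟨integrable_const c, by simp⟩

lemma of_abs_le {X Y : Ω → ℝ} {a : ℝ} (hY : BoundedInMean P Y a) (hX : AEStronglyMeasurable X P)
    (h : ∀ᵐ ω ∂P, |X ω| ≤ Y ω) : BoundedInMean P X a := by
  have hint := hY.1.mono' hX h
  refine ⟨hint, (integral_mono_ae hint.abs hY.1.abs ?_).trans hY.2⟩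
  filter_upwards [h] with ω hω using hω.trans (le_abs_self _)

lemma of_nonneg {X : Ω → ℝ} {a : ℝ} (hX : Integrable X P) (h0 : ∀ᵐ ω ∂P, 0 ≤ X ω)
    (h : ∫ ω, X ω ∂P ≤ a) : BoundedInMean P X a :=
  ⟨hX, (integral_congr_ae (h0.mono fun _ => abs_of_nonneg)).trans_le h⟩

lemma of_sq [IsProbabilityMeasure P] {X : Ω → ℝ} {a : ℝ} (hX : MemLp X 2 P)
    (h : ∫ ω, X ω ^ 2 ∂P ≤ a) : BoundedInMean P X √a := by
  refine ⟨hX.integrable one_le_two, Real.le_sqrt_of_sq_le (le_trans ?_ h)⟩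
  have hvar := variance_nonneg (fun ω => |X ω|) P
  rw [variance_eq_sub (X := fun ω => |X ω|) hX.abs] at hvar
  simpa using hvar

lemma measure_lt_le {X : Ω → ℝ} {a δ : ℝ} (hX : BoundedInMean P X a) (hδ : 0 < δ) :
    P {ω | δ < |X ω|} ≤ ENNReal.ofReal (a / δ) := by
  have hmarkov := mul_meas_ge_le_integral_of_nonneg
    (Eventually.of_forall fun ω => abs_nonneg (X ω)) hX.1.abs δ
  have hfin : P {ω | δ ≤ |X ω|} ≠ ⊤ := (hX.1.measure_norm_ge_lt_top hδ).ne
  calc P {ω | δ < |X ω|} ≤ P {ω | δ ≤ |X ω|} := measure_mono fun ω (hω : δ < |X ω|) => hω.le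
    _ = ENNReal.ofReal (P.real {ω | δ ≤ |X ω|}) := (ENNReal.ofReal_toReal hfin).symm
    _ ≤ ENNReal.ofReal (a / δ) := by
        refine ENNReal.ofReal_le_ofReal ?_
        rw [le_div_iff₀' hδ]
        exact hmarkov.trans hX.2

end BoundedInMean

lemma integral_sq_sum_le_of_orthogonal {ι : Type*} {s : Finset ι} {f : ι → Ω → ℝ} {b : ℝ}
    (hf : ∀ i ∈ s, MemLp (f i) 2 P)
    (ho : ∀ i ∈ s, ∀ j ∈ s, i ≠ j → ∫ ω, f i ω * f j ω ∂P = 0)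
    (hb : ∀ i ∈ s, ∫ ω, f i ω ^ 2 ∂P ≤ b) :
    ∫ ω, (∑ i ∈ s, f i ω) ^ 2 ∂P ≤ s.card * b := by
  have hint : ∀ i ∈ s, ∀ j ∈ s, Integrable (fun ω => f i ω * f j ω) P := fun i hi j hj =>
    (hf i hi).integrable_mul (hf j hj)
  calc ∫ ω, (∑ i ∈ s, f i ω) ^ 2 ∂P = ∫ ω, ∑ i ∈ s, ∑ j ∈ s, f i ω * f j ω ∂P := by
        simp only [sq, Finset.sum_mul_sum]
    _ = ∑ i ∈ s, ∑ j ∈ s, ∫ ω, f i ω * f j ω ∂P := by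
        rw [integral_finsetSum _ fun i hi => integrable_finsetSum _ fun j hj => hint i hi j hj]
        exact Finset.sum_congr rfl fun i hi => integral_finsetSum _ fun j hj => hint i hi j hj
    _ = ∑ i ∈ s, ∫ ω, f i ω ^ 2 ∂P := by
        refine Finset.sum_congr rfl fun i hi => ?_
        rw [Finset.sum_eq_single i (fun j hj hne => ho i hi j hj hne.symm) (fun h => absurd hi h)]
        simp only [sq]
    _ ≤ s.card * b := by
        rw [← nsmul_eq_mul]
        exact Finset.sum_le_card_nsmul _ _ _ hb

lemma integral_sq_le_of_eLpNorm_le {X : Ω → ℝ} {κ : ℝ} (hκ : 0 ≤ κ) (hX : MemLp X 2 P)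
    (h : eLpNorm X 2 P ≤ ENNReal.ofReal κ) : ∫ ω, X ω ^ 2 ∂P ≤ κ ^ 2 := by
  rw [hX.eLpNorm_eq_integral_rpow_norm two_ne_zero ENNReal.ofNat_ne_top,
    ENNReal.ofReal_le_ofReal_iff hκ] at h
  simp only [ENNReal.toReal_ofNat, Real.rpow_ofNat, Real.norm_eq_abs, sq_abs] at h
  rwa [← one_div, ← Real.sqrt_eq_rpow, Real.sqrt_le_left hκ] at h

lemma integral_comp_prodMk_of_indepFun {α β : Type*} [MeasurableSpace α] [MeasurableSpace β]
    [IsFiniteMeasure P] {X : Ω → α} {Y : Ω → β} (hX : AEMeasurable X P) (hY : AEMeasurable Y P)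
    (hXY : IndepFun X Y P) {f : α × β → ℝ} (hf : AEStronglyMeasurable f (P.map fun ω => (X ω, Y ω)))
    (hint : Integrable (fun ω => f (X ω, Y ω)) P) :
    ∫ ω, f (X ω, Y ω) ∂P = ∫ ω, ∫ x, f (x, Y ω) ∂(P.map X) ∂P := by
  have hprod := (indepFun_iff_map_prod_eq_prod_map_map hX hY).1 hXY
  have hintegrable : Integrable f ((P.map X).prod (P.map Y)) := by
    rwa [← hprod, integrable_map_measure hf (hX.prodMk hY)]
  rw [← integral_map (hX.prodMk hY) hf, hprod, integral_prod_symm f hintegrable,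
    integral_map hY hintegrable.integral_prod_right.aestronglyMeasurable]

end Mean

lemma integral_mul_indicator_of_indep {Ω : Type*} {m m₀ : MeasurableSpace Ω}
    {P : @Measure Ω m₀} [IsProbabilityMeasure P] {X T M : Ω → ℝ} (hX : Measurable X) (hm : m ≤ m₀)
    (hindep : Indep (MeasurableSpace.comap X inferInstance) m P) (hT : Measurable[m] T)
    (hM : Measurable[m] M) (hMint : Integrable M P) :
    ∫ ω, M ω * (Set.Iic (T ω)).indicator (fun _ => (1 : ℝ)) (X ω) ∂P
      = ∫ ω, M ω * cdf (P.map X) (T ω) ∂P := by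
  have := Measure.isProbabilityMeasure_map (μ := P) hX.aemeasurable
  have hTM : Measurable fun ω => (T ω, M ω) := (hT.mono hm le_rfl).prodMk (hM.mono hm le_rfl)
  have hindepFun : IndepFun X (fun ω => (T ω, M ω)) P :=
    (IndepFun_iff_Indep _ _ _).2 (indep_of_indep_of_le_right hindep (hT.prodMk hM).comap_le)
  set f : ℝ × (ℝ × ℝ) → ℝ := fun w => w.2.2 * {w : ℝ × (ℝ × ℝ) | w.1 ≤ w.2.1}.indicator 1 w
  have hf : Measurable f := (measurable_snd.comp measurable_snd).mul (measurable_one.indicator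
    (measurableSet_le measurable_fst (measurable_fst.comp measurable_snd)))
  have hint : Integrable (fun ω => f (X ω, (T ω, M ω))) P := by
    refine hMint.mono (hf.comp (hX.prodMk hTM)).aestronglyMeasurable
      (Eventually.of_forall fun ω => ?_)
    by_cases h : X ω ≤ T ω <;> simp [f, h]
  calc ∫ ω, M ω * (Set.Iic (T ω)).indicator (fun _ => (1 : ℝ)) (X ω) ∂P
      = ∫ ω, f (X ω, (T ω, M ω)) ∂P := by simp [f, Set.indicator]
    _ = ∫ ω, ∫ e, f (e, (T ω, M ω)) ∂(P.map X) ∂P := integral_comp_prodMk_of_indepFun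
        hX.aemeasurable hTM.aemeasurable hindepFun hf.aestronglyMeasurable hint
    _ = ∫ ω, M ω * cdf (P.map X) (T ω) ∂P := by
        refine integral_congr_ae (Eventually.of_forall fun ω => ?_)
        have hslice : ∀ e, f (e, (T ω, M ω)) = M ω * (Set.Iic (T ω)).indicator 1 e := fun e => by
          simp [f, Set.indicator]
        simp only [hslice]
        rw [integral_const_mul, integral_indicator_one measurableSet_Iic, cdf_eq_real]

section Thresholds

variable {p : ℕ}

/-- The total effect of the outliers `w` on the residual at time `t`, with the sign reversed: an
outlier in the residual shifts the threshold for the innovation by its opposite. -/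
def contamination (β : Fin p → ℝ) (w : ℤ → ℝ) (t : ℤ) : ℝ :=
  ∑ i : Fin (p + 1), Matrix.vecCons (-1) β i * w (t - (i : ℕ))

/-- The number of outliers at the times `t - p, …, t`. -/
def outlierCount (p : ℕ) (z : ℤ → ℝ) (t : ℤ) : ℝ := ∑ i : Fin (p + 1), z (t - (i : ℕ))

/-- The size `1 + |y_{t-1}| + ⋯ + |y_{t-p}|` of the regressors, including the constant one. -/
def lagAbs (p : ℕ) (y : ℤ → ℝ) (t : ℤ) : ℝ := 1 + ∑ j : Fin p, |y (t - ((j : ℕ) + 1))|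

/-- The effect of a rescaled estimation error `ϑ`, whose first component belongs to the constant
regressor, widened by the multiple `s` of the size of the regressors. -/
def perturbation (ϑ : ℝ × (Fin p → ℝ)) (s : ℝ) (y : ℤ → ℝ) (t : ℤ) : ℝ :=
  ϑ.1 + ∑ j : Fin p, ϑ.2 j * y (t - ((j : ℕ) + 1)) + s * lagAbs p y t

/-- The shift of the threshold for the innovation at time `t` when the autoregression `u` is
observed with the outliers `w` and the estimation error is `r ϑ`. -/
def threshold (β : Fin p → ℝ) (ϑ : ℝ × (Fin p → ℝ)) (s r : ℝ) (u w : ℤ → ℝ) (t : ℤ) : ℝ :=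
  contamination β w t + r * perturbation ϑ s (fun t => u t + w t) t

/-- The remainder of the increment of `F` from `x` by `threshold` after its linear part, with
slope `g`, and the individual effects of the outliers are removed. -/
def driftRemainder (F : ℝ → ℝ) (x g : ℝ) (β : Fin p → ℝ) (ϑ : ℝ × (Fin p → ℝ)) (s r : ℝ)
    (u z ξ : ℤ → ℝ) (t : ℤ) : ℝ :=
  F (x + threshold β ϑ s r u (fun t => z t * ξ t) t) - F x - g * (r * perturbation ϑ s u t)
    - ∑ i : Fin (p + 1), z (t - (i : ℕ)) *
        (F (x + Matrix.vecCons (-1) β i * ξ (t - (i : ℕ))) - F x)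

lemma one_le_lagAbs (y : ℤ → ℝ) (t : ℤ) : 1 ≤ lagAbs p y t :=
  le_add_of_nonneg_right (Finset.sum_nonneg fun _ _ => abs_nonneg _)

lemma lagAbs_nonneg (y : ℤ → ℝ) (t : ℤ) : 0 ≤ lagAbs p y t := zero_le_one.trans (one_le_lagAbs y t)

lemma lagAbs_add_le (u w : ℤ → ℝ) (t : ℤ) :
    lagAbs p (fun t => u t + w t) t ≤ lagAbs p u t + ∑ i : Fin (p + 1), |w (t - (i : ℕ))| := by
  have hsum : ∑ j : Fin p, |u (t - ((j : ℕ) + 1)) + w (t - ((j : ℕ) + 1))|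
      ≤ ∑ j : Fin p, |u (t - ((j : ℕ) + 1))| + ∑ j : Fin p, |w (t - ((j : ℕ) + 1))| := by
    rw [← Finset.sum_add_distrib]
    exact Finset.sum_le_sum fun j _ => abs_add_le _ _
  rw [lagAbs, lagAbs, Fin.sum_univ_succ]
  simp only [Fin.val_zero, Fin.val_succ, Nat.cast_add, Nat.cast_one, Nat.cast_zero, sub_zero]
  linarith [abs_nonneg (w t)]

lemma abs_linear_le (ϑ : ℝ × (Fin p → ℝ)) (y : ℤ → ℝ) (t : ℤ) :
    |ϑ.1 + ∑ j : Fin p, ϑ.2 j * y (t - ((j : ℕ) + 1))| ≤ ‖ϑ‖ * lagAbs p y t := by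
  have hcoeff : ∀ j, |ϑ.2 j| ≤ ‖ϑ‖ := fun j => (norm_le_pi_norm ϑ.2 j).trans (norm_snd_le ϑ)
  rw [lagAbs, mul_add, mul_one, Finset.mul_sum]
  refine (abs_add_le _ _).trans (add_le_add (norm_fst_le ϑ)
    ((Finset.abs_sum_le_sum_abs _ _).trans (Finset.sum_le_sum fun j _ => ?_)))
  rw [abs_mul]
  exact mul_le_mul_of_nonneg_right (hcoeff j) (abs_nonneg _)

lemma abs_perturbation_le (ϑ : ℝ × (Fin p → ℝ)) (s : ℝ) (y : ℤ → ℝ) (t : ℤ) :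
    |perturbation ϑ s y t| ≤ (‖ϑ‖ + |s|) * lagAbs p y t := by
  rw [add_mul]
  refine (abs_add_le _ _).trans (add_le_add (abs_linear_le ϑ y t) ?_)
  rw [abs_mul, abs_of_nonneg (lagAbs_nonneg y t)]

lemma threshold_of_no_outlier (β : Fin p → ℝ) (ϑ : ℝ × (Fin p → ℝ)) (s r : ℝ) (u : ℤ → ℝ)
    {w : ℤ → ℝ} {t : ℤ} (hw : ∀ i : Fin (p + 1), w (t - (i : ℕ)) = 0) :
    threshold β ϑ s r u w t = r * perturbation ϑ s u t := by
  have hlag : ∀ j : Fin p, w (t - ((j : ℕ) + 1)) = 0 := fun j => by simpa using hw j.succ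
  simp [threshold, contamination, perturbation, lagAbs, hw, hlag]

lemma abs_threshold_sub_contamination_le (β : Fin p → ℝ) (ϑ : ℝ × (Fin p → ℝ)) (s : ℝ) {r : ℝ}
    (hr : 0 ≤ r) (u w : ℤ → ℝ) (t : ℤ) :
    |threshold β ϑ s r u w t - contamination β w t| ≤
      r * ((‖ϑ‖ + |s|) * (lagAbs p u t + ∑ i : Fin (p + 1), |w (t - (i : ℕ))|)) := by
  rw [threshold, add_sub_cancel_left, abs_mul, abs_of_nonneg hr]
  exact mul_le_mul_of_nonneg_left ((abs_perturbation_le ϑ s _ t).trans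
    (mul_le_mul_of_nonneg_left (lagAbs_add_le u w t) (by positivity))) hr

variable {F : ℝ → ℝ} {C x g r : ℝ} {z : ℤ → ℝ}

lemma HasExpansion.abs_driftRemainder_le (hF : HasExpansion F C x g) (β : Fin p → ℝ)
    (ϑ : ℝ × (Fin p → ℝ)) (s : ℝ) (hr : 0 ≤ r) (hz : ∀ t, z t = 0 ∨ z t = 1) (u ξ : ℤ → ℝ)
    (t : ℤ) :
    |driftRemainder F x g β ϑ s r u z ξ t| ≤
      C * (r * ((‖ϑ‖ + |s|) * lagAbs p u t)) ^ 2
        + 2 * C * (r * ((‖ϑ‖ + |s|) * lagAbs p u t)) * outlierCount p z t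
        + ∑ i : Fin (p + 1), z (t - (i : ℕ)) *
            min 1 (C * (r * (‖ϑ‖ + |s|)) * |ξ (t - (i : ℕ))|)
        + 2 * (outlierCount p z t ^ 2 - outlierCount p z t) := by
  refine hF.abs_increment_sub_le (fun i => hz _) (mul_nonneg hr (by positivity)) ?_ ?_
    fun h => threshold_of_no_outlier β ϑ s r u fun i => by simp [h i]
  · rw [abs_mul, abs_of_nonneg hr]
    exact mul_le_mul_of_nonneg_left (abs_perturbation_le ϑ s u t) hr
  · have habs : ∀ t, |z t * ξ t| = z t * |ξ t| := fun t => by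
      rcases hz t with h | h <;> simp [h]
    refine (abs_threshold_sub_contamination_le β ϑ s hr u (fun t => z t * ξ t) t).trans_eq ?_
    simp only [habs]
    ring

lemma HasExpansion.abs_increment_threshold_le (hF : HasExpansion F C x g) (β : Fin p → ℝ)
    (ϑ : ℝ × (Fin p → ℝ)) (s : ℝ) (hr : 0 ≤ r) (hz : ∀ t, z t = 0 ∨ z t = 1) (u ξ : ℤ → ℝ)
    (t : ℤ) :
    |F (x + threshold β ϑ s r u (fun t => z t * ξ t) t) - F x| ≤
      C * (r * ((‖ϑ‖ + |s|) * lagAbs p u t)) + outlierCount p z t := by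
  have hz0 : ∀ i : Fin (p + 1), 0 ≤ z (t - (i : ℕ)) := fun i => by
    rcases hz (t - (i : ℕ)) with h | h <;> simp [h]
  have hcount : 0 ≤ outlierCount p z t := Finset.sum_nonneg fun i _ => hz0 i
  have hlinear : 0 ≤ C * (r * ((‖ϑ‖ + |s|) * lagAbs p u t)) := by
    have := lagAbs_nonneg (p := p) u t
    have := hF.nonneg
    positivity
  by_cases hnone : ∀ i : Fin (p + 1), z (t - (i : ℕ)) = 0
  · rw [threshold_of_no_outlier β ϑ s r u fun i => by simp [hnone i]]
    refine (hF.abs_sub_le _ _).trans (le_add_of_le_of_nonneg ?_ hcount)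
    rw [add_sub_cancel_left, abs_mul, abs_of_nonneg hr]
    exact mul_le_mul_of_nonneg_left
      (mul_le_mul_of_nonneg_left (abs_perturbation_le ϑ s u t) hr) hF.nonneg
  · obtain ⟨i, hi⟩ := not_forall.1 hnone
    have hone : 1 ≤ outlierCount p z t := by
      rw [← (hz _).resolve_left hi]
      exact Finset.single_le_sum (fun i _ => hz0 i) (Finset.mem_univ i)
    linarith [hF.abs_sub_le_one (x + threshold β ϑ s r u (fun t => z t * ξ t) t) x]

variable {α : Type*} {m : MeasurableSpace α}

lemma measurable_perturbation (ϑ : ℝ × (Fin p → ℝ)) (s : ℝ) {y : ℤ → α → ℝ} {t : ℤ}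
    (hy : ∀ t' < t, Measurable (y t')) :
    Measurable fun ω => perturbation ϑ s (fun t => y t ω) t := by
  have hlag : ∀ j : Fin p, Measurable (y (t - ((j : ℕ) + 1))) := fun j => hy _ (by omega)
  unfold perturbation lagAbs
  fun_prop

lemma measurable_threshold (β : Fin p → ℝ) (ϑ : ℝ × (Fin p → ℝ)) (s r : ℝ) {u w : ℤ → α → ℝ}
    {t : ℤ} (hu : ∀ t' < t, Measurable (u t')) (hw : ∀ t', Measurable (w t')) :
    Measurable fun ω => threshold β ϑ s r (fun t => u t ω) (fun t => w t ω) t := by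
  have hcontamination : Measurable fun ω => contamination β (fun t => w t ω) t := by
    unfold contamination
    fun_prop
  exact hcontamination.add ((measurable_perturbation ϑ s (y := fun t ω => u t ω + w t ω)
    fun t' ht' => (hu t' ht').add (hw t')).const_mul r)

end Thresholds

section Moments

variable {Ω : Type*} [MeasurableSpace Ω] {P : Measure Ω}

namespace IsRegularModel

variable {p : ℕ} {β : Fin p → ℝ} {L Q : Measure ℝ} {q κ : ℝ} {ε u z ξ : ℤ → Ω → ℝ}

lemma memLp_sol (hm : IsRegularModel P β L Q q κ ε u z ξ) (t : ℤ) : MemLp (u t) 2 P :=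
  ⟨(hm.sol_measurable t).aestronglyMeasurable, (hm.sol_norm t).trans_lt ENNReal.ofReal_lt_top⟩

lemma integral_sq_sol_le (hm : IsRegularModel P β L Q q κ ε u z ξ) (hκ : 0 ≤ κ) (t : ℤ) :
    ∫ ω, u t ω ^ 2 ∂P ≤ κ ^ 2 :=
  integral_sq_le_of_eLpNorm_le hκ (hm.memLp_sol t) (hm.sol_norm t)

lemma measurable_threshold_pastAlgebra (hm : IsRegularModel P β L Q q κ ε u z ξ)
    (ϑ : ℝ × (Fin p → ℝ)) (s r : ℝ) {t t' : ℤ} (ht : t ≤ t') :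
    Measurable[pastAlgebra ε z ξ t'] fun ω =>
      threshold β ϑ s r (fun t => u t ω) (fun t => z t ω * ξ t ω) t :=
  measurable_threshold (m := pastAlgebra ε z ξ t') (w := fun t ω => z t ω * ξ t ω) β ϑ s r
    (fun _ hs => hm.sol_past (hs.trans_le ht))
    (fun s => (measurable_bern_pastAlgebra s t').mul (measurable_outlier_pastAlgebra s t'))

lemma bern_nonneg (hm : IsRegularModel P β L Q q κ ε u z ξ) : ∀ᵐ ω ∂P, ∀ t, 0 ≤ z t ω := by
  filter_upwards [hm.bern_zero_or_one] with ω hω t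
  rcases hω t with h | h <;> simp [h]

lemma norm_bern_le_one (hm : IsRegularModel P β L Q q κ ε u z ξ) (t : ℤ) :
    ∀ᵐ ω ∂P, ‖z t ω‖ ≤ 1 := by
  filter_upwards [hm.bern_zero_or_one] with ω hω
  rcases hω t with h | h <;> simp [h]

lemma integrable_bern_mul (hm : IsRegularModel P β L Q q κ ε u z ξ) (t : ℤ) {X : Ω → ℝ}
    (hX : Integrable X P) : Integrable (fun ω => z t ω * X ω) P :=
  hX.bdd_mul (c := 1) (hm.bern_measurable t).aestronglyMeasurable (hm.norm_bern_le_one t)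

variable [IsProbabilityMeasure P]

lemma boundedInMean_sol (hm : IsRegularModel P β L Q q κ ε u z ξ) (hκ : 0 ≤ κ) (t : ℤ) :
    BoundedInMean P (u t) κ := by
  simpa [Real.sqrt_sq hκ] using
    BoundedInMean.of_sq (hm.memLp_sol t) (hm.integral_sq_sol_le hκ t)

lemma boundedInMean_lagAbs (hm : IsRegularModel P β L Q q κ ε u z ξ) (hκ : 0 ≤ κ) (t : ℤ) :
    BoundedInMean P (fun ω => lagAbs p (fun t => u t ω) t) (1 + p * κ) := by
  simpa [lagAbs] using (BoundedInMean.const (P := P) 1).add (BoundedInMean.sum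
    (s := Finset.univ) fun (j : Fin p) _ => (hm.boundedInMean_sol hκ (t - ((j : ℕ) + 1))).abs)

lemma boundedInMean_sq_lagAbs (hm : IsRegularModel P β L Q q κ ε u z ξ) (hκ : 0 ≤ κ) (t : ℤ) :
    BoundedInMean P (fun ω => lagAbs p (fun t => u t ω) t ^ 2) (2 + 2 * (p * (p * κ ^ 2))) := by
  have hsq : ∀ s : ℤ, BoundedInMean P (fun ω => u s ω ^ 2) (κ ^ 2) := fun s =>
    BoundedInMean.of_nonneg (hm.memLp_sol s).integrable_sq
      (Eventually.of_forall fun _ => sq_nonneg _) (hm.integral_sq_sol_le hκ s)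
  have hdom := (BoundedInMean.const (P := P) 2).add (((BoundedInMean.sum (s := Finset.univ)
    fun (j : Fin p) _ => hsq (t - ((j : ℕ) + 1))).const_mul p).const_mul 2)
  simp only [Finset.sum_const, Finset.card_univ, Fintype.card_fin, nsmul_eq_mul, Nat.abs_ofNat,
    Nat.abs_cast] at hdom
  refine hdom.of_abs_le ((hm.boundedInMean_lagAbs hκ t).1.aestronglyMeasurable.pow 2)
    (Eventually.of_forall fun ω => ?_)
  have hcauchy := sq_sum_le_card_mul_sum_sq (s := (Finset.univ : Finset (Fin p)))
    (f := fun j : Fin p => |u (t - ((j : ℕ) + 1)) ω|)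
  simp only [sq_abs, Finset.card_univ, Fintype.card_fin] at hcauchy
  rw [abs_of_nonneg (sq_nonneg _), lagAbs]
  nlinarith [sq_nonneg (1 - ∑ j : Fin p, |u (t - ((j : ℕ) + 1)) ω|)]

lemma boundedInMean_bern (hm : IsRegularModel P β L Q q κ ε u z ξ) (t : ℤ) :
    BoundedInMean P (z t) q :=
  BoundedInMean.of_nonneg
    (Integrable.of_bound (hm.bern_measurable t).aestronglyMeasurable 1 (hm.norm_bern_le_one t))
    (hm.bern_nonneg.mono fun _ h => h t) (hm.integral_bern t).le

lemma boundedInMean_outlierCount (hm : IsRegularModel P β L Q q κ ε u z ξ) (t : ℤ) :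
    BoundedInMean P (fun ω => outlierCount p (fun t => z t ω) t) ((p + 1) * q) := by
  simpa [outlierCount] using BoundedInMean.sum (s := Finset.univ) fun (i : Fin (p + 1)) _ =>
    hm.boundedInMean_bern (t - (i : ℕ))

lemma boundedInMean_lagAbs_mul_outlierCount (hm : IsRegularModel P β L Q q κ ε u z ξ)
    (hκ : 0 ≤ κ) (hq : 0 ≤ q) (t : ℤ) :
    BoundedInMean P
      (fun ω => lagAbs p (fun t => u t ω) t * outlierCount p (fun t => z t ω) t)
      ((p + 1) * (q * (1 + p * κ))) := by
  have hprod : ∀ s r : ℤ, BoundedInMean P (fun ω => z s ω * |u r ω|) (q * κ) := fun s r => by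
    refine BoundedInMean.of_nonneg
      (hm.integrable_bern_mul s (hm.boundedInMean_sol hκ r).1.abs) ?_ ?_
    · filter_upwards [hm.bern_nonneg] with ω hω using mul_nonneg (hω s) (abs_nonneg _)
    · rw [hm.integral_bern_mul_abs_sol]
      exact mul_le_mul_of_nonneg_left (hm.boundedInMean_sol hκ r).2 hq
  have hsum := BoundedInMean.sum (s := Finset.univ) fun (i : Fin (p + 1)) _ =>
    (hm.boundedInMean_bern (t - (i : ℕ))).add (BoundedInMean.sum (s := Finset.univ)
      fun (j : Fin p) _ => hprod (t - (i : ℕ)) (t - ((j : ℕ) + 1)))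
  refine (hsum.congr (Eventually.of_forall fun ω => ?_)).mono (le_of_eq ?_)
  · simp only [lagAbs, outlierCount, Finset.mul_sum]
    refine Finset.sum_congr rfl fun i _ => ?_
    rw [← Finset.mul_sum]
    ring
  · simp only [Finset.sum_const, Finset.card_univ, Fintype.card_fin, nsmul_eq_mul]
    push_cast
    ring

lemma boundedInMean_sq_outlierCount_sub (hm : IsRegularModel P β L Q q κ ε u z ξ) (t : ℤ) :
    BoundedInMean P (fun ω => outlierCount p (fun t => z t ω) t ^ 2
      - outlierCount p (fun t => z t ω) t) ((p + 1) * ((p + 1) * q ^ 2)) := by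
  have hpair : ∀ i j : Fin (p + 1), BoundedInMean P
      (fun ω => if i = j then 0 else z (t - (i : ℕ)) ω * z (t - (j : ℕ)) ω) (q ^ 2) := by
    intro i j
    by_cases hij : i = j
    · simpa only [hij, if_true] using (BoundedInMean.const (P := P) 0).mono (by simp [sq_nonneg])
    · simp only [hij, if_false]
      refine BoundedInMean.of_nonneg (hm.integrable_bern_mul _ (hm.boundedInMean_bern _).1)
        ?_ (hm.integral_bern_mul_bern (by omega)).le
      filter_upwards [hm.bern_nonneg] with ω hω using mul_nonneg (hω _) (hω _)
  have hsum := BoundedInMean.sum (s := Finset.univ) fun (i : Fin (p + 1)) _ =>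
    BoundedInMean.sum (s := Finset.univ) fun (j : Fin (p + 1)) _ => hpair i j
  refine (hsum.congr ?_).mono (le_of_eq (by simp))
  filter_upwards [hm.bern_zero_or_one] with ω hω
  rw [outlierCount, sq, Finset.sum_mul_sum, ← Finset.sum_sub_distrib]
  refine Finset.sum_congr rfl fun i _ => ?_
  have hidem : z (t - (i : ℕ)) ω * z (t - (i : ℕ)) ω = z (t - (i : ℕ)) ω := by
    rcases hω (t - (i : ℕ)) with h | h <;> simp [h]
  rw [← Finset.add_sum_erase _ _ (Finset.mem_univ i),
    ← Finset.add_sum_erase _ _ (Finset.mem_univ i), hidem, if_pos rfl, zero_add,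
    add_sub_cancel_left]
  exact Finset.sum_congr rfl fun j hj => if_neg (Finset.ne_of_mem_erase hj).symm

lemma boundedInMean_sum_bern_mul_min (hm : IsRegularModel P β L Q q κ ε u z ξ) {c : ℝ}
    (hc : 0 ≤ c) (t : ℤ) :
    BoundedInMean P (fun ω => ∑ i : Fin (p + 1), z (t - (i : ℕ)) ω *
      min 1 (c * |ξ (t - (i : ℕ)) ω|)) ((p + 1) * (q * ∫ x, min 1 (c * |x|) ∂Q)) := by
  have hmeas : Measurable fun x : ℝ => min 1 (c * |x|) := by fun_prop
  have hnonneg : ∀ x : ℝ, 0 ≤ min 1 (c * |x|) := fun x => le_min zero_le_one (by positivity)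
  have hbounded : ∀ t, BoundedInMean P (fun ω => z t ω * min 1 (c * |ξ t ω|))
      (q * ∫ x, min 1 (c * |x|) ∂Q) := fun t => by
    refine BoundedInMean.of_nonneg (hm.integrable_bern_mul _ (Integrable.of_bound
      (hmeas.comp (hm.outlier_measurable _)).aestronglyMeasurable 1
      (Eventually.of_forall fun ω => ?_))) ?_ (hm.integral_bern_mul_outlier hmeas _).le
    · rw [Real.norm_eq_abs, abs_of_nonneg (hnonneg _)]
      exact min_le_left _ _
    · filter_upwards [hm.bern_nonneg] with ω hω using mul_nonneg (hω _) (hnonneg _)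
  simpa using BoundedInMean.sum (s := Finset.univ) fun (i : Fin (p + 1)) _ =>
    hbounded (t - (i : ℕ))

end IsRegularModel

end Moments

section Increments

/-- The change of the indicator of `e ≤ x` when the threshold `x` is shifted by `a`. -/
def stepIncrement (x a e : ℝ) : ℝ :=
  (Set.Iic (x + a)).indicator (fun _ => (1 : ℝ)) e - (Set.Iic x).indicator (fun _ => (1 : ℝ)) e

/-- The increment `stepIncrement x a e` minus its mean over `e` with law `L`. -/
def centredStep (L : Measure ℝ) (x a e : ℝ) : ℝ :=
  stepIncrement x a e - (cdf L (x + a) - cdf L x)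

lemma abs_stepIncrement_le (x a e : ℝ) : |stepIncrement x a e| ≤ 1 := by
  by_cases hxa : e ≤ x + a <;> by_cases hx : e ≤ x <;> simp [stepIncrement, hxa, hx]

lemma abs_centredStep_le (L : Measure ℝ) (x a e : ℝ) : |centredStep L x a e| ≤ 2 := by
  refine (abs_sub _ _).trans ?_
  linarith [abs_stepIncrement_le x a e, abs_cdf_sub_le_one L (x + a) x]

lemma sq_centredStep_le (L : Measure ℝ) (x a e : ℝ) :
    centredStep L x a e ^ 2 ≤
      |stepIncrement x a e| - 2 * ((cdf L (x + a) - cdf L x) * centredStep L x a e) := by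
  have hsq : stepIncrement x a e ^ 2 ≤ |stepIncrement x a e| := by
    rw [← sq_abs]
    exact pow_le_of_le_one (abs_nonneg _) (abs_stepIncrement_le x a e) two_ne_zero
  rw [centredStep]
  nlinarith [sq_nonneg (cdf L (x + a) - cdf L x)]

lemma abs_increment_eq_mul_of_monotone {f : ℝ → ℝ} (hf : Monotone f) (x a : ℝ) :
    |f (x + a) - f x| = (if 0 ≤ a then 1 else -1) * (f (x + a) - f x) := by
  split_ifs with ha
  · rw [one_mul, abs_of_nonneg (sub_nonneg.2 (hf (by linarith)))]
  · rw [neg_one_mul, abs_of_nonpos (sub_nonpos.2 (hf (by linarith)))]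

lemma monotone_indicator_Iic (e : ℝ) :
    Monotone fun y : ℝ => (Set.Iic y).indicator (fun _ => (1 : ℝ)) e := fun _ _ hab =>
  Set.indicator_le_indicator_of_subset (Set.Iic_subset_Iic.2 hab) (fun _ => zero_le_one) e

variable {α : Type*} {m : MeasurableSpace α} {X T : α → ℝ}

lemma measurable_indicator_Iic (hX : Measurable X) (hT : Measurable T) :
    Measurable fun ω => (Set.Iic (T ω)).indicator (fun _ => (1 : ℝ)) (X ω) :=
  (measurable_const (a := (1 : ℝ))).indicator (measurableSet_le hX hT)

lemma measurable_stepIncrement (x : ℝ) (hX : Measurable X) (hT : Measurable T) :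
    Measurable fun ω => stepIncrement x (T ω) (X ω) :=
  (measurable_indicator_Iic hX (hT.const_add x)).sub (measurable_indicator_Iic hX measurable_const)

lemma measurable_cdf_increment (L : Measure ℝ) (x : ℝ) (hT : Measurable T) :
    Measurable fun ω => cdf L (x + T ω) - cdf L x :=
  ((monotone_cdf L).measurable.comp (hT.const_add x)).sub measurable_const

lemma measurable_centredStep (L : Measure ℝ) (x : ℝ) (hX : Measurable X) (hT : Measurable T) :
    Measurable fun ω => centredStep L x (T ω) (X ω) :=
  (measurable_stepIncrement x hX hT).sub (measurable_cdf_increment L x hT)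

end Increments

section Fluctuations

variable {Ω : Type*} [MeasurableSpace Ω] {P : Measure Ω}

lemma BoundedInMean.sum_of_orthogonal [IsProbabilityMeasure P] {ι : Type*} {s : Finset ι}
    {f : ι → Ω → ℝ} {b : ℝ} (hf : ∀ i ∈ s, MemLp (f i) 2 P)
    (ho : ∀ i ∈ s, ∀ j ∈ s, i ≠ j → ∫ ω, f i ω * f j ω ∂P = 0)
    (hb : ∀ i ∈ s, ∫ ω, f i ω ^ 2 ∂P ≤ b) :
    BoundedInMean P (fun ω => ∑ i ∈ s, f i ω) √(s.card * b) :=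
  .of_sq (memLp_finsetSum _ hf) (integral_sq_sum_le_of_orthogonal hf ho hb)

lemma BoundedInMean.mul_sum_of_orthogonal [IsProbabilityMeasure P] {f : ℤ → Ω → ℝ} {b : ℝ}
    (hf : ∀ t, MemLp (f t) 2 P) (ho : ∀ s t, s ≠ t → ∫ ω, f s ω * f t ω ∂P = 0)
    (hb : ∀ t, ∫ ω, f t ω ^ 2 ∂P ≤ b) {n : ℕ} {r : ℝ} (hr : r ^ 2 * n = 1) :
    BoundedInMean P (fun ω => r * ∑ t ∈ Finset.Icc (1 : ℤ) n, f t ω) √b := by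
  refine ((BoundedInMean.sum_of_orthogonal (s := Finset.Icc (1 : ℤ) n) (fun t _ => hf t)
    (fun s _ t _ => ho s t) fun t _ => hb t).const_mul r).mono (le_of_eq ?_)
  rw [← Real.sqrt_sq_eq_abs, ← Real.sqrt_mul (sq_nonneg r)]
  simp [← mul_assoc, hr]

namespace IsRegularModel

variable {p : ℕ} {β : Fin p → ℝ} {L Q : Measure ℝ} {q κ : ℝ} {ε u z ξ : ℤ → Ω → ℝ}

variable [IsProbabilityMeasure P]

lemma integral_mul_stepIncrement (hm : IsRegularModel P β L Q q κ ε u z ξ) (x : ℝ) {t : ℤ}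
    {T M : Ω → ℝ} (hT : Measurable[pastAlgebra ε z ξ t] T)
    (hM : Measurable[pastAlgebra ε z ξ t] M) (hMint : Integrable M P) :
    ∫ ω, M ω * stepIncrement x (T ω) (ε t ω) ∂P
      = ∫ ω, M ω * (cdf L (x + T ω) - cdf L x) ∂P := by
  have hindicator : ∀ S : Ω → ℝ, Measurable[pastAlgebra ε z ξ t] S →
      Integrable (fun ω => M ω * (Set.Iic (S ω)).indicator (fun _ => (1 : ℝ)) (ε t ω)) P :=
    fun S hS => hMint.mul_bdd (c := 1) (measurable_indicator_Iic (hm.innov_measurable t)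
      (hS.mono (hm.pastAlgebra_le t) le_rfl)).aestronglyMeasurable
      (Eventually.of_forall fun ω => by by_cases h : ε t ω ≤ S ω <;> simp [h])
  have hcdf : ∀ S : Ω → ℝ, Measurable[pastAlgebra ε z ξ t] S →
      Integrable (fun ω => M ω * cdf L (S ω)) P := fun S hS =>
    hMint.mul_bdd (c := 1) ((monotone_cdf L).measurable.comp
      (hS.mono (hm.pastAlgebra_le t) le_rfl)).aestronglyMeasurable
      (Eventually.of_forall fun ω => by
        rw [Real.norm_eq_abs, abs_of_nonneg (cdf_nonneg _ _)]
        exact cdf_le_one _ _)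
  have hmean : ∀ S : Ω → ℝ, Measurable[pastAlgebra ε z ξ t] S →
      ∫ ω, M ω * (Set.Iic (S ω)).indicator (fun _ => (1 : ℝ)) (ε t ω) ∂P
        = ∫ ω, M ω * cdf L (S ω) ∂P := fun S hS => by
    rw [integral_mul_indicator_of_indep (hm.innov_measurable t) (hm.pastAlgebra_le t)
      (hm.innov_indep_past t) hS hM hMint, hm.innov_law]
  have hxT : Measurable[pastAlgebra ε z ξ t] fun ω => x + T ω := Measurable.const_add hT x
  simp only [stepIncrement, mul_sub]
  rw [integral_sub (hindicator _ hxT) (hindicator _ measurable_const),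
    integral_sub (hcdf _ hxT) (hcdf _ measurable_const), hmean _ hxT, hmean _ measurable_const]

lemma integral_mul_centredStep (hm : IsRegularModel P β L Q q κ ε u z ξ) (x : ℝ) {t : ℤ}
    {T M : Ω → ℝ} (hT : Measurable[pastAlgebra ε z ξ t] T)
    (hM : Measurable[pastAlgebra ε z ξ t] M) (hMint : Integrable M P) :
    ∫ ω, M ω * centredStep L x (T ω) (ε t ω) ∂P = 0 := by
  have hT0 : Measurable T := hT.mono (hm.pastAlgebra_le t) le_rfl
  have hstep : Integrable (fun ω => M ω * stepIncrement x (T ω) (ε t ω)) P :=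
    hMint.mul_bdd (c := 1)
      (measurable_stepIncrement x (hm.innov_measurable t) hT0).aestronglyMeasurable
      (Eventually.of_forall fun ω => abs_stepIncrement_le _ _ _)
  have hcdf : Integrable (fun ω => M ω * (cdf L (x + T ω) - cdf L x)) P :=
    hMint.mul_bdd (c := 1) (measurable_cdf_increment L x hT0).aestronglyMeasurable
      (Eventually.of_forall fun ω => abs_cdf_sub_le_one _ _ _)
  simp only [centredStep, mul_sub _ (stepIncrement _ _ _)]
  rw [integral_sub hstep hcdf, hm.integral_mul_stepIncrement x hT hM hMint, sub_self]

lemma integral_abs_stepIncrement (hm : IsRegularModel P β L Q q κ ε u z ξ) (x : ℝ) {t : ℤ}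
    {T : Ω → ℝ} (hT : Measurable[pastAlgebra ε z ξ t] T) :
    ∫ ω, |stepIncrement x (T ω) (ε t ω)| ∂P = ∫ ω, |cdf L (x + T ω) - cdf L x| ∂P := by
  have hsign : Measurable[pastAlgebra ε z ξ t] fun ω => if 0 ≤ T ω then (1 : ℝ) else -1 :=
    Measurable.ite (hT measurableSet_Ici) measurable_const measurable_const
  have hsign_int : Integrable (fun ω => if 0 ≤ T ω then (1 : ℝ) else -1) P :=
    Integrable.of_bound (hsign.mono (hm.pastAlgebra_le t) le_rfl).aestronglyMeasurable 1
      (Eventually.of_forall fun ω => by split_ifs <;> simp)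
  have hstep : ∀ a e, |stepIncrement x a e| = (if 0 ≤ a then 1 else -1) * stepIncrement x a e :=
    fun a e => abs_increment_eq_mul_of_monotone (monotone_indicator_Iic e) x a
  simp only [hstep, abs_increment_eq_mul_of_monotone (monotone_cdf L)]
  exact hm.integral_mul_stepIncrement x hT hsign hsign_int

lemma memLp_centredStep (hm : IsRegularModel P β L Q q κ ε u z ξ) (x : ℝ) {t : ℤ}
    {T : Ω → ℝ} (hT : Measurable T) : MemLp (fun ω => centredStep L x (T ω) (ε t ω)) 2 P :=
  MemLp.of_bound (measurable_centredStep L x (hm.innov_measurable t) hT).aestronglyMeasurable 2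
    (Eventually.of_forall fun _ => abs_centredStep_le _ _ _ _)

lemma integral_sq_centredStep_le (hm : IsRegularModel P β L Q q κ ε u z ξ) (x : ℝ) {t : ℤ}
    {T : Ω → ℝ} (hT : Measurable[pastAlgebra ε z ξ t] T) :
    ∫ ω, centredStep L x (T ω) (ε t ω) ^ 2 ∂P ≤ ∫ ω, |cdf L (x + T ω) - cdf L x| ∂P := by
  have hT0 : Measurable T := hT.mono (hm.pastAlgebra_le t) le_rfl
  have hincr : Measurable[pastAlgebra ε z ξ t] fun ω => cdf L (x + T ω) - cdf L x :=
    measurable_cdf_increment L x hT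
  have hincr_int : Integrable (fun ω => cdf L (x + T ω) - cdf L x) P :=
    Integrable.of_bound (measurable_cdf_increment L x hT0).aestronglyMeasurable 1
      (Eventually.of_forall fun ω => abs_cdf_sub_le_one _ _ _)
  have hstep : Integrable (fun ω => |stepIncrement x (T ω) (ε t ω)|) P :=
    (Integrable.of_bound
      (measurable_stepIncrement x (hm.innov_measurable t) hT0).aestronglyMeasurable 1
      (Eventually.of_forall fun ω => abs_stepIncrement_le _ _ _)).abs
  have hcentred := hm.memLp_centredStep x (t := t) hT0
  have hproduct : Integrable (fun ω =>
      2 * ((cdf L (x + T ω) - cdf L x) * centredStep L x (T ω) (ε t ω))) P :=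
    (hincr_int.mul_bdd (c := 2) hcentred.aestronglyMeasurable
      (Eventually.of_forall fun ω => abs_centredStep_le _ _ _ _)).const_mul 2
  calc ∫ ω, centredStep L x (T ω) (ε t ω) ^ 2 ∂P
      ≤ ∫ ω, (|stepIncrement x (T ω) (ε t ω)|
          - 2 * ((cdf L (x + T ω) - cdf L x) * centredStep L x (T ω) (ε t ω))) ∂P :=
        integral_mono hcentred.integrable_sq (hstep.sub hproduct) fun ω =>
          sq_centredStep_le L x (T ω) (ε t ω)
    _ = ∫ ω, |cdf L (x + T ω) - cdf L x| ∂P := by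
        rw [integral_sub hstep hproduct, integral_const_mul,
          hm.integral_mul_centredStep x hT hincr hincr_int, mul_zero, sub_zero,
          hm.integral_abs_stepIncrement x hT]

lemma boundedInMean_sum_centredStep (hm : IsRegularModel P β L Q q κ ε u z ξ) (x : ℝ)
    {T : ℤ → Ω → ℝ} (hT : ∀ s t, s ≤ t → Measurable[pastAlgebra ε z ξ t] (T s)) {b : ℝ}
    (hb : ∀ t, ∫ ω, |cdf L (x + T t ω) - cdf L x| ∂P ≤ b) {n : ℕ} {r : ℝ}
    (hr : r ^ 2 * n = 1) :
    BoundedInMean P (fun ω => r * ∑ t ∈ Finset.Icc (1 : ℤ) n,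
      centredStep L x (T t ω) (ε t ω)) √b := by
  have hLp : ∀ t, MemLp (fun ω => centredStep L x (T t ω) (ε t ω)) 2 P := fun t =>
    hm.memLp_centredStep x ((hT t t le_rfl).mono (hm.pastAlgebra_le t) le_rfl)
  refine .mul_sum_of_orthogonal hLp (fun s t hst => ?_)
    (fun t => (hm.integral_sq_centredStep_le x (hT t t le_rfl)).trans (hb t)) hr
  wlog h : s < t generalizing s t
  · simp only [mul_comm (centredStep L x (T s _) _)]
    exact this t s hst.symm (hst.lt_or_gt.resolve_left h)
  exact hm.integral_mul_centredStep x (hT t t le_rfl) (measurable_centredStep L x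
    (measurable_innov_pastAlgebra h) (hT s t h.le)) ((hLp s).integrable one_le_two)

lemma memLp_bern_mul_outlier (hm : IsRegularModel P β L Q q κ ε u z ξ) {φ : ℝ → ℝ}
    (hφ : Measurable φ) (hφ1 : ∀ x, |φ x| ≤ 1) (t : ℤ) :
    MemLp (fun ω => z t ω * φ (ξ t ω)) 2 P := by
  refine MemLp.of_bound ((hm.bern_measurable t).mul
    (hφ.comp (hm.outlier_measurable t))).aestronglyMeasurable 1 ?_
  filter_upwards [hm.norm_bern_le_one t] with ω hω
  rw [norm_mul]
  exact mul_le_one₀ hω (norm_nonneg _) (hφ1 _)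

lemma integral_sq_bern_mul_outlier_le (hm : IsRegularModel P β L Q q κ ε u z ξ) {φ : ℝ → ℝ}
    (hφ : Measurable φ) (hφ1 : ∀ x, |φ x| ≤ 1) (t : ℤ) :
    ∫ ω, (z t ω * φ (ξ t ω)) ^ 2 ∂P ≤ q := by
  rw [← hm.integral_bern t]
  refine integral_mono_ae (hm.memLp_bern_mul_outlier hφ hφ1 t).integrable_sq
    (hm.boundedInMean_bern t).1 ?_
  filter_upwards [hm.bern_zero_or_one] with ω hω
  rcases hω t with h | h
  · simp [h]
  · simpa [h, sq_le_one_iff_abs_le_one] using hφ1 _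

lemma boundedInMean_sum_outlier (hm : IsRegularModel P β L Q q κ ε u z ξ) {φ : ℝ → ℝ}
    (hφ : Measurable φ) (hφ1 : ∀ x, |φ x| ≤ 1) (l : ℤ) {n : ℕ} {r : ℝ} (hr : r ^ 2 * n = 1) :
    BoundedInMean P (fun ω => r * ∑ t ∈ Finset.Icc (1 : ℤ) n,
      (z (t - l) ω * φ (ξ (t - l) ω) - q * ∫ x, φ x ∂Q)) √q := by
  have hLp := hm.memLp_bern_mul_outlier hφ hφ1
  have hmean : ∀ t, ∫ ω, z t ω * φ (ξ t ω) ∂P = q * ∫ x, φ x ∂Q :=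
    hm.integral_bern_mul_outlier hφ
  refine .mul_sum_of_orthogonal (fun t => (hLp (t - l)).sub (memLp_const _))
    (fun s t hst => ?_) (fun t => ?_) hr
  · have hcov := covariance_eq_sub (hLp (s - l)) (hLp (t - l))
    simp only [covariance, Pi.mul_apply] at hcov
    rw [hm.integral_bern_mul_outlier_pair hφ (by omega), hmean, hmean, sq, sub_self] at hcov
    exact hcov
  · have hvar := variance_le_expectation_sq (hLp (t - l)).aestronglyMeasurable
    rw [variance_eq_integral (hLp (t - l)).aemeasurable, hmean] at hvar
    exact hvar.trans (hm.integral_sq_bern_mul_outlier_le hφ hφ1 (t - l))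

end IsRegularModel

end Fluctuations

section LawOfLargeNumbers

lemma sum_Icc_shift_succ (f : ℤ → ℝ) (n l : ℕ) :
    ∑ t ∈ Finset.Icc (1 : ℤ) n, f (t - ((l : ℕ) + 1)) =
      ∑ t ∈ Finset.Icc (1 : ℤ) n, f (t - (l : ℕ)) + (f (-(l : ℤ)) - f (n - (l : ℤ))) := by
  induction n with
  | zero => simp
  | succ n ih =>
    have hIcc : Finset.Icc (1 : ℤ) ((n + 1 : ℕ) : ℤ) =
        insert ((n : ℤ) + 1) (Finset.Icc (1 : ℤ) n) := by
      ext a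
      simp only [Finset.mem_insert, Finset.mem_Icc]
      omega
    have hnotMem : ((n : ℤ) + 1) ∉ Finset.Icc (1 : ℤ) n := by simp
    rw [hIcc, Finset.sum_insert hnotMem, Finset.sum_insert hnotMem, ih,
      show (n : ℤ) + 1 - (l + 1) = n - l by ring]
    push_cast
    ring

lemma SolvesAR.sum_Icc_eq {p : ℕ} {β : Fin p → ℝ} {u e : ℤ → ℝ} (h : SolvesAR β u e)
    (hβ : 1 - ∑ j, β j ≠ 0) (n : ℕ) :
    ∑ t ∈ Finset.Icc (1 : ℤ) n, u t = (1 - ∑ j, β j)⁻¹ *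
      (∑ j : Fin p, β j * (∑ t ∈ Finset.Icc (1 : ℤ) n, u (t - (((j : ℕ) + 1 : ℕ) : ℤ))
        - ∑ t ∈ Finset.Icc (1 : ℤ) n, u t) + ∑ t ∈ Finset.Icc (1 : ℤ) n, e t) := by
  have hsum : ∑ t ∈ Finset.Icc (1 : ℤ) n, u t
      = ∑ j : Fin p, β j * ∑ t ∈ Finset.Icc (1 : ℤ) n, u (t - ((j : ℕ) + 1))
        + ∑ t ∈ Finset.Icc (1 : ℤ) n, e t := by
    simp only [Finset.mul_sum]
    rw [Finset.sum_comm, ← Finset.sum_add_distrib]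
    exact Finset.sum_congr rfl fun t _ => h t
  rw [eq_inv_mul_iff_mul_eq₀ hβ]
  push_cast
  simp only [mul_sub, Finset.sum_sub_distrib, ← Finset.sum_mul]
  linear_combination hsum

variable {Ω : Type*} [MeasurableSpace Ω] {P : Measure Ω} [IsProbabilityMeasure P]

namespace IsRegularModel

variable {p : ℕ} {β : Fin p → ℝ} {L Q : Measure ℝ} {q κ : ℝ} {ε u z ξ : ℤ → Ω → ℝ}

lemma boundedInMean_sum_innov (hm : IsRegularModel P β L Q q κ ε u z ξ) {σ : ℝ}
    (hL : MemLp (fun x : ℝ => x) 2 L) (hL0 : ∫ x, x ∂L = 0) (hLσ : ∫ x, x ^ 2 ∂L ≤ σ) (n : ℕ) :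
    BoundedInMean P (fun ω => ∑ t ∈ Finset.Icc (1 : ℤ) n, ε t ω) √(n * σ) := by
  have hLp : ∀ t, MemLp (ε t) 2 P := fun t => by
    rw [← hm.innov_law t] at hL
    exact (memLp_map_measure_iff measurable_id'.aestronglyMeasurable
      (hm.innov_measurable t).aemeasurable).1 hL
  have hmean : ∀ t, ∫ ω, ε t ω ∂P = 0 := fun t => by
    rwa [← hm.innov_law t, integral_map (hm.innov_measurable t).aemeasurable
      measurable_id'.aestronglyMeasurable] at hL0
  have hsq : ∀ t, ∫ ω, ε t ω ^ 2 ∂P ≤ σ := fun t => by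
    rwa [← hm.innov_law t, integral_map (hm.innov_measurable t).aemeasurable
      (measurable_id'.pow_const 2).aestronglyMeasurable] at hLσ
  simpa using BoundedInMean.sum_of_orthogonal (s := Finset.Icc (1 : ℤ) n) (fun t _ => hLp t)
    (fun s _ t _ hst => by rw [(hm.indepFun_innov hst).integral_fun_mul_eq_mul_integral
      (hLp s).1 (hLp t).1, hmean, zero_mul]) fun t _ => hsq t

lemma boundedInMean_sum_shift_sub (hm : IsRegularModel P β L Q q κ ε u z ξ)
    (hκ : 0 ≤ κ) (n l : ℕ) :
    BoundedInMean P (fun ω => ∑ t ∈ Finset.Icc (1 : ℤ) n, u (t - (l : ℕ)) ω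
      - ∑ t ∈ Finset.Icc (1 : ℤ) n, u t ω) (l * (2 * κ)) := by
  induction l with
  | zero => exact ⟨by simp, by simp⟩
  | succ l ih =>
    have hends := (hm.boundedInMean_sol hκ (-(l : ℤ))).add
      (hm.boundedInMean_sol hκ (n - (l : ℤ))).neg
    refine ((ih.add hends).congr (Eventually.of_forall fun ω => ?_)).mono (le_of_eq ?_)
    · push_cast
      rw [sum_Icc_shift_succ (fun t => u t ω) n l]
      ring
    · push_cast
      ring

lemma boundedInMean_sum_sol (hm : IsRegularModel P β L Q q κ ε u z ξ)
    (hκ : 0 ≤ κ) (hβ : 1 - ∑ j, β j ≠ 0) {σ : ℝ} (hL : MemLp (fun x : ℝ => x) 2 L)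
    (hL0 : ∫ x, x ∂L = 0) (hLσ : ∫ x, x ^ 2 ∂L ≤ σ) (n l : ℕ) :
    BoundedInMean P (fun ω => ∑ t ∈ Finset.Icc (1 : ℤ) n, u (t - (l : ℕ)) ω)
      (|(1 - ∑ j, β j)⁻¹| * (∑ j : Fin p, |β j| * (((j : ℕ) + 1) * (2 * κ)) + √(n * σ))
        + l * (2 * κ)) := by
  have hshift : ∀ l : ℕ, BoundedInMean P (fun ω => ∑ t ∈ Finset.Icc (1 : ℤ) n, u (t - (l : ℕ)) ω
      - ∑ t ∈ Finset.Icc (1 : ℤ) n, u t ω) (l * (2 * κ)) := hm.boundedInMean_sum_shift_sub hκ n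
  have hunshifted := (((BoundedInMean.sum (s := Finset.univ) fun (j : Fin p) _ =>
    (hshift ((j : ℕ) + 1)).const_mul (β j)).add
      (hm.boundedInMean_sum_innov hL hL0 hLσ n)).const_mul (1 - ∑ j, β j)⁻¹).congr
    (Y := fun ω => ∑ t ∈ Finset.Icc (1 : ℤ) n, u t ω)
    (by filter_upwards [hm.equation] with ω hω using (hω.sum_Icc_eq hβ n).symm)
  refine ((hunshifted.add (hshift l)).congr (Eventually.of_forall fun ω => ?_)).mono
    (le_of_eq ?_)
  · exact add_sub_cancel _ _
  · push_cast
    rfl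

end IsRegularModel

end LawOfLargeNumbers

section ErrorBound

variable {p : ℕ}

/-- The bound for the mean of the martingale part of the expansion error; here and below `K` bounds
the estimation error and `r = n^{-1/2}`. -/
def martingaleBound (p : ℕ) (C K κ Γ r : ℝ) : ℝ :=
  √(C * (r * (K * (1 + p * κ))) + (p + 1) * (Γ * r))

/-- The bound for the mean of the second order terms of the expansion error. -/
def driftBound (p : ℕ) (Q : Measure ℝ) (C K κ Γ r : ℝ) : ℝ :=
  r * (C * (K ^ 2 * (2 + 2 * (p * (p * κ ^ 2)))) + 2 * C * K * ((p + 1) * (Γ * (1 + p * κ)))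
      + 2 * ((p + 1) * ((p + 1) * Γ ^ 2)))
    + (p + 1) * (Γ * ∫ x, min 1 (C * (r * K) * |x|) ∂Q)

/-- The bound for the mean of the averages of the lagged autoregression. -/
def averageBound (β : Fin p → ℝ) (κ σ r : ℝ) : ℝ :=
  r ^ 2 * (|(1 - ∑ j, β j)⁻¹| * (∑ j : Fin p, |β j| * (((j : ℕ) + 1) * (2 * κ))) + p * (2 * κ))
    + r * (|(1 - ∑ j, β j)⁻¹| * √σ)

/-- The bound for the mean fluctuation of the outlier effects. -/
def outlierBound (p : ℕ) (Γ r : ℝ) : ℝ := (p + 1) * √(Γ * r)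

/-- The bound for the mean error of the first order expansion of the residual empirical process. -/
def errorBound (β : Fin p → ℝ) (Q : Measure ℝ) (C K κ σ Γ r : ℝ) : ℝ :=
  martingaleBound p C K κ Γ r + driftBound p Q C K κ Γ r + C * (p * (K * averageBound β κ σ r))
    + outlierBound p Γ r

lemma tendsto_integral_min (Q : Measure ℝ) [IsFiniteMeasure Q] {C K : ℝ} (hC : 0 ≤ C)
    (hK : 0 ≤ K) :
    Tendsto (fun r : ℝ => ∫ x, min 1 (C * (r * K) * |x|) ∂Q) (𝓝[≥] 0) (𝓝 0) := by
  suffices h : Tendsto (fun r : ℝ => ∫ x, min 1 (C * (r * K) * |x|) ∂Q) (𝓝[≥] 0)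
      (𝓝 (∫ x : ℝ, min (1 : ℝ) (C * (0 * K) * |x|) ∂Q)) by simpa using h
  refine tendsto_integral_filter_of_dominated_convergence (fun _ => 1)
    (Eventually.of_forall fun r => ?_) ?_ (integrable_const _) (Eventually.of_forall fun x => ?_)
  · exact Measurable.aestronglyMeasurable (by fun_prop)
  · filter_upwards [self_mem_nhdsWithin] with r (hr : 0 ≤ r)
    refine Eventually.of_forall fun x => ?_
    rw [Real.norm_eq_abs, abs_of_nonneg (le_min zero_le_one (by positivity))]
    exact min_le_left _ _
  · have hcont : Continuous fun r : ℝ => min 1 (C * (r * K) * |x|) := by fun_prop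
    exact (hcont.tendsto 0).mono_left nhdsWithin_le_nhds

lemma tendsto_driftBound (p : ℕ) (Q : Measure ℝ) [IsFiniteMeasure Q] {C K : ℝ} (hC : 0 ≤ C)
    (hK : 0 ≤ K) (κ Γ : ℝ) : Tendsto (driftBound p Q C K κ Γ) (𝓝[≥] 0) (𝓝 0) := by
  have hlinear : Tendsto (fun r : ℝ => r * (C * (K ^ 2 * (2 + 2 * (p * (p * κ ^ 2))))
      + 2 * C * K * ((p + 1) * (Γ * (1 + p * κ))) + 2 * ((p + 1) * ((p + 1) * Γ ^ 2))))
      (𝓝[≥] 0) (𝓝 0) :=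
    (Continuous.tendsto' (by fun_prop) _ _ (by simp)).mono_left nhdsWithin_le_nhds
  simpa only [mul_zero, add_zero, ← driftBound.eq_def] using
    hlinear.add (((tendsto_integral_min Q hC hK).const_mul Γ).const_mul (p + 1 : ℝ))

lemma tendsto_errorBound (β : Fin p → ℝ) (Q : Measure ℝ) [IsFiniteMeasure Q] {C K : ℝ}
    (hC : 0 ≤ C) (hK : 0 ≤ K) (κ σ Γ : ℝ) :
    Tendsto (errorBound β Q C K κ σ Γ) (𝓝[≥] 0) (𝓝 0) := by
  have hmartingale : Tendsto (martingaleBound p C K κ Γ) (𝓝[≥] 0) (𝓝 0) :=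
    (Continuous.tendsto' (by unfold martingaleBound; fun_prop) 0 0
      (by simp [martingaleBound])).mono_left nhdsWithin_le_nhds
  have haverage : Tendsto (averageBound β κ σ) (𝓝[≥] 0) (𝓝 0) :=
    (Continuous.tendsto' (by unfold averageBound; fun_prop) 0 0 (by simp [averageBound])).mono_left
      nhdsWithin_le_nhds
  have houtlier : Tendsto (outlierBound p Γ) (𝓝[≥] 0) (𝓝 0) :=
    (Continuous.tendsto' (by unfold outlierBound; fun_prop) 0 0 (by simp [outlierBound])).mono_left
      nhdsWithin_le_nhds
  have hdrift := tendsto_driftBound p Q hC hK κ Γ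
  simpa only [mul_zero, add_zero, ← errorBound.eq_def] using ((hmartingale.add hdrift).add
    (((haverage.const_mul K).const_mul (p : ℝ)).const_mul C)).add houtlier

end ErrorBound

section FixedParameter

/-- The normalized change `n^{-1/2} ∑ (1(e_t ≤ x + a_t) - 1(e_t ≤ x))`, with `r = n^{-1/2}`. -/
def changeSum (n : ℕ) (r x : ℝ) (a e : ℤ → ℝ) : ℝ :=
  r * ∑ t ∈ Finset.Icc (1 : ℤ) n, stepIncrement x (a t) (e t)

variable {p : ℕ}

lemma mul_sum_perturbation {n : ℕ} {r : ℝ} (hr : r ^ 2 * n = 1) (ϑ : ℝ × (Fin p → ℝ)) (s : ℝ)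
    (u : ℤ → ℝ) :
    r ^ 2 * ∑ t ∈ Finset.Icc (1 : ℤ) n, perturbation ϑ s u t =
      ϑ.1 + ∑ j : Fin p, ϑ.2 j *
          (r ^ 2 * ∑ t ∈ Finset.Icc (1 : ℤ) n, u (t - (((j : ℕ) + 1 : ℕ) : ℤ)))
        + s * (r ^ 2 * ∑ t ∈ Finset.Icc (1 : ℤ) n, lagAbs p u t) := by
  have hlinear : ∑ t ∈ Finset.Icc (1 : ℤ) n, perturbation ϑ s u t = n * ϑ.1
      + ∑ j : Fin p, ϑ.2 j * ∑ t ∈ Finset.Icc (1 : ℤ) n, u (t - (((j : ℕ) + 1 : ℕ) : ℤ))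
      + s * ∑ t ∈ Finset.Icc (1 : ℤ) n, lagAbs p u t := by
    simp only [perturbation, Finset.sum_add_distrib, Finset.sum_const, Int.card_Icc, nsmul_eq_mul,
      Finset.mul_sum]
    rw [Finset.sum_comm]
    simp
  simp only [mul_left_comm _ (r ^ 2), ← Finset.mul_sum]
  rw [hlinear]
  linear_combination ϑ.1 * hr

lemma sum_outlier_sub_eq (n : ℕ) (r q : ℝ) (m : Fin (p + 1) → ℝ) (f : Fin (p + 1) → ℤ → ℝ) :
    ∑ i, r * ∑ t ∈ Finset.Icc (1 : ℤ) n, (f i t - q * m i) =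
      r * ∑ t ∈ Finset.Icc (1 : ℤ) n, ∑ i, f i t - r * n * (q * ∑ i, m i) := by
  rw [← Finset.mul_sum, Finset.sum_comm]
  simp only [Finset.sum_sub_distrib, Finset.sum_const, Int.card_Icc, nsmul_eq_mul,
    ← Finset.mul_sum]
  simp
  ring

lemma changeSum_sub_eq (L : Measure ℝ) (x g q : ℝ) (m : Fin (p + 1) → ℝ) (β : Fin p → ℝ)
    (ϑ : ℝ × (Fin p → ℝ)) (s : ℝ) {n : ℕ} {r : ℝ} (hr : r ^ 2 * n = 1) (u z ξ e : ℤ → ℝ) :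
    changeSum n r x (threshold β ϑ s r u fun t => z t * ξ t) e
        - g * (ϑ.1 + s * (r ^ 2 * ∑ t ∈ Finset.Icc (1 : ℤ) n, lagAbs p u t))
        - r * n * (q * ∑ i, m i) =
      r * (∑ t ∈ Finset.Icc (1 : ℤ) n,
          centredStep L x (threshold β ϑ s r u (fun t => z t * ξ t) t) (e t))
        + r * (∑ t ∈ Finset.Icc (1 : ℤ) n,
          driftRemainder (fun y => cdf L y) x g β ϑ s r u z ξ t)
        + g * (∑ j : Fin p, ϑ.2 j *
          (r ^ 2 * ∑ t ∈ Finset.Icc (1 : ℤ) n, u (t - (((j : ℕ) + 1 : ℕ) : ℤ))))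
        + ∑ i : Fin (p + 1), r * ∑ t ∈ Finset.Icc (1 : ℤ) n, (z (t - (i : ℕ)) *
          (cdf L (x + Matrix.vecCons (-1) β i * ξ (t - (i : ℕ))) - cdf L x) - q * m i) := by
  rw [sum_outlier_sub_eq n r q m fun i t => z (t - (i : ℕ)) *
    (cdf L (x + Matrix.vecCons (-1) β i * ξ (t - (i : ℕ))) - cdf L x)]
  simp only [changeSum, centredStep, driftRemainder, Finset.sum_sub_distrib, ← Finset.mul_sum]
  linear_combination g * mul_sum_perturbation hr ϑ s u

lemma integrable_cdf_affine (Q : Measure ℝ) [IsFiniteMeasure Q] (L : Measure ℝ) (x b : ℝ) :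
    Integrable (fun y => cdf L (x + b * y)) Q := by
  refine Integrable.of_bound ((monotone_cdf L).measurable.comp
    ((measurable_id.const_mul b).const_add x)).aestronglyMeasurable 1
    (Eventually.of_forall fun y => ?_)
  rw [Real.norm_eq_abs, abs_of_nonneg (cdf_nonneg _ _)]
  exact cdf_le_one _ _

lemma shift_cdf_eq_sum_integral (β : Fin p → ℝ) (L Q : Measure ℝ) [IsProbabilityMeasure Q]
    (x : ℝ) :
    shift β (fun y => cdf L y) Q x =
      ∑ i : Fin (p + 1), ∫ y, (cdf L (x + Matrix.vecCons (-1) β i * y) - cdf L x) ∂Q := by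
  refine Finset.sum_congr rfl fun i _ => ?_
  rw [integral_sub (integrable_cdf_affine Q L x _) (integrable_const _), integral_const,
    probReal_univ, one_smul]

namespace IsRegularModel

variable {Ω : Type*} [MeasurableSpace Ω] {P : Measure Ω}
variable {β : Fin p → ℝ} {L Q : Measure ℝ} {q κ : ℝ} {ε u z ξ : ℤ → Ω → ℝ}

lemma measurable_threshold (hm : IsRegularModel P β L Q q κ ε u z ξ) (ϑ : ℝ × (Fin p → ℝ))
    (s r : ℝ) (t : ℤ) :
    Measurable fun ω => threshold β ϑ s r (fun t => u t ω) (fun t => z t ω * ξ t ω) t :=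
  (hm.measurable_threshold_pastAlgebra ϑ s r le_rfl).mono (hm.pastAlgebra_le t) le_rfl

lemma measurable_driftRemainder (hm : IsRegularModel P β L Q q κ ε u z ξ) (x g : ℝ)
    (ϑ : ℝ × (Fin p → ℝ)) (s r : ℝ) (t : ℤ) :
    Measurable fun ω => driftRemainder (fun y => cdf L y) x g β ϑ s r (fun t => u t ω)
      (fun t => z t ω) (fun t => ξ t ω) t :=
  ((measurable_cdf_increment L x (hm.measurable_threshold ϑ s r t)).sub
    (((measurable_perturbation ϑ s fun t' _ => hm.sol_measurable t').const_mul r).const_mul g)).sub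
    (Finset.measurable_sum _ fun _ _ => (hm.bern_measurable _).mul
      (measurable_cdf_increment L x ((hm.outlier_measurable _).const_mul _)))

variable [IsProbabilityMeasure P] {C x g : ℝ} {n : ℕ} {r Γ : ℝ}

lemma boundedInMean_increment_threshold (hm : IsRegularModel P β L Q q κ ε u z ξ) (hκ : 0 ≤ κ)
    (hF : HasExpansion (fun y => cdf L y) C x g) (ϑ : ℝ × (Fin p → ℝ)) (s : ℝ) (hr : 0 ≤ r)
    (t : ℤ) :
    BoundedInMean P (fun ω => cdf L (x + threshold β ϑ s r (fun t => u t ω)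
        (fun t => z t ω * ξ t ω) t) - cdf L x)
      (C * (r * ((‖ϑ‖ + |s|) * (1 + p * κ))) + (p + 1) * q) := by
  have hlag := (((hm.boundedInMean_lagAbs hκ t).const_mul (‖ϑ‖ + |s|)).const_mul r).const_mul C
  rw [abs_of_nonneg hF.nonneg, abs_of_nonneg hr,
    abs_of_nonneg (by positivity : 0 ≤ ‖ϑ‖ + |s|)] at hlag
  refine (hlag.add (hm.boundedInMean_outlierCount t)).of_abs_le
    (measurable_cdf_increment L x (hm.measurable_threshold ϑ s r t)).aestronglyMeasurable ?_
  filter_upwards [hm.bern_zero_or_one] with ω hω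
  exact hF.abs_increment_threshold_le β ϑ s hr hω (fun t => u t ω) (fun t => ξ t ω) t

lemma boundedInMean_martingale (hm : IsRegularModel P β L Q q κ ε u z ξ) (hκ : 0 ≤ κ)
    (hF : HasExpansion (fun y => cdf L y) C x g) (ϑ : ℝ × (Fin p → ℝ)) (s : ℝ) (hr : 0 ≤ r)
    (hrn : r ^ 2 * n = 1) (hqr : q ≤ Γ * r) :
    BoundedInMean P (fun ω => r * ∑ t ∈ Finset.Icc (1 : ℤ) n, centredStep L x
        (threshold β ϑ s r (fun t => u t ω) (fun t => z t ω * ξ t ω) t) (ε t ω))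
      (martingaleBound p C (‖ϑ‖ + |s|) κ Γ r) :=
  (hm.boundedInMean_sum_centredStep x
    (fun _ _ hst => hm.measurable_threshold_pastAlgebra ϑ s r hst)
    (fun t => (hm.boundedInMean_increment_threshold hκ hF ϑ s hr t).2) hrn).mono <|
      Real.sqrt_le_sqrt (by gcongr)

lemma boundedInMean_driftRemainder (hm : IsRegularModel P β L Q q κ ε u z ξ) (hκ : 0 ≤ κ)
    (hq : 0 ≤ q) (hF : HasExpansion (fun y => cdf L y) C x g) (ϑ : ℝ × (Fin p → ℝ)) (s : ℝ)
    (hr : 0 ≤ r) (t : ℤ) :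
    BoundedInMean P (fun ω => driftRemainder (fun y => cdf L y) x g β ϑ s r (fun t => u t ω)
        (fun t => z t ω) (fun t => ξ t ω) t)
      (C * (r * (‖ϑ‖ + |s|)) ^ 2 * (2 + 2 * (p * (p * κ ^ 2)))
        + 2 * C * (r * (‖ϑ‖ + |s|)) * ((p + 1) * (q * (1 + p * κ)))
        + (p + 1) * (q * ∫ x, min 1 (C * (r * (‖ϑ‖ + |s|)) * |x|) ∂Q)
        + 2 * ((p + 1) * ((p + 1) * q ^ 2))) := by
  have hC := hF.nonneg
  set R := r * (‖ϑ‖ + |s|) with hR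
  have hR0 : 0 ≤ R := by positivity
  have hsq := (hm.boundedInMean_sq_lagAbs hκ t).const_mul (C * R ^ 2)
  have hcross := (hm.boundedInMean_lagAbs_mul_outlierCount hκ hq t).const_mul (2 * C * R)
  have hpair := (hm.boundedInMean_sq_outlierCount_sub t).const_mul 2
  rw [abs_of_nonneg (by positivity)] at hsq hcross hpair
  refine (((hsq.add hcross).add (hm.boundedInMean_sum_bern_mul_min (mul_nonneg hC hR0) t)).add
    hpair).of_abs_le (hm.measurable_driftRemainder x g ϑ s r t).aestronglyMeasurable ?_
  filter_upwards [hm.bern_zero_or_one] with ω hω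
  refine (hF.abs_driftRemainder_le β ϑ s hr hω (fun t => u t ω) (fun t => ξ t ω) t).trans_eq ?_
  rw [← mul_assoc r, ← hR]
  ring

lemma boundedInMean_sum_driftRemainder (hm : IsRegularModel P β L Q q κ ε u z ξ) (hκ : 0 ≤ κ)
    (hq : 0 ≤ q) (hF : HasExpansion (fun y => cdf L y) C x g) (ϑ : ℝ × (Fin p → ℝ)) (s : ℝ)
    (hr : 0 ≤ r) (hrn : r ^ 2 * n = 1) (hqr : q ≤ Γ * r) :
    BoundedInMean P (fun ω => r * ∑ t ∈ Finset.Icc (1 : ℤ) n,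
        driftRemainder (fun y => cdf L y) x g β ϑ s r (fun t => u t ω) (fun t => z t ω)
          (fun t => ξ t ω) t)
      (driftBound p Q C (‖ϑ‖ + |s|) κ Γ r) := by
  have hC := hF.nonneg
  have hsum := (BoundedInMean.sum (s := Finset.Icc (1 : ℤ) n) fun t _ =>
    hm.boundedInMean_driftRemainder hκ hq hF ϑ s hr t).const_mul r
  rw [abs_of_nonneg hr, Finset.sum_const, Int.card_Icc, add_sub_cancel_right, Int.toNat_natCast,
    nsmul_eq_mul] at hsum
  refine hsum.mono ?_
  set K := ‖ϑ‖ + |s|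
  have _ : 0 ≤ K := by positivity
  set I := ∫ x, min 1 (C * (r * K) * |x|) ∂Q
  have _ : 0 ≤ I := integral_nonneg fun x => le_min zero_le_one (by positivity)
  calc r * (n * (C * (r * K) ^ 2 * (2 + 2 * (p * (p * κ ^ 2)))
        + 2 * C * (r * K) * ((p + 1) * (q * (1 + p * κ))) + (p + 1) * (q * I)
        + 2 * ((p + 1) * ((p + 1) * q ^ 2))))
      ≤ r * (n * (C * (r * K) ^ 2 * (2 + 2 * (p * (p * κ ^ 2)))
        + 2 * C * (r * K) * ((p + 1) * (Γ * r * (1 + p * κ))) + (p + 1) * (Γ * r * I)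
        + 2 * ((p + 1) * ((p + 1) * (Γ * r) ^ 2)))) := by gcongr
    _ = r ^ 2 * n * driftBound p Q C K κ Γ r := by rw [driftBound]; ring
    _ = driftBound p Q C K κ Γ r := by rw [hrn, one_mul]

lemma boundedInMean_average_sol (hm : IsRegularModel P β L Q q κ ε u z ξ) (hκ : 0 ≤ κ)
    (hβ : 1 - ∑ j, β j ≠ 0) {σ : ℝ} (hL : MemLp (fun x : ℝ => x) 2 L) (hL0 : ∫ x, x ∂L = 0)
    (hLσ : ∫ x, x ^ 2 ∂L ≤ σ) (hrn : r * √n = 1) {l : ℕ} (hl : l ≤ p) :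
    BoundedInMean P (fun ω => r ^ 2 * ∑ t ∈ Finset.Icc (1 : ℤ) n, u (t - (l : ℕ)) ω)
      (averageBound β κ σ r) := by
  refine ((hm.boundedInMean_sum_sol hκ hβ hL hL0 hLσ n l).const_mul (r ^ 2)).mono ?_
  rw [abs_of_nonneg (sq_nonneg r), Real.sqrt_mul n.cast_nonneg]
  calc r ^ 2 * (|(1 - ∑ j, β j)⁻¹| *
          (∑ j : Fin p, |β j| * (((j : ℕ) + 1) * (2 * κ)) + √n * √σ) + l * (2 * κ))
      ≤ r ^ 2 * (|(1 - ∑ j, β j)⁻¹| *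
          (∑ j : Fin p, |β j| * (((j : ℕ) + 1) * (2 * κ)) + √n * √σ) + p * (2 * κ)) := by gcongr
    _ = averageBound β κ σ r := by
        rw [averageBound]
        linear_combination (r * |(1 - ∑ j, β j)⁻¹| * √σ) * hrn

lemma boundedInMean_linear (hm : IsRegularModel P β L Q q κ ε u z ξ) (hκ : 0 ≤ κ)
    (hβ : 1 - ∑ j, β j ≠ 0) {σ : ℝ} (hL : MemLp (fun x : ℝ => x) 2 L) (hL0 : ∫ x, x ∂L = 0)
    (hLσ : ∫ x, x ^ 2 ∂L ≤ σ) (hr : 0 ≤ r) (hrn : r * √n = 1) (hg : |g| ≤ C)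
    {ϑ : ℝ × (Fin p → ℝ)} {K : ℝ} (hK : ‖ϑ‖ ≤ K) :
    BoundedInMean P (fun ω => g * ∑ j : Fin p, ϑ.2 j *
        (r ^ 2 * ∑ t ∈ Finset.Icc (1 : ℤ) n, u (t - (((j : ℕ) + 1 : ℕ) : ℤ)) ω))
      (C * (p * (K * averageBound β κ σ r))) := by
  have hbound : 0 ≤ averageBound β κ σ r := by rw [averageBound]; positivity
  have hcoeff : ∀ j, |ϑ.2 j| ≤ K := fun j =>
    (norm_le_pi_norm ϑ.2 j).trans ((norm_snd_le ϑ).trans hK)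
  have hsum := BoundedInMean.sum (s := Finset.univ) fun (j : Fin p) _ =>
    ((hm.boundedInMean_average_sol hκ hβ hL hL0 hLσ hrn (Nat.succ_le_of_lt j.2)).const_mul
      (ϑ.2 j)).mono (mul_le_mul_of_nonneg_right (hcoeff j) hbound)
  have hK0 : 0 ≤ K := (norm_nonneg ϑ).trans hK
  rw [Finset.sum_const, Finset.card_univ, Fintype.card_fin, nsmul_eq_mul] at hsum
  exact (hsum.const_mul g).mono (mul_le_mul_of_nonneg_right hg (by positivity))

lemma boundedInMean_sum_outlier_increment (hm : IsRegularModel P β L Q q κ ε u z ξ) (x : ℝ)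
    (hrn : r ^ 2 * n = 1) (hqr : q ≤ Γ * r) :
    BoundedInMean P (fun ω => ∑ i : Fin (p + 1), r * ∑ t ∈ Finset.Icc (1 : ℤ) n,
        (z (t - (i : ℕ)) ω *
          (cdf L (x + Matrix.vecCons (-1) β i * ξ (t - (i : ℕ)) ω) - cdf L x)
          - q * ∫ y, (cdf L (x + Matrix.vecCons (-1) β i * y) - cdf L x) ∂Q))
      (outlierBound p Γ r) := by
  refine (BoundedInMean.sum (s := Finset.univ) fun (i : Fin (p + 1)) _ =>
    hm.boundedInMean_sum_outlier
      (measurable_cdf_increment L x (measurable_id.const_mul (Matrix.vecCons (-1) β i)))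
      (fun y => abs_cdf_sub_le_one L _ _) (i : ℕ) hrn).mono ?_
  rw [Finset.sum_const, Finset.card_univ, Fintype.card_fin, nsmul_eq_mul, outlierBound]
  push_cast
  gcongr

lemma boundedInMean_changeSum_sub [IsProbabilityMeasure Q]
    (hm : IsRegularModel P β L Q q κ ε u z ξ) (hκ : 0 ≤ κ) (hq : 0 ≤ q)
    (hβ : 1 - ∑ j, β j ≠ 0) {σ : ℝ} (hL : MemLp (fun x : ℝ => x) 2 L) (hL0 : ∫ x, x ∂L = 0)
    (hLσ : ∫ x, x ^ 2 ∂L ≤ σ) (hF : HasExpansion (fun y => cdf L y) C x g)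
    (ϑ : ℝ × (Fin p → ℝ)) (s : ℝ) (hr : 0 ≤ r) (hrn : r * √n = 1) (hqr : q ≤ Γ * r) :
    BoundedInMean P (fun ω => changeSum n r x
        (threshold β ϑ s r (fun t => u t ω) (fun t => z t ω * ξ t ω)) (fun t => ε t ω)
          - g * (ϑ.1 + s * (r ^ 2 * ∑ t ∈ Finset.Icc (1 : ℤ) n, lagAbs p (fun t => u t ω) t))
          - √n * q * shift β (fun y => cdf L y) Q x)
      (errorBound β Q C (‖ϑ‖ + |s|) κ σ Γ r) := by
  have hn : √(n : ℝ) * √n = n := Real.mul_self_sqrt n.cast_nonneg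
  have hrn₂ : r ^ 2 * n = 1 := by rw [← hn]; linear_combination (r * √n + 1) * hrn
  have hrn₁ : r * n = √n := by linear_combination √(n : ℝ) * hrn - r * hn
  refine ((((hm.boundedInMean_martingale hκ hF ϑ s hr hrn₂ hqr).add
    (hm.boundedInMean_sum_driftRemainder hκ hq hF ϑ s hr hrn₂ hqr)).add
    (hm.boundedInMean_linear hκ hβ hL hL0 hLσ hr hrn hF.abs_slope_le
      (le_add_of_nonneg_right (abs_nonneg s)))).add
    (hm.boundedInMean_sum_outlier_increment x hrn₂ hqr)).congr (Eventually.of_forall fun ω => ?_)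
  beta_reduce
  rw [← changeSum_sub_eq L x g q _ β ϑ s hrn₂, ← shift_cdf_eq_sum_integral, hrn₁]
  ring

end IsRegularModel

end FixedParameter

section Mixture

/-- The mixture `(1 - r) Q₀ + r Q₁`, the law whose distribution function is `mixtureCdf`. -/
def mixtureLaw (Q₀ Q₁ : Measure ℝ) (r : ℝ) : Measure ℝ :=
  ENNReal.ofReal (1 - r) • Q₀ + ENNReal.ofReal r • Q₁

lemma memLp_mixtureLaw {Q₀ Q₁ : Measure ℝ} {f : ℝ → ℝ} (hf : Measurable f) (hf₀ : MemLp f 2 Q₀)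
    (hf₁ : MemLp f 2 Q₁) (r : ℝ) : MemLp f 2 (mixtureLaw Q₀ Q₁ r) := by
  rw [memLp_two_iff_integrable_sq hf.aestronglyMeasurable]
  exact (hf₀.integrable_sq.smul_measure ENNReal.ofReal_ne_top).add_measure
    (hf₁.integrable_sq.smul_measure ENNReal.ofReal_ne_top)

variable {Q₀ Q₁ : Measure ℝ} {r : ℝ}

lemma integral_mixtureLaw (hr : r ∈ Set.Icc 0 1) {f : ℝ → ℝ} (hf₀ : Integrable f Q₀)
    (hf₁ : Integrable f Q₁) :
    ∫ x, f x ∂mixtureLaw Q₀ Q₁ r = (1 - r) * ∫ x, f x ∂Q₀ + r * ∫ x, f x ∂Q₁ := by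
  rw [mixtureLaw, integral_add_measure (hf₀.smul_measure ENNReal.ofReal_ne_top)
    (hf₁.smul_measure ENNReal.ofReal_ne_top), integral_smul_measure, integral_smul_measure,
    ENNReal.toReal_ofReal (sub_nonneg.2 hr.2), ENNReal.toReal_ofReal hr.1, smul_eq_mul,
    smul_eq_mul]

lemma integral_sq_mixtureLaw_le (hr : r ∈ Set.Icc 0 1)
    (h₀ : MemLp (fun x : ℝ => x) 2 Q₀) (h₁ : MemLp (fun x : ℝ => x) 2 Q₁) :
    ∫ x, x ^ 2 ∂mixtureLaw Q₀ Q₁ r ≤ ∫ x, x ^ 2 ∂Q₀ + ∫ x, x ^ 2 ∂Q₁ := by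
  rw [integral_mixtureLaw hr h₀.integrable_sq h₁.integrable_sq]
  exact add_le_add
    (mul_le_of_le_one_left (integral_nonneg fun _ => sq_nonneg _) (sub_le_self 1 hr.1))
    (mul_le_of_le_one_left (integral_nonneg fun _ => sq_nonneg _) hr.2)

lemma IsSmoothCenteredLaw.integral_mixtureLaw_eq_zero [IsFiniteMeasure Q₀] [IsFiniteMeasure Q₁]
    (h₀ : IsSmoothCenteredLaw Q₀) (h₁ : IsSmoothCenteredLaw Q₁) (hr : r ∈ Set.Icc 0 1) :
    ∫ x, x ∂mixtureLaw Q₀ Q₁ r = 0 := by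
  rw [integral_mixtureLaw hr (h₀.finite_variance.integrable one_le_two)
    (h₁.finite_variance.integrable one_le_two), h₀.mean_zero, h₁.mean_zero, mul_zero, mul_zero,
    add_zero]

lemma HasExpansion.mixture {F₀ F₁ F : ℝ → ℝ} {C₀ C₁ x g₀ g₁ : ℝ} (hF₀ : HasExpansion F₀ C₀ x g₀)
    (hF₁ : HasExpansion F₁ C₁ x g₁) (hr : r ∈ Set.Icc 0 1)
    (hF : ∀ y, F y = (1 - r) * F₀ y + r * F₁ y) :
    HasExpansion F (C₀ + C₁) x ((1 - r) * g₀ + r * g₁) := by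
  have hr' : 0 ≤ 1 - r := sub_nonneg.2 hr.2
  have habs : ∀ {a b A B : ℝ}, |a| ≤ A → |b| ≤ B →
      |(1 - r) * a + r * b| ≤ (1 - r) * A + r * B := fun {a b A B} ha hb => by
    calc |(1 - r) * a + r * b| ≤ |(1 - r) * a| + |r * b| := abs_add_le _ _
      _ = (1 - r) * |a| + r * |b| := by rw [abs_mul, abs_mul, abs_of_nonneg hr', abs_of_nonneg hr.1]
      _ ≤ (1 - r) * A + r * B :=
          add_le_add (mul_le_mul_of_nonneg_left ha hr') (mul_le_mul_of_nonneg_left hb hr.1)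
  have hweights : (1 - r) * C₀ + r * C₁ ≤ C₀ + C₁ := add_le_add
    (mul_le_of_le_one_left hF₀.nonneg (sub_le_self 1 hr.1)) (mul_le_of_le_one_left hF₁.nonneg hr.2)
  have hscale : ∀ {a b c y : ℝ}, 0 ≤ y → |a| ≤ C₀ * y → |b| ≤ C₁ * y →
      c = (1 - r) * a + r * b → |c| ≤ (C₀ + C₁) * y := fun {a b c y} hy ha hb hc => by
    rw [hc]
    exact (habs ha hb).trans <| (by ring : _ = ((1 - r) * C₀ + r * C₁) * y).trans_le
      (mul_le_mul_of_nonneg_right hweights hy)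
  refine ⟨add_nonneg hF₀.nonneg hF₁.nonneg, fun a b => ?_, fun a b => ?_,
    (habs hF₀.abs_slope_le hF₁.abs_slope_le).trans hweights, fun a => ?_⟩
  · calc |F a - F b| = |(1 - r) * (F₀ a - F₀ b) + r * (F₁ a - F₁ b)| := by
          rw [hF, hF]; congr 1; ring
      _ ≤ (1 - r) * 1 + r * 1 := habs (hF₀.abs_sub_le_one a b) (hF₁.abs_sub_le_one a b)
      _ = 1 := by ring
  · exact hscale (abs_nonneg _) (hF₀.abs_sub_le a b) (hF₁.abs_sub_le a b) (by rw [hF, hF]; ring)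
  · exact hscale (sq_nonneg _) (hF₀.abs_remainder_le a) (hF₁.abs_remainder_le a)
      (by rw [hF, hF]; ring)

lemma abs_shift_cdf_le {p : ℕ} (β : Fin p → ℝ) (L Q : Measure ℝ) [IsProbabilityMeasure Q]
    (x : ℝ) : |shift β (fun y => cdf L y) Q x| ≤ p + 1 := by
  rw [shift_cdf_eq_sum_integral]
  refine (Finset.abs_sum_le_sum_abs _ _).trans ?_
  refine (Finset.sum_le_card_nsmul _ _ 1 fun i _ => ?_).trans (by simp)
  have hbound : ∀ᵐ y ∂Q, ‖cdf L (x + Matrix.vecCons (-1) β i * y) - cdf L x‖ ≤ 1 :=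
    Eventually.of_forall fun y => abs_cdf_sub_le_one L _ x
  simpa only [Real.norm_eq_abs, probReal_univ, mul_one] using
    norm_integral_le_of_norm_le_const hbound

variable [IsProbabilityMeasure Q₀] [IsProbabilityMeasure Q₁]

lemma isProbabilityMeasure_mixtureLaw (hr : r ∈ Set.Icc 0 1) :
    IsProbabilityMeasure (mixtureLaw Q₀ Q₁ r) := by
  constructor
  simp only [mixtureLaw, Measure.add_apply, Measure.smul_apply, measure_univ, smul_eq_mul, mul_one]
  rw [← ENNReal.ofReal_add (sub_nonneg.2 hr.2) hr.1, sub_add_cancel, ENNReal.ofReal_one]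

lemma cdf_mixtureLaw (hr : r ∈ Set.Icc 0 1) (x : ℝ) :
    cdf (mixtureLaw Q₀ Q₁ r) x = (1 - r) * cdf Q₀ x + r * cdf Q₁ x := by
  have _ := isProbabilityMeasure_mixtureLaw (Q₀ := Q₀) (Q₁ := Q₁) hr
  have hindicator := integral_mixtureLaw (Q₀ := Q₀) (Q₁ := Q₁) hr
    (f := (Set.Iic x).indicator fun _ => (1 : ℝ))
    ((integrable_const _).indicator measurableSet_Iic)
    ((integrable_const _).indicator measurableSet_Iic)
  simpa only [integral_indicator_const _ measurableSet_Iic, smul_eq_mul, mul_one,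
    ← cdf_eq_real] using hindicator

lemma shift_mixtureLaw {p : ℕ} (β : Fin p → ℝ) (Q : Measure ℝ) [IsFiniteMeasure Q] (x : ℝ)
    (hr : r ∈ Set.Icc 0 1) :
    shift β (fun y => cdf (mixtureLaw Q₀ Q₁ r) y) Q x
      = (1 - r) * shift β (fun y => cdf Q₀ y) Q x + r * shift β (fun y => cdf Q₁ y) Q x := by
  simp only [shift, cdf_mixtureLaw hr, Finset.mul_sum]
  rw [← Finset.sum_add_distrib]
  refine Finset.sum_congr rfl fun i _ => ?_
  rw [integral_add ((integrable_cdf_affine Q Q₀ x _).const_mul _)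
    ((integrable_cdf_affine Q Q₁ x _).const_mul _), integral_const_mul, integral_const_mul]
  ring

end Mixture

section Residuals

variable {p : ℕ} {β : Fin p → ℝ} {n : ℕ} {r x : ℝ}

/-- The estimation errors of the mean and of the coefficients, scaled by `R = √n` and combined into
the parameter of `threshold` which turns innovations into residuals. -/
def estimationError (β : Fin p → ℝ) (μ R m : ℝ) (b : Fin p → ℝ) : ℝ × (Fin p → ℝ) :=
  (R * (m - μ) * (1 - ∑ j, b j), R • (b - β))

lemma arResidual_eq_sub_threshold {u w y e : ℤ → ℝ} {μ R : ℝ} (hrR : r * R = 1)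
    (hy : ∀ s, y s = u s + μ + w s) (hu : SolvesAR β u e) (m : ℝ) (b : Fin p → ℝ) (t : ℤ) :
    arResidual y m b t = e t - threshold β (estimationError β μ R m b) 0 r u w t := by
  have hcontamination : contamination β w t =
      -w t + ∑ j : Fin p, β j * w (t - ((j : ℕ) + 1)) := by
    rw [contamination, Fin.sum_univ_succ]
    simp
  set V := ∑ j : Fin p, b j * (u (t - ((j : ℕ) + 1)) + w (t - ((j : ℕ) + 1))) with hV
  have hobservations : ∑ j : Fin p, b j * (y (t - ((j : ℕ) + 1)) - m) = V + (μ - m) * ∑ j, b j := by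
    rw [hV, Finset.mul_sum, ← Finset.sum_add_distrib]
    exact Finset.sum_congr rfl fun j _ => by rw [hy]; ring
  have hcoefficients :
      ∑ j : Fin p, (R • (b - β)) j * (u (t - ((j : ℕ) + 1)) + w (t - ((j : ℕ) + 1))) =
        R * (V - ∑ j : Fin p, β j * u (t - ((j : ℕ) + 1))
          - ∑ j : Fin p, β j * w (t - ((j : ℕ) + 1))) := by
    rw [hV, ← Finset.sum_sub_distrib, ← Finset.sum_sub_distrib, Finset.mul_sum]
    refine Finset.sum_congr rfl fun j _ => ?_
    simp only [Pi.smul_apply, Pi.sub_apply, smul_eq_mul]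
    ring
  rw [arResidual, threshold, perturbation, estimationError, hcontamination, hobservations,
    hcoefficients, hy t, hu t]
  linear_combination ((m - μ) * (1 - ∑ j, b j) + (V - ∑ j : Fin p, β j * u (t - ((j : ℕ) + 1))
    - ∑ j : Fin p, β j * w (t - ((j : ℕ) + 1)))) * hrR

lemma sqrt_mul_edf_sub_eq_changeSum {ρ e a : ℤ → ℝ} (h : ∀ t, ρ t = e t - a t) :
    √(n : ℝ) * (edf n ρ x - edf n e x) = changeSum n (1 / √(n : ℝ)) x a e := by
  rw [edf, edf, changeSum, ← mul_sub, ← mul_assoc, ← div_eq_mul_inv, Real.sqrt_div_self',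
    ← Finset.sum_sub_distrib]
  simp only [stepIncrement, Set.indicator, Set.mem_Iic, h, sub_le_iff_le_add]

lemma changeSum_mono (hr : 0 ≤ r) {a b : ℤ → ℝ} (h : ∀ t, a t ≤ b t) (e : ℤ → ℝ) :
    changeSum n r x a e ≤ changeSum n r x b e :=
  mul_le_mul_of_nonneg_left (Finset.sum_le_sum fun t _ => sub_le_sub_right
    (monotone_indicator_Iic (e t) (add_le_add_right (h t) x)) _) hr

lemma perturbation_le_perturbation {ϑ ϑ' : ℝ × (Fin p → ℝ)} {s s' : ℝ} (h : ‖ϑ' - ϑ‖ ≤ s' - s)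
    (y : ℤ → ℝ) (t : ℤ) : perturbation ϑ s y t ≤ perturbation ϑ' s' y t := by
  have hlinear := neg_le_of_abs_le ((abs_linear_le (ϑ' - ϑ) y t).trans
    (mul_le_mul_of_nonneg_right h (lagAbs_nonneg y t)))
  simp only [Prod.fst_sub, Prod.snd_sub, Pi.sub_apply, sub_mul, Finset.sum_sub_distrib] at hlinear
  rw [perturbation, perturbation]
  linarith

lemma changeSum_threshold_le (β : Fin p → ℝ) (hr : 0 ≤ r) {ϑ ϑ' : ℝ × (Fin p → ℝ)} {s s' : ℝ}
    (h : ‖ϑ' - ϑ‖ ≤ s' - s) (u w e : ℤ → ℝ) :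
    changeSum n r x (threshold β ϑ s r u w) e ≤ changeSum n r x (threshold β ϑ' s' r u w) e :=
  changeSum_mono hr (fun t => add_le_add_right
    (mul_le_mul_of_nonneg_left (perturbation_le_perturbation h _ t) hr) _) e

end Residuals

section UniformExpansion

variable {p : ℕ} {β : Fin p → ℝ}

/-- The error of the first order expansion of `changeSum` at the estimation error `ϑ`: the slope
`g₀` accounts for `ϑ`, the slope `g` for the widening by `s`, and `d` for the outliers. -/
def expansionError (β : Fin p → ℝ) (n : ℕ) (r x g g₀ d : ℝ) (ϑ : ℝ × (Fin p → ℝ)) (s : ℝ)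
    (u w e : ℤ → ℝ) : ℝ :=
  changeSum n r x (threshold β ϑ s r u w) e - g₀ * ϑ.1 - d
    - g * (s * (r ^ 2 * ∑ t ∈ Finset.Icc (1 : ℤ) n, lagAbs p u t))

/-- The bound for the mean of `expansionError` when the innovations follow a mixture law; the second
summand accounts for the replacement of the mixture by its main component. -/
def mixtureErrorBound (β : Fin p → ℝ) (Q : Measure ℝ) (C K κ σ Γ r : ℝ) : ℝ :=
  errorBound β Q C K κ σ Γ r + r * (C * K + Γ * (2 * (p + 1)))

lemma tendsto_mixtureErrorBound (β : Fin p → ℝ) (Q : Measure ℝ) [IsFiniteMeasure Q] {C K : ℝ}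
    (hC : 0 ≤ C) (hK : 0 ≤ K) (κ σ Γ : ℝ) :
    Tendsto (mixtureErrorBound β Q C K κ σ Γ) (𝓝[≥] 0) (𝓝 0) := by
  have hlinear : Tendsto (fun r : ℝ => r * (C * K + Γ * (2 * (p + 1)))) (𝓝[≥] 0) (𝓝 0) :=
    (Continuous.tendsto' (by fun_prop) _ _ (by simp)).mono_left nhdsWithin_le_nhds
  simpa only [add_zero, ← mixtureErrorBound.eq_def] using
    (tendsto_errorBound β Q hC hK κ σ Γ).add hlinear

/-- By monotonicity in the threshold, the expansion at `ϑ` is enclosed by the expansions at a nearby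
point, widened by `± η`. -/
lemma abs_changeSum_sub_le {n : ℕ} {r x g g₀ d C η : ℝ} (hr : 0 ≤ r) (hg : |g| ≤ C)
    (hg₀ : |g₀| ≤ C) {ϑ ϑ₀ : ℝ × (Fin p → ℝ)} (hϑ : ‖ϑ - ϑ₀‖ ≤ η) (u w e : ℤ → ℝ) :
    |changeSum n r x (threshold β ϑ 0 r u w) e - g₀ * ϑ.1 - d| ≤
      |expansionError β n r x g g₀ d ϑ₀ η u w e| + |expansionError β n r x g g₀ d ϑ₀ (-η) u w e|
        + C * η * (r ^ 2 * ∑ t ∈ Finset.Icc (1 : ℤ) n, lagAbs p u t + 1) := by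
  have hη : 0 ≤ η := (norm_nonneg _).trans hϑ
  have hupper := changeSum_threshold_le (n := n) (x := x) β hr
    (by rwa [norm_sub_rev, sub_zero] : ‖ϑ₀ - ϑ‖ ≤ η - 0) u w e
  have hlower := changeSum_threshold_le (n := n) (x := x) β hr
    (by rwa [zero_sub, neg_neg] : ‖ϑ - ϑ₀‖ ≤ 0 - -η) u w e
  have habs_upper := abs_le.1 (le_refl |expansionError β n r x g g₀ d ϑ₀ η u w e|)
  have habs_lower := abs_le.1 (le_refl |expansionError β n r x g g₀ d ϑ₀ (-η) u w e|)
  unfold expansionError at habs_upper habs_lower ⊢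
  set V := r ^ 2 * ∑ t ∈ Finset.Icc (1 : ℤ) n, lagAbs p u t
  have hV0 : 0 ≤ V := mul_nonneg (sq_nonneg r) (Finset.sum_nonneg fun t _ => lagAbs_nonneg u t)
  have hslope : |g₀ * (ϑ.1 - ϑ₀.1)| ≤ C * η := by
    rw [abs_mul]
    exact mul_le_mul hg₀ ((norm_fst_le (ϑ - ϑ₀)).trans hϑ) (abs_nonneg _) ((abs_nonneg _).trans hg₀)
  have hwiden : |g * (η * V)| ≤ C * (η * V) := by
    rw [abs_mul, abs_of_nonneg (mul_nonneg hη hV0)]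
    exact mul_le_mul_of_nonneg_right hg (mul_nonneg hη hV0)
  rw [abs_le] at hslope hwiden ⊢
  constructor <;> linarith [hslope.1, hslope.2, hwiden.1, hwiden.2, habs_upper.1, habs_upper.2,
    habs_lower.1, habs_lower.2]

variable {Ω : Type*} [MeasurableSpace Ω] {P : Measure Ω} [IsProbabilityMeasure P]
variable {Q : Measure ℝ} {κ : ℝ} {ε u z ξ : ℤ → Ω → ℝ} {n : ℕ} {r : ℝ}

namespace IsRegularModel

lemma boundedInMean_average_lagAbs {L : Measure ℝ} {q : ℝ}
    (hm : IsRegularModel P β L Q q κ ε u z ξ) (hκ : 0 ≤ κ) (hrn : r ^ 2 * n = 1) :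
    BoundedInMean P (fun ω => r ^ 2 * ∑ t ∈ Finset.Icc (1 : ℤ) n, lagAbs p (fun t => u t ω) t)
      (1 + p * κ) := by
  refine ((BoundedInMean.sum (s := Finset.Icc (1 : ℤ) n) fun t _ =>
    hm.boundedInMean_lagAbs hκ t).const_mul (r ^ 2)).mono (le_of_eq ?_)
  rw [abs_of_nonneg (sq_nonneg r), Finset.sum_const, Int.card_Icc, add_sub_cancel_right,
    Int.toNat_natCast, nsmul_eq_mul, ← mul_assoc, hrn, one_mul]

variable {G₀ H : Measure ℝ} [IsProbabilityMeasure Q] [IsProbabilityMeasure G₀]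
  [IsProbabilityMeasure H] {γ Γ σ C₀ C₁ x g₀ g₁ : ℝ}

lemma boundedInMean_expansionError
    (hm : IsRegularModel P β (mixtureLaw G₀ H r) Q (γ * r) κ ε u z ξ) (hκ : 0 ≤ κ)
    (hβ : 1 - ∑ j, β j ≠ 0) (hG₀ : IsSmoothCenteredLaw G₀) (hH : IsSmoothCenteredLaw H)
    (hσ : ∫ x, x ^ 2 ∂G₀ + ∫ x, x ^ 2 ∂H ≤ σ) (hF₀ : HasExpansion (fun y => cdf G₀ y) C₀ x g₀)
    (hF₁ : HasExpansion (fun y => cdf H y) C₁ x g₁) (hr : r ∈ Set.Icc 0 1) (hrn : r * √n = 1)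
    (hγ : γ ∈ Set.Icc 0 Γ) (ϑ : ℝ × (Fin p → ℝ)) (s : ℝ) :
    BoundedInMean P (fun ω => expansionError β n r x ((1 - r) * g₀ + r * g₁) g₀
        (γ * shift β (fun y => cdf G₀ y) Q x) ϑ s (fun t => u t ω) (fun t => z t ω * ξ t ω)
        (fun t => ε t ω))
      (mixtureErrorBound β Q (C₀ + C₁) (‖ϑ‖ + |s|) κ σ Γ r) := by
  have hL := memLp_mixtureLaw measurable_id' hG₀.finite_variance hH.finite_variance r
  have hLσ := (integral_sq_mixtureLaw_le hr hG₀.finite_variance hH.finite_variance).trans hσ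
  have hF := hF₀.mixture hF₁ hr (cdf_mixtureLaw (Q₀ := G₀) (Q₁ := H) hr)
  have hmixture := hm.boundedInMean_changeSum_sub hκ (mul_nonneg hγ.1 hr.1) hβ hL
    (hG₀.integral_mixtureLaw_eq_zero hH hr) hLσ hF ϑ s hr.1 hrn
    (mul_le_mul_of_nonneg_right hγ.2 hr.1)
  have hreplace := BoundedInMean.const (P := P) (r * ((g₁ - g₀) * ϑ.1 +
    γ * (shift β (fun y => cdf H y) Q x - shift β (fun y => cdf G₀ y) Q x)))
  refine ((hmixture.add hreplace).congr (Eventually.of_forall fun ω => ?_)).mono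
    (add_le_add_right ?_ _)
  · simp only [expansionError]
    rw [shift_mixtureLaw β Q x hr]
    linear_combination (-γ * ((1 - r) * shift β (fun y => cdf G₀ y) Q x
      + r * shift β (fun y => cdf H y) Q x)) * hrn
  · have hslope : |(g₁ - g₀) * ϑ.1| ≤ (C₀ + C₁) * (‖ϑ‖ + |s|) := by
      rw [abs_mul]
      refine mul_le_mul ((abs_sub _ _).trans ?_)
        ((norm_fst_le ϑ).trans (le_add_of_nonneg_right (abs_nonneg s))) (abs_nonneg _)
        (add_nonneg hF₀.nonneg hF₁.nonneg)
      linarith [hF₀.abs_slope_le, hF₁.abs_slope_le]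
    have hshift : |γ * (shift β (fun y => cdf H y) Q x - shift β (fun y => cdf G₀ y) Q x)| ≤
        Γ * (2 * (p + 1)) := by
      rw [abs_mul, abs_of_nonneg hγ.1]
      refine mul_le_mul hγ.2 ((abs_sub _ _).trans ?_) (abs_nonneg _) (hγ.1.trans hγ.2)
      linarith [abs_shift_cdf_le β H Q x, abs_shift_cdf_le β G₀ Q x]
    rw [abs_mul, abs_of_nonneg hr.1]
    exact mul_le_mul_of_nonneg_left ((abs_add_le _ _).trans (add_le_add hslope hshift)) hr.1

lemma exists_uniform_bound
    (hm : IsRegularModel P β (mixtureLaw G₀ H r) Q (γ * r) κ ε u z ξ) (hκ : 0 ≤ κ)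
    (hβ : 1 - ∑ j, β j ≠ 0) (hG₀ : IsSmoothCenteredLaw G₀) (hH : IsSmoothCenteredLaw H)
    (hσ : ∫ x, x ^ 2 ∂G₀ + ∫ x, x ^ 2 ∂H ≤ σ) (hF₀ : HasExpansion (fun y => cdf G₀ y) C₀ x g₀)
    (hF₁ : HasExpansion (fun y => cdf H y) C₁ x g₁) (hr : r ∈ Set.Icc 0 1) (hrn : r * √n = 1)
    (hγ : γ ∈ Set.Icc 0 Γ) (S : Finset (ℝ × (Fin p → ℝ))) {η : ℝ} (hη : 0 ≤ η) :
    ∃ Z : Ω → ℝ, BoundedInMean P Z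
        (∑ ϑ ∈ S, 2 * mixtureErrorBound β Q (C₀ + C₁) (‖ϑ‖ + η) κ σ Γ r
          + (C₀ + C₁) * η * (2 + p * κ)) ∧
      ∀ ω, ∀ ϑ : ℝ × (Fin p → ℝ), (∃ ϑ₀ ∈ S, ‖ϑ - ϑ₀‖ ≤ η) →
        |changeSum n r x
            (threshold β ϑ 0 r (fun t => u t ω) (fun t => z t ω * ξ t ω)) (fun t => ε t ω)
          - g₀ * ϑ.1 - γ * shift β (fun y => cdf G₀ y) Q x| ≤ Z ω := by
  set g := (1 - r) * g₀ + r * g₁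
  have hF := hF₀.mixture hF₁ hr (cdf_mixtureLaw (Q₀ := G₀) (Q₁ := H) hr)
  have hg₀ : |g₀| ≤ C₀ + C₁ := hF₀.abs_slope_le.trans (le_add_of_nonneg_right hF₁.nonneg)
  have hn : √(n : ℝ) * √n = n := Real.mul_self_sqrt n.cast_nonneg
  have hrn₂ : r ^ 2 * n = 1 := by rw [← hn]; linear_combination (r * √n + 1) * hrn
  let E (ϑ : ℝ × (Fin p → ℝ)) (s : ℝ) (ω : Ω) : ℝ := |expansionError β n r x g g₀
    (γ * shift β (fun y => cdf G₀ y) Q x) ϑ s (fun t => u t ω) (fun t => z t ω * ξ t ω)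
    (fun t => ε t ω)|
  have hE : ∀ ϑ s, |s| = η →
      BoundedInMean P (E ϑ s) (mixtureErrorBound β Q (C₀ + C₁) (‖ϑ‖ + η) κ σ Γ r) := by
    rintro ϑ s rfl
    exact (hm.boundedInMean_expansionError hκ hβ hG₀ hH hσ hF₀ hF₁ hr hrn hγ ϑ s).abs
  have hnet := BoundedInMean.sum (s := S) fun ϑ _ =>
    (hE ϑ η (abs_of_nonneg hη)).add (hE ϑ (-η) (by rw [abs_neg, abs_of_nonneg hη]))
  have hwiden := ((hm.boundedInMean_average_lagAbs hκ hrn₂).add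
    (BoundedInMean.const (P := P) 1)).const_mul ((C₀ + C₁) * η)
  refine ⟨_, (hnet.add hwiden).mono (le_of_eq ?_), ?_⟩
  · simp only [← two_mul]
    rw [abs_of_nonneg (mul_nonneg hF.nonneg hη), abs_one]
    ring
  · rintro ω ϑ ⟨ϑ₀, hϑ₀, hdist⟩
    refine (abs_changeSum_sub_le hr.1 hF.abs_slope_le hg₀ hdist _ _ _).trans
      (add_le_add_left ?_ _)
    exact Finset.single_le_sum (f := fun ϑ => E ϑ η ω + E ϑ (-η) ω)
      (fun ϑ _ => add_nonneg (abs_nonneg _) (abs_nonneg _)) hϑ₀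

end IsRegularModel

end UniformExpansion

section UniformInProbability

variable {Ω : ℕ → ℝ → Type*} [∀ n γ, MeasurableSpace (Ω n γ)] {P : ∀ n γ, Measure (Ω n γ)} {Γ : ℝ}

lemma UniformlyBoundedInProb.exists_eventually_le {E : Type*} [Norm E] {X : ∀ n γ, Ω n γ → E}
    (hX : UniformlyBoundedInProb P Γ X) {η : ENNReal} (hη : 0 < η) :
    ∃ C : ℝ, ∀ᶠ n in atTop, ∀ γ ∈ Set.Icc 0 Γ, P n γ {ω | C < ‖X n γ ω‖} ≤ η :=
  (hX η hη).imp fun _ hC => hC.mono fun _ hn => iSup₂_le_iff.1 hn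

lemma uniformlyTendstoZeroInProb_iff {X : ∀ n γ, Ω n γ → ℝ} :
    UniformlyTendstoZeroInProb P Γ X ↔ ∀ δ > 0, ∀ b > 0, ∀ᶠ n in atTop, ∀ γ ∈ Set.Icc 0 Γ,
      P n γ {ω | δ < |X n γ ω|} ≤ b := by
  simp only [UniformlyTendstoZeroInProb, ENNReal.tendsto_nhds_zero, iSup₂_le_iff]

lemma UniformlyTendstoZeroInProb.half_sub {X Y : ∀ n γ, Ω n γ → ℝ}
    (hX : UniformlyTendstoZeroInProb P Γ X) (hY : UniformlyTendstoZeroInProb P Γ Y) :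
    UniformlyTendstoZeroInProb P Γ fun n γ ω => (X n γ ω - Y n γ ω) / 2 := by
  rw [uniformlyTendstoZeroInProb_iff] at hX hY ⊢
  intro δ hδ b hb
  have hb₂ : 0 < b / 2 := ENNReal.half_pos hb.ne'
  filter_upwards [hX δ hδ _ hb₂, hY δ hδ _ hb₂] with n hXn hYn γ hγ
  calc P n γ {ω | δ < |(X n γ ω - Y n γ ω) / 2|}
      ≤ P n γ ({ω | δ < |X n γ ω|} ∪ {ω | δ < |Y n γ ω|}) := by
        refine measure_mono fun ω (hω : δ < |(X n γ ω - Y n γ ω) / 2|) => ?_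
        by_contra hno
        simp only [Set.mem_union, Set.mem_ofPred_eq, not_or, not_lt] at hno
        rw [abs_div, abs_two] at hω
        linarith [abs_sub (X n γ ω) (Y n γ ω)]
    _ ≤ b / 2 + b / 2 := (measure_union_le _ _).trans (add_le_add (hXn γ hγ) (hYn γ hγ))
    _ = b := ENNReal.add_halves b

lemma UniformlyBoundedInProb.uniformlyTendstoZeroInProb {E : Type*} [Norm E]
    {θ : ∀ n γ, Ω n γ → E} (hθ : UniformlyBoundedInProb P Γ θ) {X : ∀ n γ, Ω n γ → ℝ}
    (hX : ∀ K : ℝ, ∀ a > 0, ∀ᶠ n in atTop, ∀ γ ∈ Set.Icc 0 Γ, ∃ Z : Ω n γ → ℝ,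
      BoundedInMean (P n γ) Z a ∧ ∀ᵐ ω ∂P n γ, ‖θ n γ ω‖ ≤ K → |X n γ ω| ≤ Z ω) :
    UniformlyTendstoZeroInProb P Γ X := by
  rw [uniformlyTendstoZeroInProb_iff]
  intro δ hδ b hb
  have hb₂ : 0 < b / 2 := ENNReal.half_pos hb.ne'
  obtain ⟨e, he, heb⟩ := ENNReal.lt_iff_exists_nnreal_btwn.1 hb₂
  have he₀ : 0 < (e : ℝ) := by exact_mod_cast he
  obtain ⟨K, hK⟩ := hθ.exists_eventually_le hb₂
  filter_upwards [hK, hX K (e * δ) (mul_pos he₀ hδ)] with n hKn hXn γ hγ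
  obtain ⟨Z, hZ, hXZ⟩ := hXn γ hγ
  calc P n γ {ω | δ < |X n γ ω|} ≤ P n γ ({ω | K < ‖θ n γ ω‖} ∪ {ω | δ < |Z ω|}) := by
        refine measure_mono_ae ?_
        filter_upwards [hXZ] with ω hω (hδX : δ < |X n γ ω|)
        rcases lt_or_ge K ‖θ n γ ω‖ with hlarge | hsmall
        · exact Or.inl hlarge
        · exact Or.inr (hδX.trans_le ((hω hsmall).trans (le_abs_self _)))
    _ ≤ b / 2 + ENNReal.ofReal (e * δ / δ) :=
        (measure_union_le _ _).trans (add_le_add (hKn γ hγ) (hZ.measure_lt_le hδ))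
    _ ≤ b / 2 + b / 2 := by
        rw [mul_div_cancel_right₀ _ hδ.ne', ENNReal.ofReal_coe_nnreal]
        gcongr
    _ = b := ENNReal.add_halves b

end UniformInProbability

section EstimationError

lemma norm_estimationError_le {p : ℕ} (β : Fin p → ℝ) {μ R m K₁ K₂ : ℝ} {b : Fin p → ℝ}
    (hR : 1 ≤ R) (hm : ‖R * (m - μ)‖ ≤ K₁) (hb : ‖R • (b - β)‖ ≤ K₂) :
    ‖estimationError β μ R m b‖ ≤ max (K₁ * (|1 - ∑ j, β j| + p * K₂)) K₂ := by
  have hcoord : ∀ j, |b j - β j| ≤ K₂ := fun j => by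
    have hj := (norm_le_pi_norm (R • (b - β)) j).trans hb
    rw [Pi.smul_apply, Pi.sub_apply, smul_eq_mul, Real.norm_eq_abs, abs_mul,
      abs_of_pos (one_pos.trans_le hR)] at hj
    exact (le_mul_of_one_le_left (abs_nonneg _) hR).trans hj
  have hsum : |∑ j, (b j - β j)| ≤ p * K₂ :=
    (Finset.abs_sum_le_sum_abs _ _).trans
      ((Finset.sum_le_card_nsmul _ _ K₂ fun j _ => hcoord j).trans_eq (by simp))
  have hfactor : |1 - ∑ j, b j| ≤ |1 - ∑ j, β j| + p * K₂ := by
    have hsplit : 1 - ∑ j, b j = (1 - ∑ j, β j) - ∑ j, (b j - β j) := by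
      rw [Finset.sum_sub_distrib]
      ring
    rw [hsplit]
    exact (abs_sub _ _).trans (add_le_add_right hsum _)
  refine max_le_max ?_ hb
  rw [estimationError, norm_mul]
  exact mul_le_mul hm hfactor (norm_nonneg _) ((norm_nonneg _).trans hm)

lemma one_le_sqrt_natCast {n : ℕ} (hn : 1 ≤ n) : 1 ≤ √(n : ℝ) :=
  Real.one_le_sqrt.2 (by exact_mod_cast hn)

lemma uniformlyBoundedInProb_estimationError {p : ℕ} {β : Fin p → ℝ} {μ Γ : ℝ}
    {Ω : ℕ → ℝ → Type*} [∀ n γ, MeasurableSpace (Ω n γ)] {P : ∀ n γ, Measure (Ω n γ)}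
    {μhat : ∀ n γ, Ω n γ → ℝ} {βhat : ∀ n γ, Ω n γ → (Fin p → ℝ)}
    (hμrate : UniformlyBoundedInProb P Γ (fun n γ ω => √(n : ℝ) * (μhat n γ ω - μ)))
    (hβrate : UniformlyBoundedInProb P Γ (fun n γ ω => √(n : ℝ) • (βhat n γ ω - β))) :
    UniformlyBoundedInProb P Γ
      (fun n γ ω => estimationError β μ √(n : ℝ) (μhat n γ ω) (βhat n γ ω)) := by
  intro η hη
  have hη₂ : 0 < η / 2 := ENNReal.half_pos hη.ne'
  obtain ⟨K₁, hK₁⟩ := hμrate.exists_eventually_le hη₂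
  obtain ⟨K₂, hK₂⟩ := hβrate.exists_eventually_le hη₂
  refine ⟨max (K₁ * (|1 - ∑ j, β j| + p * K₂)) K₂, ?_⟩
  filter_upwards [hK₁, hK₂, eventually_ge_atTop 1] with n hμn hβn hn
  refine iSup₂_le fun γ hγ => ?_
  calc P n γ {ω | max (K₁ * (|1 - ∑ j, β j| + p * K₂)) K₂ <
        ‖estimationError β μ √(n : ℝ) (μhat n γ ω) (βhat n γ ω)‖}
      ≤ P n γ ({ω | K₁ < ‖√(n : ℝ) * (μhat n γ ω - μ)‖} ∪
          {ω | K₂ < ‖√(n : ℝ) • (βhat n γ ω - β)‖}) := by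
        refine measure_mono fun ω (hω : _ < ‖_‖) => ?_
        by_contra hno
        simp only [Set.mem_union, Set.mem_ofPred_eq, not_or, not_lt] at hno
        exact hω.not_ge (norm_estimationError_le β (one_le_sqrt_natCast hn) hno.1 hno.2)
    _ ≤ η / 2 + η / 2 := (measure_union_le _ _).trans (add_le_add (hμn γ hγ) (hβn γ hγ))
    _ = η := ENNReal.add_halves η

end EstimationError

section AsymptoticLinearity

lemma exists_finset_forall_norm_sub_le {E : Type*} [NormedAddCommGroup E] [ProperSpace E] (K : ℝ)
    {η : ℝ} (hη : 0 < η) :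
    ∃ S : Finset E, ∀ ϑ : E, ‖ϑ‖ ≤ K → ∃ ϑ₀ ∈ S, ‖ϑ - ϑ₀‖ ≤ η := by
  obtain ⟨S, -, hS, hcover⟩ := (isCompact_closedBall (0 : E) K).finite_cover_balls hη
  refine ⟨hS.toFinset, fun ϑ hϑ => ?_⟩
  obtain ⟨ϑ₀, hmem, hball⟩ := Set.mem_iUnion₂.1 (hcover (mem_closedBall_zero_iff.2 hϑ))
  exact ⟨ϑ₀, hS.mem_toFinset.2 hmem, (mem_ball_iff_norm.1 hball).le⟩

lemma tendsto_one_div_sqrt_natCast :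
    Tendsto (fun n : ℕ => 1 / √(n : ℝ)) atTop (𝓝[≥] 0) := by
  refine tendsto_nhdsWithin_iff.2 ⟨?_, Eventually.of_forall fun n => ?_⟩
  · simp only [one_div]
    exact (Real.tendsto_sqrt_atTop.comp tendsto_natCast_atTop_atTop).inv_tendsto_atTop
  · exact one_div_nonneg.2 (Real.sqrt_nonneg _)

lemma exists_net_eventually_mixtureErrorBound_le {p : ℕ} (β : Fin p → ℝ) (Q : Measure ℝ)
    [IsFiniteMeasure Q] {C : ℝ} (hC : 0 ≤ C) (κ σ Γ K : ℝ) {a : ℝ} (ha : 0 < a) :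
    ∃ (S : Finset (ℝ × (Fin p → ℝ))) (η : ℝ), 0 ≤ η ∧
      (∀ ϑ, ‖ϑ‖ ≤ K → ∃ ϑ₀ ∈ S, ‖ϑ - ϑ₀‖ ≤ η) ∧
      ∀ᶠ r in 𝓝[≥] 0, ∑ ϑ ∈ S, 2 * mixtureErrorBound β Q C (‖ϑ‖ + η) κ σ Γ r
        + C * η * (2 + p * κ) ≤ a := by
  obtain ⟨η, hη, hηa⟩ := exists_pos_mul_lt (half_pos ha) (C * (2 + p * κ))
  obtain ⟨S, hS⟩ := exists_finset_forall_norm_sub_le (E := ℝ × (Fin p → ℝ)) K hη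
  refine ⟨S, η, hη.le, hS, ?_⟩
  have hlim : Tendsto (fun r => ∑ ϑ ∈ S, 2 * mixtureErrorBound β Q C (‖ϑ‖ + η) κ σ Γ r)
      (𝓝[≥] 0) (𝓝 0) := by
    simpa only [mul_zero, Finset.sum_const_zero] using tendsto_finsetSum S fun ϑ _ =>
      (tendsto_mixtureErrorBound β Q hC (by positivity : 0 ≤ ‖ϑ‖ + η) κ σ Γ).const_mul 2
  filter_upwards [hlim.eventually_le_const (half_pos ha)] with r hr
  linarith

lemma contaminationLevel_eq_mul {γ : ℝ} {n : ℕ} (hn : 1 ≤ n) (hγ : γ ≤ √(n : ℝ)) :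
    contaminationLevel γ n = γ * (1 / √(n : ℝ)) := by
  rw [contaminationLevel, mul_one_div, min_eq_right]
  exact (div_le_one (one_pos.trans_le (one_le_sqrt_natCast hn))).2 hγ

lemma eLpNorm_two_le_ofReal_sqrt {Ω : Type*} [MeasurableSpace Ω] {P : Measure Ω} {X : Ω → ℝ}
    (hX : MemLp X 2 P) {σ : ℝ} (h : ∫ ω, X ω ^ 2 ∂P ≤ σ) : eLpNorm X 2 P ≤ ENNReal.ofReal √σ := by
  rw [hX.eLpNorm_eq_integral_rpow_norm (by norm_num) (by norm_num)]
  refine ENNReal.ofReal_le_ofReal ?_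
  simp only [ENNReal.toReal_ofNat, Real.rpow_ofNat, Real.norm_eq_abs, sq_abs]
  rw [Real.sqrt_eq_rpow, one_div]
  exact Real.rpow_le_rpow (integral_nonneg fun _ => sq_nonneg _) h (by norm_num)

variable {p : ℕ} {β : Fin p → ℝ} {ν μ : ℝ} {Q G₀ H : Measure ℝ} [IsProbabilityMeasure G₀]
  [IsProbabilityMeasure H]

lemma IsContaminatedAR.exists_mixture_isRegularModel {Ω : Type*} [MeasurableSpace Ω]
    {P : Measure Ω} [IsProbabilityMeasure P] {n : ℕ} {γ : ℝ} {ε v z ξ : ℤ → Ω → ℝ}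
    (h : IsContaminatedAR P β ν (mixtureCdf G₀ H n) (contaminationLevel γ n) Q ε v z ξ)
    (hn : 1 ≤ n) (hγ : γ ∈ Set.Icc 0 √(n : ℝ)) (hν : ν = (1 - ∑ j, β j) * μ) {ψ ρ : ℕ → ℝ}
    (hψ : IsCausalExpansion β ψ ρ) (hG₀ : IsSmoothCenteredLaw G₀) (hH : IsSmoothCenteredLaw H) :
    ∃ u : ℤ → Ω → ℝ, IsRegularModel P β (mixtureLaw G₀ H (1 / √(n : ℝ))) Q
        (γ * (1 / √(n : ℝ))) ((∑' i, |ψ i|) * √(∫ x, x ^ 2 ∂G₀ + ∫ x, x ^ 2 ∂H)) ε u z ξ ∧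
      ∀ᵐ ω ∂P, ∀ t, v t ω = u t ω + μ := by
  have hsqrt := one_le_sqrt_natCast hn
  have hr : 1 / √(n : ℝ) ∈ Set.Icc 0 1 :=
    ⟨by positivity, (div_le_one (one_pos.trans_le hsqrt)).2 hsqrt⟩
  have _ := isProbabilityMeasure_mixtureLaw (Q₀ := G₀) (Q₁ := H) hr
  have hlevel : contaminationLevel γ n ∈ Set.Icc 0 1 :=
    ⟨le_min zero_le_one (div_nonneg hγ.1 (Real.sqrt_nonneg _)), min_le_left _ _⟩
  have hnorm := eLpNorm_two_le_ofReal_sqrt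
    (memLp_mixtureLaw measurable_id' hG₀.finite_variance hH.finite_variance _)
    (integral_sq_mixtureLaw_le hr hG₀.finite_variance hH.finite_variance)
  rw [← contaminationLevel_eq_mul hn hγ.2]
  exact h.exists_isRegularModel hlevel hν hψ (fun x => cdf_mixtureLaw hr x)
    (Real.sqrt_nonneg _) hnorm

variable [IsProbabilityMeasure Q] {Γ : ℝ} {Ω : ℕ → ℝ → Type*} [∀ n γ, MeasurableSpace (Ω n γ)]
  {P : ∀ n γ, Measure (Ω n γ)} [∀ n γ, IsProbabilityMeasure (P n γ)]
  {ε v z ξ y : ∀ n γ, ℤ → Ω n γ → ℝ}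

lemma eventually_exists_uniform_expansion (hβ : RootsInUnitDisc β)
    (hν : ν = (1 - ∑ j, β j) * μ) (hG₀ : IsSmoothCenteredLaw G₀) (hH : IsSmoothCenteredLaw H)
    (hmodel : ∀ n : ℕ, 1 ≤ n → ∀ γ ∈ Set.Icc 0 Γ,
      IsContaminatedAR (P n γ) β ν (mixtureCdf G₀ H n) (contaminationLevel γ n) Q
        (ε n γ) (v n γ) (z n γ) (ξ n γ)) (x K : ℝ) {a : ℝ} (ha : 0 < a) :
    ∀ᶠ n : ℕ in atTop, ∀ γ ∈ Set.Icc 0 Γ, ∃ (u : ℤ → Ω n γ → ℝ) (Z : Ω n γ → ℝ),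
      (∀ᵐ ω ∂P n γ, ∀ t, v n γ t ω = u t ω + μ) ∧
      (∀ᵐ ω ∂P n γ, SolvesAR β (fun t => u t ω) (fun t => ε n γ t ω)) ∧
      BoundedInMean (P n γ) Z a ∧
      ∀ ω, ∀ ϑ : ℝ × (Fin p → ℝ), ‖ϑ‖ ≤ K →
        |changeSum n (1 / √(n : ℝ)) x (threshold β ϑ 0 (1 / √(n : ℝ)) (fun t => u t ω)
            (fun t => z n γ t ω * ξ n γ t ω)) (fun t => ε n γ t ω)
          - deriv (fun y => cdf G₀ y) x * ϑ.1 - γ * shift β (fun y => cdf G₀ y) Q x| ≤ Z ω := by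
  obtain ⟨ψ, ρ, hψ⟩ := hβ.exists_isCausalExpansion
  obtain ⟨C₀, hC₀⟩ := hG₀.exists_hasExpansion
  obtain ⟨C₁, hC₁⟩ := hH.exists_hasExpansion
  set σ := ∫ x, x ^ 2 ∂G₀ + ∫ x, x ^ 2 ∂H
  set κ := (∑' i, |ψ i|) * √σ
  have hκ : 0 ≤ κ := mul_nonneg (tsum_nonneg fun _ => abs_nonneg _) (Real.sqrt_nonneg _)
  obtain ⟨S, η, hη, hS, hbound⟩ := exists_net_eventually_mixtureErrorBound_le β Q
    (add_nonneg (hC₀ x).nonneg (hC₁ x).nonneg) κ σ Γ K ha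
  have hsqrt_ge : ∀ᶠ n : ℕ in atTop, Γ ≤ √(n : ℝ) :=
    (Real.tendsto_sqrt_atTop.comp tendsto_natCast_atTop_atTop).eventually_ge_atTop Γ
  filter_upwards [eventually_ge_atTop 1, hsqrt_ge,
    tendsto_one_div_sqrt_natCast.eventually hbound] with n hn hΓn hboundn γ hγ
  have hsqrt := one_le_sqrt_natCast hn
  have hr : 1 / √(n : ℝ) ∈ Set.Icc 0 1 :=
    ⟨by positivity, (div_le_one (one_pos.trans_le hsqrt)).2 hsqrt⟩
  obtain ⟨u, hu, hvu⟩ := (hmodel n hn γ hγ).exists_mixture_isRegularModel hn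
    ⟨hγ.1, hγ.2.trans hΓn⟩ hν hψ hG₀ hH
  obtain ⟨Z, hZ, hexpansion⟩ := hu.exists_uniform_bound hκ hβ.one_sub_sum_ne_zero hG₀ hH le_rfl
    (hC₀ x) (hC₁ x) hr (one_div_mul_cancel (one_pos.trans_le hsqrt).ne') hγ S hη
  exact ⟨u, Z, hvu, hu.equation, hZ.mono hboundn, fun ω ϑ hϑ => hexpansion ω ϑ (hS ϑ hϑ)⟩

variable {μhat : ∀ n γ, Ω n γ → ℝ} {βhat : ∀ n γ, Ω n γ → (Fin p → ℝ)}

lemma uniformlyTendstoZeroInProb_residual_edf (hβ : RootsInUnitDisc β)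
    (hν : ν = (1 - ∑ j, β j) * μ)
    (hy : ∀ n γ t ω, y n γ t ω = v n γ t ω + z n γ t ω * ξ n γ t ω)
    (hμrate : UniformlyBoundedInProb P Γ (fun n γ ω => √(n : ℝ) * (μhat n γ ω - μ)))
    (hβrate : UniformlyBoundedInProb P Γ (fun n γ ω => √(n : ℝ) • (βhat n γ ω - β)))
    (hG₀ : IsSmoothCenteredLaw G₀) (hH : IsSmoothCenteredLaw H)
    (hmodel : ∀ n : ℕ, 1 ≤ n → ∀ γ ∈ Set.Icc 0 Γ,
      IsContaminatedAR (P n γ) β ν (mixtureCdf G₀ H n) (contaminationLevel γ n) Q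
        (ε n γ) (v n γ) (z n γ) (ξ n γ)) (x : ℝ) :
    UniformlyTendstoZeroInProb P Γ (fun n γ ω => √(n : ℝ) *
        (edf n (arResidual (fun t => y n γ t ω) (μhat n γ ω) (βhat n γ ω)) x
          - edf n (fun t => ε n γ t ω) x)
        - deriv (fun y => cdf G₀ y) x *
          (estimationError β μ √(n : ℝ) (μhat n γ ω) (βhat n γ ω)).1
        - γ * shift β (fun y => cdf G₀ y) Q x) := by
  refine (uniformlyBoundedInProb_estimationError hμrate hβrate).uniformlyTendstoZeroInProb
    fun K a ha => ?_
  filter_upwards [eventually_exists_uniform_expansion hβ hν hG₀ hH hmodel x K ha,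
    eventually_ge_atTop 1] with n hn hn₁ γ hγ
  obtain ⟨u, Z, hvu, hu, hZ, hexpansion⟩ := hn γ hγ
  refine ⟨Z, hZ, ?_⟩
  filter_upwards [hvu, hu] with ω hvuω huω hK
  have hresidual := arResidual_eq_sub_threshold (r := 1 / √(n : ℝ))
    (w := fun t => z n γ t ω * ξ n γ t ω) (y := fun t => y n γ t ω)
    (one_div_mul_cancel (one_pos.trans_le (one_le_sqrt_natCast hn₁)).ne')
    (fun s => by rw [hy, hvuω s]) huω (μhat n γ ω) (βhat n γ ω)
  rw [sqrt_mul_edf_sub_eq_changeSum hresidual]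
  exact hexpansion ω _ hK

end AsymptoticLinearity

section Symmetrization

variable {p : ℕ} {β : Fin p → ℝ} {ν μ : ℝ} {Q G₀ H : Measure ℝ} [IsProbabilityMeasure G₀]
  [IsProbabilityMeasure H] [IsProbabilityMeasure Q] {Γ : ℝ} {Ω : ℕ → ℝ → Type*}
  [∀ n γ, MeasurableSpace (Ω n γ)] {P : ∀ n γ, Measure (Ω n γ)}
  [∀ n γ, IsProbabilityMeasure (P n γ)] {ε v z ξ y : ∀ n γ, ℤ → Ω n γ → ℝ}
  {μhat : ∀ n γ, Ω n γ → ℝ} {βhat : ∀ n γ, Ω n γ → (Fin p → ℝ)}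

lemma mixtureCdf_self (G : Measure ℝ) (n : ℕ) : mixtureCdf G G n = fun x => cdf G x := by
  funext x
  rw [mixtureCdf]
  ring

lemma uniformlyTendstoZeroInProb_symmetrize (hβ : RootsInUnitDisc β)
    (hν : ν = (1 - ∑ j, β j) * μ)
    (hy : ∀ n γ t ω, y n γ t ω = v n γ t ω + z n γ t ω * ξ n γ t ω)
    (hμrate : UniformlyBoundedInProb P Γ (fun n γ ω => √(n : ℝ) * (μhat n γ ω - μ)))
    (hβrate : UniformlyBoundedInProb P Γ (fun n γ ω => √(n : ℝ) • (βhat n γ ω - β)))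
    (hG₀ : IsSmoothCenteredLaw G₀) (hH : IsSmoothCenteredLaw H) (hsym : IsSymmetricCdf G₀)
    (hmodel : ∀ n : ℕ, 1 ≤ n → ∀ γ ∈ Set.Icc 0 Γ,
      IsContaminatedAR (P n γ) β ν (mixtureCdf G₀ H n) (contaminationLevel γ n) Q
        (ε n γ) (v n γ) (z n γ) (ξ n γ)) (x : ℝ) :
    UniformlyTendstoZeroInProb P Γ (fun n γ ω =>
        √(n : ℝ) *
          (symmetrize (edf n
              (arResidual (fun t => y n γ t ω) (μhat n γ ω) (βhat n γ ω))) x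
            - symmetrize (edf n (fun t => ε n γ t ω)) x)
          - γ * symmShift β (fun x => cdf G₀ x) Q x) := by
  have hexpansion := uniformlyTendstoZeroInProb_residual_edf hβ hν hy hμrate hβrate hG₀ hH hmodel
  convert (hexpansion x).half_sub (hexpansion (-x)) using 4 with n γ ω
  rw [hsym.deriv_neg]
  simp only [symmetrize, symmShift]
  ring

end Symmetrization

end ResidualAR

end

theorem mainTheorem3 {p : ℕ} (β : Fin p → ℝ) (hβ : ResidualAR.RootsInUnitDisc β)
    (ν μ : ℝ) (hμ : ν = (1 - ∑ j, β j) * μ)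
    (Q : Measure ℝ) [IsProbabilityMeasure Q] (Γ : ℝ) (hΓ : 0 ≤ Γ)
    {Ω : ℕ → ℝ → Type*} [∀ n γ, MeasurableSpace (Ω n γ)]
    (P : ∀ n γ, Measure (Ω n γ)) [∀ n γ, IsProbabilityMeasure (P n γ)]
    (ε v z ξ y : ∀ n γ, ℤ → Ω n γ → ℝ)
    (hy : ∀ n γ t ω, y n γ t ω = v n γ t ω + z n γ t ω * ξ n γ t ω)
    (μhat : ∀ n γ, Ω n γ → ℝ) (hμhat : ∀ n γ, Measurable (μhat n γ))
    (βhat : ∀ n γ, Ω n γ → (Fin p → ℝ)) (hβhat : ∀ n γ, Measurable (βhat n γ))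
    (hμrate : ResidualAR.UniformlyBoundedInProb P Γ
      (fun n γ ω => √(n : ℝ) * (μhat n γ ω - μ)))
    (hβrate : ResidualAR.UniformlyBoundedInProb P Γ
      (fun n γ ω => √(n : ℝ) • (βhat n γ ω - β))) :
    -- first situation: the innovation distribution function `G` does not depend on `n`
    (∀ (G : Measure ℝ) [IsProbabilityMeasure G],
      ResidualAR.IsSmoothCenteredLaw G → ResidualAR.IsSymmetricCdf G →
      (∀ n : ℕ, 1 ≤ n → ∀ γ ∈ Set.Icc 0 Γ,
        ResidualAR.IsContaminatedAR (P n γ) β ν (fun x => cdf G x)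
          (ResidualAR.contaminationLevel γ n) Q (ε n γ) (v n γ) (z n γ) (ξ n γ)) →
      ∀ x : ℝ, ResidualAR.UniformlyTendstoZeroInProb P Γ (fun n γ ω =>
        √(n : ℝ) *
          (ResidualAR.symmetrize (ResidualAR.edf n
              (ResidualAR.arResidual (fun t => y n γ t ω) (μhat n γ ω) (βhat n γ ω))) x
            - ResidualAR.symmetrize (ResidualAR.edf n (fun t => ε n γ t ω)) x)
          - γ * ResidualAR.symmShift β (fun x => cdf G x) Q x)) ∧
    -- second situation: the innovation distribution function is the mixture `A_n` of `G₀`, `H`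
    (∀ (G₀ H : Measure ℝ) [IsProbabilityMeasure G₀] [IsProbabilityMeasure H],
      ResidualAR.IsSmoothCenteredLaw G₀ → ResidualAR.IsSmoothCenteredLaw H →
      ResidualAR.IsSymmetricCdf G₀ →
      (∀ n : ℕ, 1 ≤ n → ∀ γ ∈ Set.Icc 0 Γ,
        ResidualAR.IsContaminatedAR (P n γ) β ν (ResidualAR.mixtureCdf G₀ H n)
          (ResidualAR.contaminationLevel γ n) Q (ε n γ) (v n γ) (z n γ) (ξ n γ)) →
      ∀ x : ℝ, ResidualAR.UniformlyTendstoZeroInProb P Γ (fun n γ ω =>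
        √(n : ℝ) *
          (ResidualAR.symmetrize (ResidualAR.edf n
              (ResidualAR.arResidual (fun t => y n γ t ω) (μhat n γ ω) (βhat n γ ω))) x
            - ResidualAR.symmetrize (ResidualAR.edf n (fun t => ε n γ t ω)) x)
          - γ * ResidualAR.symmShift β (fun x => cdf G₀ x) Q x)) := by
  refine ⟨fun G _ hG hsym hmodel => ?_, fun G₀ H _ _ hG₀ hH hsym hmodel => ?_⟩
  · exact ResidualAR.uniformlyTendstoZeroInProb_symmetrize hβ hμ hy hμrate hβrate hG hG hsym
      (by simpa only [ResidualAR.mixtureCdf_self] using hmodel)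
  · exact ResidualAR.uniformlyTendstoZeroInProb_symmetrize hβ hμ hy hμrate hβrate hG₀ hH hsym hmodel
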